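/- Let $N\ge 1$ and $l\ge 1$ be integers and let $\alpha>0$, $p>1$, $a>0$, $\beta\ge 1$ be real numbers with $0<\alpha p<N$ and $l\beta>\frac{N(p-1)}{N-\alpha p}$. Write $B_t(x)$ for the open ball of centre $x$ and radius $t$ in $\mathbb{R}^N$, $B_R=B_R(0)$, and identify a nonnegative measurable function $g$ with the measure $g\,dx$. "Measurable function" means Lebesgue measurable, with values in $[0,\infty]$, and "measure" means positive Radon measure on $\mathbb{R}^N$. Put - $H_l(r)=e^r-\sum_{j=0}^{l-1}\frac{r^j}{j!}$ and $P_{l,a,\beta}(r)=H_l(ar^\beta)$ for $r\ge 0$, with $P_{l,a,\beta}(\infty)=\infty$; - $\mathbf W_{\alpha,p}[\nu](x)=\int_0^\infty\Big(\frac{\nu(B_t(x))}{t^{N-\alpha p}}\Big)^{\frac1{p-1}}\frac{dt}{t}$; - $\mathbf M_{\alpha p}^{\eta}[\nu](x)=\sup_{t>0}\frac{\nu(B_t(x))}{t^{N-\alpha p}h_\eta(t)}$, where $h_\eta(t)=(-\ln t)^{-\eta}$ for $0<t\le\frac12$ and $h_\eta(t)=(\ln 2)^{-\eta}$ for $t>\frac12$;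 below $\eta=\frac{(p-1)(\beta-1)}{\beta}$; - $c_p=\max\{1,4^{\frac{2-p}{p-1}}\}$; - for $s\ge0$, $Q_p(s)=\sum_{q=l}^\infty\frac{s^{\beta q/(p-1)}}{q^{\beta q/(p-1)}\,q!}$ if $p\ne2$ and $Q_p(s)=H_l(s^\beta)$ if $p=2$; $Q_p^*(r)=\sup\{rs-Q_p(s):s\ge0\}$ for $r\ge 0$; - $\mathbf I_{\alpha p}(x)=\frac{1}{N-\alpha p}|x|^{-(N-\alpha p)}$ and $\mathrm{Cap}_{\mathbf I_{\alpha p},Q_p^*}(E)=\inf\Big\{\int_{\mathbb{R}^N}Q_p^*(g)\,dx:\ g\ge0 \text{ measurable and finite},\ \mathbf I_{\alpha p}*g\ge\chi_E \text{ everywhere},\ Q_p^*(g)\in L^1(\mathbb{R}^N)\Big\}$, with $\inf\emptyset=\infty$. **Existence.** For all $\varepsilon>0$ and $R>0$ there is $M>0$, depending only on $N,\alpha,p,l,a,\beta,\varepsilon,R$, with the following property. Let $f$ be a nonnegative measurable function vanishing almost everywhere outside $B_R$ such that $\mu_1=P_{l,a+\varepsilon,\beta}(f)$ is locally integrable, and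 let $\mu$ be a measure with $\mu(\mathbb{R}^N\setminus B_R)=0$. If $$\|\mathbf M_{\alpha p}^{\eta}[\mu]\|_{L^\infty(\mathbb{R}^N)}\le M\quad\text{and}\quad\|\mathbf M_{\alpha p}^{\eta}[\mu_1]\|_{L^\infty(\mathbb{R}^N)}\le M,$$ then there is a nonnegative measurable function $u$ with $P_{l,a,\beta}(u)\in L^1(\mathbb{R}^N)$ such that, at every point of $\mathbb{R}^N$, $$u=\mathbf W_{\alpha,p}[P_{l,a,\beta}(u)+\mu]+f$$ and $$u\le F:=2c_p\mathbf W_{\alpha,p}[\omega_1]+2c_p\mathbf W_{\alpha,p}[\omega_2]+f,$$ where $\omega_1=M\,\|\mathbf M_{\alpha p}^{\eta}[\chi_{B_R}]\|_{L^\infty(\mathbb{R}^N)}^{-1}\chi_{B_R}+\mu$ and $\omega_2=M\,\|\mathbf M_{\alpha p}^{\eta}[\chi_{B_R}]\|_{L^\infty(\mathbb{R}^N)}^{-1}\chi_{B_R}+\mu_1$; moreover $P_{l,a,\beta}(F)\in L^1(\mathbb{R}^N)$. **Converse.** There is $C>0$, depending only on $N,\alpha,p,l,a,\beta$, such that, for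 every nonnegative measurable function $f$ and every measure $\mu$ (not assumed to be supported in a ball, nor to be small), if $u$ is a nonnegative measurable function with $P_{l,a,\beta}(u)\in L^1(\mathbb{R}^N)$ and $u=\mathbf W_{\alpha,p}[P_{l,a,\beta}(u)+\mu]+f$ almost everywhere in $\mathbb{R}^N$, then $$\int_E P_{l,a,\beta}(u)\,dx+\int_E P_{l,a,\beta}(f)\,dx+\mu(E)\le C\,\mathrm{Cap}_{\mathbf I_{\alpha p},Q_p^*}(E)\qquad\text{for every Borel set }E\subset\mathbb{R}^N.$$ -/

import Mathlib

open MeasureTheory Set Metric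
open scoped NNReal ENNReal

namespace WolffExp

noncomputable section

/-- The `l`-truncated exponential `H_l(r) = e^r - ∑_{j < l} r^j / j!`. -/
def truncExp (l : ℕ) (r : ℝ) : ℝ :=
  Real.exp r - ∑ j ∈ Finset.range l, r ^ j / (j.factorial : ℝ)

/-- `P_{l,a,β}(r) = H_l(a r^β)` for a finite `r ≥ 0`. -/
def reactionReal (l : ℕ) (a β r : ℝ) : ℝ :=
  truncExp l (a * r ^ β)

/-- `P_{l,a,β}` on `[0,∞]`, with `P_{l,a,β}(∞) = ∞`. The functions `f` and `u` take values in
`[0,∞]`, since a potential may be infinite on a Lebesgue null set. -/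
def reaction (l : ℕ) (a β : ℝ) (r : ℝ≥0∞) : ℝ≥0∞ :=
  if r = ∞ then ∞ else ENNReal.ofReal (reactionReal l a β r.toReal)

/-- The measure `P_{l,a,β}(v) dx`. -/
def reactionMeasure {N : ℕ} (l : ℕ) (a β : ℝ) (v : EuclideanSpace ℝ (Fin N) → ℝ≥0∞) :
    Measure (EuclideanSpace ℝ (Fin N)) :=
  volume.withDensity (fun x => reaction l a β (v x))

/-- The (untruncated) Wolff potential
`W_{α,s}[μ](x) = ∫_0^∞ (μ(B_t(x)) / t^{N - α s})^{1/(s-1)} dt/t`. -/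
def wolff {N : ℕ} (α s : ℝ) (μ : Measure (EuclideanSpace ℝ (Fin N)))
    (x : EuclideanSpace ℝ (Fin N)) : ℝ≥0∞ :=
  ∫⁻ t in Ioi (0 : ℝ),
    (μ (ball x t) / ENNReal.ofReal (t ^ ((N : ℝ) - α * s))) ^ (1 / (s - 1)) / ENNReal.ofReal t

/-- The weight `h_η(t) = (-ln t)^{-η}` for `0 < t ≤ 1/2` and `(ln 2)^{-η}` for `t ≥ 1/2`. -/
def logWeight (η t : ℝ) : ℝ :=
  if t ≤ 1 / 2 then (-Real.log t) ^ (-η) else (Real.log 2) ^ (-η)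

/-- The (untruncated) `η`-fractional maximal potential
`M_γ^η[μ](x) = sup_{t > 0} μ(B_t(x)) / (t^{N - γ} h_η(t))`. -/
def fracMaximal {N : ℕ} (γ η : ℝ) (μ : Measure (EuclideanSpace ℝ (Fin N)))
    (x : EuclideanSpace ℝ (Fin N)) : ℝ≥0∞ :=
  ⨆ (t : ℝ) (_ : 0 < t),
    μ (ball x t) / ENNReal.ofReal (t ^ ((N : ℝ) - γ) * logWeight η t)

/-- `‖M_{αp}^{(p-1)(β-1)/β}[μ]‖_{L^∞(ℝ^N)}`. -/
def maximalNorm {N : ℕ} (α p β : ℝ) (μ : Measure (EuclideanSpace ℝ (Fin N))) : ℝ≥0∞ :=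
  eLpNorm (fracMaximal (α * p) ((p - 1) * (β - 1) / β) μ) ∞ volume

/-- `M ‖M_{αp}^{(p-1)(β-1)/β}[χ_{B_R}]‖_{L^∞}^{-1} χ_{B_R} dx + ν`. -/
def augmented {N : ℕ} (α p β R M : ℝ) (ν : Measure (EuclideanSpace ℝ (Fin N))) :
    Measure (EuclideanSpace ℝ (Fin N)) :=
  (ENNReal.ofReal M *
      (maximalNorm α p β (volume.restrict (ball (0 : EuclideanSpace ℝ (Fin N)) R)))⁻¹) •
    volume.restrict (ball (0 : EuclideanSpace ℝ (Fin N)) R) + ν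

/-- The constant `c_p = max(1, 4^{(2-p)/(p-1)})`. -/
def cConst (p : ℝ) : ℝ :=
  max 1 ((4 : ℝ) ^ ((2 - p) / (p - 1)))

/-- The function `F = 2 c_p W_{α,p}[ω₁] + 2 c_p W_{α,p}[ω₂] + f`, where
`ω₁ = M ‖M_{αp}^{(p-1)(β-1)/β}[χ_{B_R}]‖^{-1} χ_{B_R} + μ` and
`ω₂ = M ‖M_{αp}^{(p-1)(β-1)/β}[χ_{B_R}]‖^{-1} χ_{B_R} + P_{l,a+ε,β}(f)`. -/
def upperBound {N : ℕ} (α p : ℝ) (l : ℕ) (a β ε R M : ℝ)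
    (f : EuclideanSpace ℝ (Fin N) → ℝ≥0∞) (μ : Measure (EuclideanSpace ℝ (Fin N)))
    (x : EuclideanSpace ℝ (Fin N)) : ℝ≥0∞ :=
  2 * ENNReal.ofReal (cConst p) * wolff α p (augmented α p β R M μ) x +
    2 * ENNReal.ofReal (cConst p) *
      wolff α p (augmented α p β R M (reactionMeasure l (a + ε) β f)) x +
    f x

/-- The Young function `Q_p`, on `s ≥ 0`: `H_l(s^β)` if `p = 2`, and otherwise
`∑_{q ≥ l} s^{βq/(p-1)} / (q^{βq/(p-1)} q!)`, the summation index being `q = k + l`. -/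
def youngQ (p : ℝ) (l : ℕ) (β s : ℝ) : ℝ :=
  if p = 2 then truncExp l (s ^ β)
  else ∑' k : ℕ, s ^ (β * ((k + l : ℕ) : ℝ) / (p - 1)) /
    (((k + l : ℕ) : ℝ) ^ (β * ((k + l : ℕ) : ℝ) / (p - 1)) * ((k + l).factorial : ℝ))

/-- The complementary function `Q_p^*(r) = sup {r s - Q_p(s) : s ≥ 0}`, `r ≥ 0`, in `[0,∞]`.
Discarding the negative values `r s - Q_p(s)` does not change the supremum, because
`Q_p(0) = 0`. -/
def youngQStar (p : ℝ) (l : ℕ) (β : ℝ) (r : ℝ≥0) : ℝ≥0∞ :=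
  ⨆ s : ℝ≥0, ENNReal.ofReal ((r : ℝ) * s - youngQ p l β s)

/-- The Riesz kernel `I_γ(x) = (N - γ)^{-1} |x|^{-(N-γ)}` (infinite at the origin). -/
def rieszKernel {N : ℕ} (γ : ℝ) (x : EuclideanSpace ℝ (Fin N)) : ℝ≥0∞ :=
  (ENNReal.ofReal ((N : ℝ) - γ))⁻¹ * ‖x‖ₑ ^ (-((N : ℝ) - γ))

/-- The Orlicz-Riesz capacity `Cap_{I_γ, Q_p^*}(E)`: the infimum of `∫ Q_p^*(g) dx` over the
measurable `g ≥ 0` with `I_γ * g ≥ χ_E` everywhere and `Q_p^*(g) ∈ L^1(ℝ^N)`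
(`∞` if there is no such `g`). -/
def rieszCapacity {N : ℕ} (γ p : ℝ) (l : ℕ) (β : ℝ) (E : Set (EuclideanSpace ℝ (Fin N))) :
    ℝ≥0∞ :=
  sInf {c | ∃ g : EuclideanSpace ℝ (Fin N) → ℝ≥0, AEMeasurable g volume ∧
    (∀ x, E.indicator (fun _ => (1 : ℝ≥0∞)) x ≤ ∫⁻ y, rieszKernel γ (x - y) * (g y : ℝ≥0∞)) ∧
    ∫⁻ x, youngQStar p l β (g x) ≠ ∞ ∧
    c = ∫⁻ x, youngQStar p l β (g x)}

end

end WolffExp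

/-!
Write `d = N - αp`, `κ = 1/(p-1)` and `A_j(x) = 2^(-dj) ω(B_{2^j}(x))` for `j ∈ ℤ`. The Wolff
potential of `ω` is comparable to the dyadic sum `∑_j A_j^κ`, and the reaction is a power series with
lowest exponent `lβ`; the hypothesis on `lβ` says `lβκ d > N`, and in particular `lβκ > 1`.

**Existence.** The core is a pointwise estimate (`exists_expTail_dyadic_le`): if
`ω(B_{2^j}(y)) ≤ m` and `A_j(y) ≤ m |j|^(-η)` for `j < 0`, then
`H_l(b W[ω](y)^β) ≤ C m^(lβκ-1) J(y)`, where `J(y) = ∑_j k_j ω(B_{2^j}(y))` and the kernel `k` is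
slightly more singular than `2^(-dj)` at small scales and slightly more integrable than `2^(-Nj)` at
large ones. If `J(y)/m` is small, this is an interpolation between the two available bounds of each
term. If it is large, only about `log (J(y)/m)` scales escape the geometric decay, and on those the
logarithmic weight of the maximal function gives `W[ω]^β ≤ C m^(κβ) log (J(y)/m)`. Since `J` is linear
in `ω`, Tonelli's theorem and a discrete Hardy inequality show that the Wolff potential of `J dy` is
bounded by a multiple of that of `ω`, at every point (`dyadicPotential_smoothing_le`). For small
`M` it follows that `W[H_l(K W[ω]^β)] ≤ W[ω]` (`exists_wolff_expTail_le`). Splitting the reaction of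
`F` into the one of `f`, with coefficient `a + ε`, and those of the two potentials
(`exists_expTail_add_le`), the monotone iteration `u ↦ W[P(u) + μ] + f` stays below `F`, and its
limit is the solution.

**Converse.** With `ω = P(u) + μ` one has `P(W[ω]) dx ≤ ω`, and it suffices to bound `ω(E)` by the
capacity of `E`. A test function `g` satisfies `ω(E) ≤ ∫ g I[ω_E]` with `ω_E = ω|_E`, so by Young's
inequality it is enough that `∫ Q_p(δ I[ω_E]) ≤ (δ/2) ω(E)` for some small `δ`. Expanding `Q_p`,
each moment of `I[ω_E]` is estimated by Wolff's inequality with the constant `(Cs)^s` for the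
exponent `s` (`exists_lintegral_rpow_tsum_density_le`); this growth is exactly compensated by the
coefficients of `Q_p`, and leaves the integral of `H_l(c W[ω_E]^β)`. Finally
`W[ω_E] ≤ C r^κ W[ω]`, where `r ≤ 1` is the centred maximal function of the indicator of `E` with
respect to `ω`, so that this integral is at most
`C δ^(lβκ) ∫ r^(lβκ) P(W[ω]) dx ≤ C δ^(lβκ) ∫ r^(lβκ) dω ≤ C' δ^(lβκ) ω(E)`
by Besicovitch's covering theorem (`exists_lintegral_massRatio_rpow_le`).
-/

namespace WolffExp

/-! ### Inequalities for sums of powers in `[0,∞]` -/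

/-- To bound a power of an infinite sum it suffices to bound the power of the finite subsums. -/
theorem tsum_rpow_le_of_sum {ι : Type*} {x : ι → ℝ≥0∞} {σ : ℝ} (hσ : 0 ≤ σ) {B : ℝ≥0∞}
    (h : ∀ s : Finset ι, (∑ i ∈ s, x i) ^ σ ≤ B) : (∑' i, x i) ^ σ ≤ B := by
  have hs : HasSum x (∑' i, x i) := ENNReal.summable.hasSum
  rcases hσ.eq_or_lt with rfl | hσ'
  · simpa using h ∅
  · exact le_of_tendsto ((ENNReal.continuous_rpow_const (y := σ)).continuousAt.tendsto.comp hs)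
      (Filter.Eventually.of_forall h)

theorem tsum_rpow_le_tsum_rpow {ι : Type*} (x : ι → ℝ≥0∞) {σ : ℝ} (h0 : 0 < σ) (h1 : σ ≤ 1) :
    (∑' i, x i) ^ σ ≤ ∑' i, x i ^ σ := by
  classical
  refine tsum_rpow_le_of_sum h0.le fun s => ?_
  refine le_trans ?_ (ENNReal.sum_le_tsum s)
  induction s using Finset.induction_on with
  | empty => simp [ENNReal.zero_rpow_of_pos h0]
  | insert a s ha ih =>
    rw [Finset.sum_insert ha, Finset.sum_insert ha]
    exact (ENNReal.rpow_add_le_add_rpow _ _ h0.le h1).trans (by gcongr)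

theorem tsum_rpow_le_rpow_tsum {ι : Type*} (x : ι → ℝ≥0∞) {σ : ℝ} (h1 : 1 ≤ σ) :
    ∑' i, x i ^ σ ≤ (∑' i, x i) ^ σ := by
  have h0 : (0 : ℝ) < σ := by linarith
  have key := tsum_rpow_le_tsum_rpow (fun i => x i ^ σ) (σ := σ⁻¹) (by positivity)
    (inv_le_one_of_one_le₀ h1)
  have h2 : ∀ i, (x i ^ σ) ^ σ⁻¹ = x i := fun i => ENNReal.rpow_rpow_inv h0.ne' _
  simp only [h2] at key
  calc ∑' i, x i ^ σ = ((∑' i, x i ^ σ) ^ σ⁻¹) ^ σ := (ENNReal.rpow_inv_rpow h0.ne' _).symm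
    _ ≤ _ := by gcongr

/-- Jensen's inequality for the power `σ ≥ 1` and weights of arbitrary total mass. -/
theorem tsum_mul_rpow_le {ι : Type*} (w x : ι → ℝ≥0∞) {σ : ℝ} (h1 : 1 ≤ σ) :
    (∑' i, w i * x i) ^ σ ≤ (∑' i, w i) ^ (σ - 1) * ∑' i, w i * x i ^ σ := by
  have h0 : (0 : ℝ) < σ := by linarith
  refine tsum_rpow_le_of_sum h0.le fun s => ?_
  have h := ENNReal.inner_le_weight_mul_Lp_of_nonneg s h1 w x
  calc (∑ i ∈ s, w i * x i) ^ σ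
      ≤ ((∑ i ∈ s, w i) ^ (1 - σ⁻¹) * (∑ i ∈ s, w i * x i ^ σ) ^ σ⁻¹) ^ σ := by gcongr
    _ = (∑ i ∈ s, w i) ^ (σ - 1) * ∑ i ∈ s, w i * x i ^ σ := by
        rw [ENNReal.mul_rpow_of_nonneg _ _ h0.le, ENNReal.rpow_inv_rpow h0.ne',
          ← ENNReal.rpow_mul]
        congr 2
        field_simp
    _ ≤ _ := by
        have : 0 ≤ σ - 1 := by linarith
        gcongr <;> exact ENNReal.sum_le_tsum s

theorem tsum_int_add (x : ℤ → ℝ≥0∞) (n : ℤ) : ∑' j, x (j + n) = ∑' j, x j :=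
  (Equiv.addRight n).tsum_eq x

/-- The constant in the discrete Hardy inequality `tsum_hardy_le`. -/
noncomputable def hardyConst (ρ : ℝ≥0∞) (σ : ℝ) : ℝ≥0∞ :=
  if 1 ≤ σ then ((1 - ρ)⁻¹) ^ σ else (1 - ρ ^ σ)⁻¹

/-- A discrete Hardy inequality, for every exponent `σ > 0`. -/
theorem tsum_hardy_le (ρ : ℝ≥0∞) (x : ℤ → ℝ≥0∞) {σ : ℝ} (h0 : 0 < σ) :
    ∑' j : ℤ, (∑' k : ℕ, ρ ^ k * x (j + k)) ^ σ ≤ hardyConst ρ σ * ∑' j, x j ^ σ := by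
  unfold hardyConst
  split_ifs with h1
  · calc ∑' j : ℤ, (∑' k : ℕ, ρ ^ k * x (j + k)) ^ σ
        ≤ ∑' j : ℤ, (∑' k : ℕ, ρ ^ k) ^ (σ - 1) * ∑' k : ℕ, ρ ^ k * x (j + k) ^ σ :=
          ENNReal.tsum_le_tsum fun j => tsum_mul_rpow_le _ _ h1
      _ = (∑' k : ℕ, ρ ^ k) ^ (σ - 1) * ((∑' k : ℕ, ρ ^ k) * ∑' j, x j ^ σ) := by
          rw [ENNReal.tsum_mul_left, ENNReal.tsum_comm]
          congr 1
          rw [← ENNReal.tsum_mul_right]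
          refine tsum_congr fun k => ?_
          rw [ENNReal.tsum_mul_left, tsum_int_add (fun j => x j ^ σ) k]
      _ = _ := by
          rw [ENNReal.tsum_geometric, ← mul_assoc]
          congr 1
          nth_rewrite 2 [← ENNReal.rpow_one (1 - ρ)⁻¹]
          rw [← ENNReal.rpow_add_of_nonneg _ _ (by linarith) zero_le_one]
          congr 1; ring
  · calc ∑' j : ℤ, (∑' k : ℕ, ρ ^ k * x (j + k)) ^ σ
        ≤ ∑' j : ℤ, ∑' k : ℕ, (ρ ^ σ) ^ k * x (j + k) ^ σ := by
          refine ENNReal.tsum_le_tsum fun j => ?_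
          refine (tsum_rpow_le_tsum_rpow _ h0 (le_of_not_ge h1)).trans
            (ENNReal.tsum_le_tsum fun k => ?_)
          rw [ENNReal.mul_rpow_of_nonneg _ _ h0.le]
          gcongr
          rw [← ENNReal.rpow_natCast, ← ENNReal.rpow_natCast, ← ENNReal.rpow_mul,
            ← ENNReal.rpow_mul, mul_comm]
      _ = _ := by
          rw [ENNReal.tsum_comm, ← ENNReal.tsum_geometric, ← ENNReal.tsum_mul_right]
          refine tsum_congr fun k => ?_
          rw [ENNReal.tsum_mul_left, tsum_int_add (fun j => x j ^ σ) k]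

theorem hardyConst_ne_top {ρ : ℝ≥0∞} (hρ : ρ < 1) {σ : ℝ} (h0 : 0 < σ) :
    hardyConst ρ σ ≠ ∞ := by
  unfold hardyConst
  split_ifs
  · exact ENNReal.rpow_ne_top_of_nonneg h0.le
      (ENNReal.inv_ne_top.2 (tsub_pos_of_lt hρ).ne')
  · exact ENNReal.inv_ne_top.2 (tsub_pos_of_lt (ENNReal.rpow_lt_one hρ h0)).ne'

/-- The convexity inequality `(a + b)^s - b^s ≤ s a (a + b)^(s-1)`. -/
theorem add_rpow_le_rpow_add_mul (a b : ℝ≥0∞) {s : ℝ} (hs : 1 ≤ s) :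
    (a + b) ^ s ≤ b ^ s + ENNReal.ofReal s * (a * (a + b) ^ (s - 1)) := by
  have hs0 : 0 < s := by linarith
  rcases eq_or_ne b ∞ with rfl | hb
  · simp [ENNReal.top_rpow_of_pos hs0]
  rcases eq_or_ne a ∞ with rfl | ha
  · have h1 : (∞ : ℝ≥0∞) ^ (s - 1) ≠ 0 := by
      rcases (sub_nonneg.2 hs).eq_or_lt with h | h
      · rw [← h]; simp
      · rw [ENNReal.top_rpow_of_pos h]; simp
    have : ENNReal.ofReal s * (∞ * (∞ + b) ^ (s - 1)) = ∞ := by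
      rw [top_add, ENNReal.top_mul h1, ENNReal.mul_top (by simpa using hs0)]
    rw [this]; simp
  lift a to ℝ≥0 using ha
  lift b to ℝ≥0 using hb
  rcases eq_or_ne (a + b) 0 with h0 | h0
  · rw [← ENNReal.coe_add, h0]; simp [ENNReal.zero_rpow_of_pos hs0]
  have hpos : (0 : ℝ) < a + b := by exact_mod_cast pos_iff_ne_zero.2 h0
  have key : ((a : ℝ) + b) ^ s ≤ (b : ℝ) ^ s + s * (a * (a + b) ^ (s - 1)) := by
    have h := one_add_mul_self_le_rpow_one_add (s := -(a / (a + b) : ℝ)) (by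
      rw [neg_le_neg_iff, div_le_one hpos]; linarith [b.coe_nonneg]) hs
    have e : (1 + -(a / (a + b) : ℝ)) = b / (a + b) := by field_simp; ring
    rw [e, Real.div_rpow b.coe_nonneg hpos.le, le_div_iff₀ (by positivity)] at h
    rw [Real.rpow_sub_one hpos.ne']
    have h3 : (1 + s * -(a / (a + b) : ℝ)) * (a + b) ^ s
      = (a + b : ℝ) ^ s - s * (a * ((a + b) ^ s / (a + b))) := by field_simp; ring
    linarith
  have e1 : ((a : ℝ≥0∞) + b) = ENNReal.ofReal ((a : ℝ) + b) := by
    rw [ENNReal.ofReal_add a.coe_nonneg b.coe_nonneg]; simp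
  have e2 : (b : ℝ≥0∞) = ENNReal.ofReal (b : ℝ) := by simp
  have e3 : (a : ℝ≥0∞) = ENNReal.ofReal (a : ℝ) := by simp
  rw [e1, ENNReal.ofReal_rpow_of_pos hpos, ENNReal.ofReal_rpow_of_pos hpos, e2,
    ENNReal.ofReal_rpow_of_nonneg b.coe_nonneg hs0.le, e3, ← ENNReal.ofReal_mul a.coe_nonneg,
    ← ENNReal.ofReal_mul hs0.le, ← ENNReal.ofReal_add (by positivity) (by positivity)]
  exact ENNReal.ofReal_le_ofReal key

/-- A discrete form of `(∫ y)^s ≤ s ∫ y(t) (∫_t^∞ y)^(s-1) dt`. -/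
theorem rpow_tsum_le_tsum_mul_tail (y : ℤ → ℝ≥0∞) {s : ℝ} (hs : 1 ≤ s) :
    (∑' j, y j) ^ s ≤
      ENNReal.ofReal s * ∑' j : ℤ, y j * (∑' k : ℕ, y (j + k)) ^ (s - 1) := by
  have hs0 : 0 < s := by linarith
  have hs1 : 0 ≤ s - 1 := by linarith
  refine tsum_rpow_le_of_sum hs0.le fun t => ?_
  refine le_trans ?_ (mul_le_mul_right (ENNReal.sum_le_tsum t) _)
  induction t using Finset.induction_on_min with
  | empty => simp [ENNReal.zero_rpow_of_pos hs0]
  | insert a t ha ih =>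
    have hat : a ∉ t := fun h => lt_irrefl _ (ha a h)
    rw [Finset.sum_insert hat, Finset.sum_insert hat]
    have hle : y a + ∑ i ∈ t, y i ≤ ∑' k : ℕ, y (a + k) := by
      rw [← Finset.sum_insert hat]
      have himg : ∀ i ∈ insert a t, a + ((i - a).toNat : ℤ) = i := by
        intro i hi
        have : a ≤ i := by
          rcases Finset.mem_insert.1 hi with rfl | h
          · exact le_rfl
          · exact (ha i h).le
        omega
      calc ∑ i ∈ insert a t, y i
          = ∑ i ∈ insert a t, y (a + ((i - a).toNat : ℤ)) :=
            Finset.sum_congr rfl fun i hi => by rw [himg i hi]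
        _ = ∑ k ∈ (insert a t).image (fun i => (i - a).toNat), y (a + k) := by
            rw [Finset.sum_image]
            intro i hi j hj h
            have h : (i - a).toNat = (j - a).toNat := h
            rw [← himg i hi, ← himg j hj, h]
        _ ≤ _ := ENNReal.sum_le_tsum _
    calc (y a + ∑ i ∈ t, y i) ^ s
        ≤ (∑ i ∈ t, y i) ^ s + ENNReal.ofReal s * (y a * (y a + ∑ i ∈ t, y i) ^ (s - 1)) :=
          add_rpow_le_rpow_add_mul _ _ hs
      _ ≤ ENNReal.ofReal s * ∑ j ∈ t, y j * (∑' k : ℕ, y (j + k)) ^ (s - 1)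
          + ENNReal.ofReal s * (y a * (∑' k : ℕ, y (a + k)) ^ (s - 1)) := by gcongr
      _ = _ := by rw [mul_add, add_comm]

/-- `∑_{i=1}^n i^(r-1) ≤ n^r / r` for `0 < r ≤ 1`. -/
theorem sum_rpow_sub_one_le {r : ℝ} (h0 : 0 < r) (h1 : r ≤ 1) (n : ℕ) :
    ∑ i ∈ Finset.range n, ((i : ℝ) + 1) ^ (r - 1) ≤ r⁻¹ * (n : ℝ) ^ r := by
  induction n with
  | zero => simp [Real.zero_rpow h0.ne']
  | succ n ih =>
    rw [Finset.sum_range_succ]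
    have hpos : (0 : ℝ) < (n : ℝ) + 1 := by positivity
    have h := rpow_one_add_le_one_add_mul_self (s := -(1 / ((n : ℝ) + 1))) (by
      rw [neg_le_neg_iff, div_le_one hpos]; linarith [(Nat.cast_nonneg n : (0:ℝ) ≤ n)]) h0.le h1
    have e : 1 + -(1 / ((n : ℝ) + 1)) = n / (n + 1) := by field_simp; ring
    rw [e, Real.div_rpow (Nat.cast_nonneg n) hpos.le, div_le_iff₀ (by positivity)] at h
    have h3 : (1 + r * -(1 / ((n : ℝ) + 1))) * ((n : ℝ) + 1) ^ r
      = ((n : ℝ) + 1) ^ r - r * ((n : ℝ) + 1) ^ (r - 1) := by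
      rw [Real.rpow_sub_one hpos.ne']; field_simp; ring
    push_cast
    have h4 : r⁻¹ * (n : ℝ) ^ r ≤ r⁻¹ * ((n : ℝ) + 1) ^ r - ((n : ℝ) + 1) ^ (r - 1) := by
      rw [h3] at h
      calc r⁻¹ * (n : ℝ) ^ r ≤ r⁻¹ * (((n : ℝ) + 1) ^ r - r * ((n : ℝ) + 1) ^ (r - 1)) := by
            gcongr
        _ = _ := by field_simp
    linarith

/-! ### The truncated exponential as a power series in `[0,∞]` -/

/-- The power series `∑_{q ≥ l} x^q / q!` on `[0,∞]`, which is `H_l` there. -/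
noncomputable def expTail (l : ℕ) (x : ℝ≥0∞) : ℝ≥0∞ :=
  ∑' k : ℕ, x ^ (k + l) / ((k + l).factorial : ℝ≥0∞)

theorem expTail_mono (l : ℕ) : Monotone (expTail l) := fun x y h =>
  ENNReal.tsum_le_tsum fun k => by gcongr

theorem measurable_expTail (l : ℕ) : Measurable (expTail l) := by
  unfold expTail; fun_prop

theorem expTail_zero {l : ℕ} (hl : 1 ≤ l) : expTail l 0 = 0 := by
  simp only [expTail, ENNReal.tsum_eq_zero]
  intro k
  rw [zero_pow (by omega), ENNReal.zero_div]

theorem expTail_top {l : ℕ} (hl : 1 ≤ l) : expTail l ∞ = ∞ := by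
  refine top_unique (le_trans ?_ (ENNReal.le_tsum 0))
  rw [ENNReal.top_pow (by omega), ENNReal.top_div_of_ne_top (by simp)]

theorem expTail_mul_le (l : ℕ) {z : ℝ≥0∞} (hz : z ≤ 1) (x : ℝ≥0∞) :
    expTail l (z * x) ≤ z ^ l * expTail l x := by
  unfold expTail
  rw [← ENNReal.tsum_mul_left]
  refine ENNReal.tsum_le_tsum fun k => ?_
  rw [mul_pow, ← mul_div_assoc]
  gcongr ?_ * _ / _
  exact pow_le_pow_right_of_le_one' hz (by omega)

theorem expTail_ofReal (l : ℕ) {y : ℝ} (hy : 0 ≤ y) :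
    expTail l (ENNReal.ofReal y) = ENNReal.ofReal (truncExp l y) := by
  have hs := Real.summable_pow_div_factorial y
  have h1 : truncExp l y = ∑' k : ℕ, y ^ (k + l) / ((k + l).factorial : ℝ) := by
    unfold truncExp
    rw [Real.exp_eq_exp_ℝ, NormedSpace.exp_eq_tsum_div]
    beta_reduce
    rw [← hs.sum_add_tsum_nat_add l]
    ring
  rw [h1, ENNReal.ofReal_tsum_of_nonneg (fun k => by positivity) ((summable_nat_add_iff l).2 hs)]
  refine tsum_congr fun k => ?_
  rw [ENNReal.ofReal_div_of_pos (by positivity), ENNReal.ofReal_pow hy, ENNReal.ofReal_natCast]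

theorem expTail_ofReal_le_exp (l : ℕ) {y : ℝ} (hy : 0 ≤ y) :
    expTail l (ENNReal.ofReal y) ≤ ENNReal.ofReal (Real.exp y) := by
  rw [expTail_ofReal l hy]
  refine ENNReal.ofReal_le_ofReal (sub_le_self _ (Finset.sum_nonneg fun j _ => by positivity))

theorem expTail_iSup (l : ℕ) {x : ℕ → ℝ≥0∞} (hx : Monotone x) :
    expTail l (⨆ n, x n) = ⨆ n, expTail l (x n) := by
  have hpow : ∀ k, (⨆ n, x n) ^ k = ⨆ n, x n ^ k := fun k =>
    (tendsto_nhds_unique (((ENNReal.continuous_pow k).tendsto _).comp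
      (tendsto_atTop_iSup hx)) (tendsto_atTop_iSup fun a b h => pow_le_pow_left' (hx h) k))
  unfold expTail
  simp only [hpow, ENNReal.iSup_div, ENNReal.tsum_eq_iSup_sum]
  rw [iSup_comm]
  congr 1; ext s
  rw [ENNReal.finsetSum_iSup_of_monotone]
  intro k a b h
  dsimp only
  gcongr
  exact hx h

theorem reaction_eq_expTail {l : ℕ} (hl : 1 ≤ l) {a β : ℝ} (ha : 0 < a) (hβ : 0 < β)
    (r : ℝ≥0∞) : reaction l a β r = expTail l (ENNReal.ofReal a * r ^ β) := by
  unfold reaction reactionReal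
  split_ifs with h
  · rw [h, ENNReal.top_rpow_of_pos hβ, ENNReal.mul_top (by simpa using ha), expTail_top hl]
  · rw [← expTail_ofReal l (by positivity), ENNReal.ofReal_mul ha.le,
      ← ENNReal.ofReal_rpow_of_nonneg ENNReal.toReal_nonneg hβ.le, ENNReal.ofReal_toReal h]

theorem reaction_mono {l : ℕ} (hl : 1 ≤ l) {a β : ℝ} (ha : 0 < a) (hβ : 0 < β) :
    Monotone (reaction l a β) := fun r s h => by
  rw [reaction_eq_expTail hl ha hβ, reaction_eq_expTail hl ha hβ]
  exact expTail_mono l (by gcongr)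

theorem measurable_reaction {l : ℕ} (hl : 1 ≤ l) {a β : ℝ} (ha : 0 < a) (hβ : 0 < β) :
    Measurable (reaction l a β) := by
  rw [funext (reaction_eq_expTail hl ha hβ)]
  exact (measurable_expTail l).comp (by fun_prop)

theorem reaction_zero {l : ℕ} (hl : 1 ≤ l) {a β : ℝ} (ha : 0 < a) (hβ : 0 < β) :
    reaction l a β 0 = 0 := by
  rw [reaction_eq_expTail hl ha hβ, ENNReal.zero_rpow_of_pos hβ, mul_zero, expTail_zero hl]

theorem iSup_rpow {ι : Type*} (x : ι → ℝ≥0∞) {σ : ℝ} (hσ : 0 < σ) :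
    (⨆ n, x n) ^ σ = ⨆ n, x n ^ σ :=
  (ENNReal.orderIsoRpow σ hσ).map_iSup x

theorem reaction_iSup {l : ℕ} (hl : 1 ≤ l) {a β : ℝ} (ha : 0 < a) (hβ : 0 < β)
    {x : ℕ → ℝ≥0∞} (hx : Monotone x) :
    reaction l a β (⨆ n, x n) = ⨆ n, reaction l a β (x n) := by
  simp only [reaction_eq_expTail hl ha hβ]
  rw [iSup_rpow _ hβ, ENNReal.mul_iSup, expTail_iSup]
  intro m n h
  dsimp only
  gcongr
  exact hx h

/-- An almost convexity inequality: enlarging the coefficient `a` to `a + ε` in front of one of the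
terms allows to separate the three terms. Either `X + Y` is so small with respect to `Z` that
`a (X + Y + Z)^β ≤ (a + ε) Z^β`, or `X + Y + Z` is bounded by a multiple of `max X Y`. -/
theorem exists_expTail_add_le (l : ℕ) {a ε β : ℝ} (ha : 0 < a) (hε : 0 < ε) (hβ : 0 < β) :
    ∃ K : ℝ, 0 < K ∧ ∀ X Y Z : ℝ≥0∞,
      expTail l (ENNReal.ofReal a * (X + Y + Z) ^ β) ≤
        expTail l (ENNReal.ofReal (a + ε) * Z ^ β) +
        (expTail l (ENNReal.ofReal K * X ^ β) + expTail l (ENNReal.ofReal K * Y ^ β)) := by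
  obtain ⟨τ, hτ, hτa⟩ : ∃ τ : ℝ, 0 < τ ∧ a * (1 + τ) ^ β = a + ε := by
    refine ⟨(1 + ε / a) ^ β⁻¹ - 1, ?_, ?_⟩
    · have : (1 : ℝ) < (1 + ε / a) ^ β⁻¹ :=
        Real.one_lt_rpow (by have := div_pos hε ha; linarith) (by positivity)
      linarith
    · rw [add_sub_cancel, Real.rpow_inv_rpow (by positivity) hβ.ne']
      field_simp
  refine ⟨a * (2 * (1 + τ⁻¹)) ^ β, by positivity, fun X Y Z => ?_⟩
  by_cases h : X + Y ≤ ENNReal.ofReal τ * Z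
  · refine le_trans (expTail_mono l ?_) le_self_add
    calc ENNReal.ofReal a * (X + Y + Z) ^ β
        ≤ ENNReal.ofReal a * (ENNReal.ofReal (1 + τ) * Z) ^ β := by
          gcongr
          rw [ENNReal.ofReal_add zero_le_one hτ.le, add_mul, ENNReal.ofReal_one, one_mul, add_comm]
          gcongr
      _ = _ := by
          rw [ENNReal.mul_rpow_of_nonneg _ _ hβ.le, ENNReal.ofReal_rpow_of_pos (by positivity),
            ← mul_assoc, ← ENNReal.ofReal_mul ha.le, hτa]
  · have hZ : Z ≤ ENNReal.ofReal τ⁻¹ * (X + Y) := by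
      rw [ENNReal.ofReal_inv_of_pos hτ, mul_comm, ← div_eq_mul_inv,
        ENNReal.le_div_iff_mul_le (by simp [hτ]) (by simp), mul_comm]
      exact (le_of_not_ge h)
    have key : ENNReal.ofReal a * (X + Y + Z) ^ β ≤
        ENNReal.ofReal (a * (2 * (1 + τ⁻¹)) ^ β) * (max X Y) ^ β := by
      calc ENNReal.ofReal a * (X + Y + Z) ^ β
          ≤ ENNReal.ofReal a * (ENNReal.ofReal (2 * (1 + τ⁻¹)) * max X Y) ^ β := by
            gcongr
            have hXY : X + Y ≤ 2 * max X Y := by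
              rw [two_mul]; gcongr; exacts [le_max_left _ _, le_max_right _ _]
            calc X + Y + Z ≤ (X + Y) + ENNReal.ofReal τ⁻¹ * (X + Y) := by gcongr
              _ = ENNReal.ofReal (1 + τ⁻¹) * (X + Y) := by
                rw [ENNReal.ofReal_add zero_le_one (by positivity), ENNReal.ofReal_one]; ring
              _ ≤ ENNReal.ofReal (1 + τ⁻¹) * (2 * max X Y) := by gcongr
              _ = _ := by
                rw [mul_comm 2 (1 + τ⁻¹), ENNReal.ofReal_mul (by positivity), mul_assoc]; simp
        _ = _ := by
            rw [ENNReal.mul_rpow_of_nonneg _ _ hβ.le, ENNReal.ofReal_rpow_of_pos (by positivity),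
              ← mul_assoc, ← ENNReal.ofReal_mul ha.le]
    refine (expTail_mono l key).trans (le_trans ?_ le_add_self)
    rcases le_total X Y with hXY | hXY
    · rw [max_eq_right hXY]; exact le_add_self
    · rw [max_eq_left hXY]; exact le_self_add

/-! ### Dyadic form of the Wolff potential -/

/-- The space `ℝ^N` with its Euclidean norm. -/
abbrev Space (N : ℕ) := EuclideanSpace ℝ (Fin N)

/-- The dyadic density `2^(-dj) ν(B_{2^j}(x))`, `j ∈ ℤ`. -/
noncomputable def dyadicDensity {N : ℕ} (d : ℝ) (ν : Measure (Space N)) (x : Space N) (j : ℤ) :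
    ℝ≥0∞ :=
  ν (ball x ((2 : ℝ) ^ j)) * (2 : ℝ≥0∞) ^ (-(d * j))

/-- The dyadic potential `∑_j (2^(-dj) ν(B_{2^j}(x)))^κ`. For `κ = 1 / (p - 1)` and `d = N - αp` it
is comparable to the Wolff potential, for `κ = 1` it dominates the Riesz potential. -/
noncomputable def dyadicPotential {N : ℕ} (d κ : ℝ) (ν : Measure (Space N)) (x : Space N) :
    ℝ≥0∞ :=
  ∑' j : ℤ, dyadicDensity d ν x j ^ κ

theorem two_rpow_ne_zero (s : ℝ) : (2 : ℝ≥0∞) ^ s ≠ 0 := by simp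

theorem two_rpow_ne_top (s : ℝ) : (2 : ℝ≥0∞) ^ s ≠ ∞ := by simp

theorem two_rpow_add (s t : ℝ) : (2 : ℝ≥0∞) ^ (s + t) = 2 ^ s * 2 ^ t :=
  ENNReal.rpow_add _ _ two_ne_zero (by simp)

theorem two_rpow_lt_one {s : ℝ} (hs : s < 0) : (2 : ℝ≥0∞) ^ s < 1 :=
  ENNReal.rpow_lt_one_of_one_lt_of_neg ENNReal.one_lt_two hs

theorem two_rpow_mono : Monotone fun s : ℝ => (2 : ℝ≥0∞) ^ s := fun _ _ h =>
  ENNReal.rpow_le_rpow_of_exponent_le ENNReal.one_lt_two.le h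

theorem two_rpow_mul_nat (s : ℝ) (k : ℕ) : ((2 : ℝ≥0∞) ^ s) ^ k = 2 ^ (s * k) := by
  rw [ENNReal.rpow_mul, ENNReal.rpow_natCast]

theorem tsum_two_rpow_ne_top {s : ℝ} (hs : s < 0) : ∑' k : ℕ, (2 : ℝ≥0∞) ^ (s * k) ≠ ∞ := by
  simp only [← two_rpow_mul_nat, ENNReal.tsum_geometric]
  exact ENNReal.inv_ne_top.2 (tsub_pos_of_lt (two_rpow_lt_one hs)).ne'

theorem ofReal_two_zpow_rpow (j : ℤ) (d : ℝ) :
    ENNReal.ofReal (((2 : ℝ) ^ j) ^ d) = 2 ^ (d * j) := by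
  rw [← Real.rpow_intCast, ← Real.rpow_mul zero_le_two, ← ENNReal.ofReal_rpow_of_pos two_pos,
    mul_comm]
  simp

theorem ofReal_two_zpow (j : ℤ) : ENNReal.ofReal ((2 : ℝ) ^ j) = 2 ^ (j : ℝ) := by
  have := ofReal_two_zpow_rpow j 1
  rwa [Real.rpow_one, one_mul] at this

theorem two_zpow_pos (j : ℤ) : (0 : ℝ) < 2 ^ j := by positivity

theorem Ioi_eq_iUnion_Ioc_zpow :
    Ioi (0 : ℝ) = ⋃ j : ℤ, Ioc ((2 : ℝ) ^ j) (2 ^ (j + 1)) := by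
  ext t
  simp only [mem_Ioi, mem_iUnion]
  exact ⟨fun h => exists_mem_Ioc_zpow h one_lt_two, fun ⟨j, hj⟩ => (two_zpow_pos j).trans hj.1⟩

theorem volume_Ioc_zpow (j : ℤ) : volume (Ioc ((2 : ℝ) ^ j) (2 ^ (j + 1))) = 2 ^ (j : ℝ) := by
  rw [Real.volume_Ioc, ← ofReal_two_zpow]
  congr 1
  rw [zpow_add_one₀ two_ne_zero]; ring

theorem dyadicDensity_add_one {N : ℕ} (d : ℝ) (ν : Measure (Space N)) (x : Space N) (j : ℤ) :
    ν (ball x ((2 : ℝ) ^ (j + 1))) * 2 ^ (-(d * j)) = 2 ^ d * dyadicDensity d ν x (j + 1) := by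
  unfold dyadicDensity
  rw [mul_left_comm, ← two_rpow_add]
  congr 2
  push_cast; ring

theorem wolff_le_dyadicPotential {N : ℕ} (α : ℝ) {p : ℝ} (hp : 1 < p)
    (hαp : α * p < N) (ν : Measure (Space N)) (x : Space N) :
    wolff α p ν x ≤ 2 ^ ((N - α * p) * (1 / (p - 1))) *
      dyadicPotential (N - α * p) (1 / (p - 1)) ν x := by
  set d : ℝ := N - α * p with hd
  set κ : ℝ := 1 / (p - 1) with hκ
  have hκ0 : 0 < κ := one_div_pos.2 (sub_pos.2 hp)
  have hd0 : 0 < d := sub_pos.2 hαp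
  unfold wolff dyadicPotential
  rw [Ioi_eq_iUnion_Ioc_zpow, ← ENNReal.tsum_mul_left,
    ← tsum_int_add (fun j => 2 ^ (d * κ) * dyadicDensity d ν x j ^ κ) 1]
  refine (lintegral_iUnion_le _ _).trans (ENNReal.tsum_le_tsum fun j => ?_)
  calc ∫⁻ t in Ioc ((2 : ℝ) ^ j) (2 ^ (j + 1)),
        (ν (ball x t) / ENNReal.ofReal (t ^ d)) ^ κ / ENNReal.ofReal t
      ≤ ∫⁻ _ in Ioc ((2 : ℝ) ^ j) (2 ^ (j + 1)),
        (2 ^ d * dyadicDensity d ν x (j + 1)) ^ κ / 2 ^ (j : ℝ) := by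
        refine setLIntegral_mono measurable_const fun t ht => ?_
        rw [← dyadicDensity_add_one, ENNReal.rpow_neg, ← div_eq_mul_inv, ← ofReal_two_zpow_rpow,
          ← ofReal_two_zpow]
        have := two_zpow_pos j
        gcongr
        exacts [ht.2, ht.1.le, ht.1.le]
    _ = _ := by
        rw [setLIntegral_const, volume_Ioc_zpow,
          ENNReal.div_mul_cancel (two_rpow_ne_zero _) (two_rpow_ne_top _),
          ENNReal.mul_rpow_of_nonneg _ _ hκ0.le, ← ENNReal.rpow_mul]

theorem dyadicPotential_le_wolff {N : ℕ} (α : ℝ) {p : ℝ} (hp : 1 < p)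
    (hαp : α * p < N) (ν : Measure (Space N)) (x : Space N) :
    dyadicPotential (N - α * p) (1 / (p - 1)) ν x ≤
      2 ^ ((N - α * p) * (1 / (p - 1)) + 1) * wolff α p ν x := by
  set d : ℝ := N - α * p with hd
  set κ : ℝ := 1 / (p - 1) with hκ
  have hκ0 : 0 < κ := one_div_pos.2 (sub_pos.2 hp)
  have hd0 : 0 < d := sub_pos.2 hαp
  have hdisj : Pairwise (Function.onFun Disjoint
      fun j : ℤ => Ioc ((2 : ℝ) ^ j) (2 ^ (j + 1))) := by
    intro i j hij
    rw [Function.onFun, Set.disjoint_left]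
    rintro t ⟨h1, h2⟩ ⟨h3, h4⟩
    have a1 := (zpow_lt_zpow_iff_right₀ (one_lt_two (α := ℝ))).1 (h1.trans_le h4)
    have a2 := (zpow_lt_zpow_iff_right₀ (one_lt_two (α := ℝ))).1 (h3.trans_le h2)
    omega
  unfold wolff dyadicPotential
  rw [Ioi_eq_iUnion_Ioc_zpow, lintegral_iUnion (fun _ => measurableSet_Ioc) hdisj,
    ← ENNReal.tsum_mul_left]
  refine ENNReal.tsum_le_tsum fun j => ?_
  have hA : dyadicDensity d ν x j =
      2 ^ d * (ν (ball x (2 ^ j)) / ENNReal.ofReal (((2 : ℝ) ^ (j + 1)) ^ d)) := by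
    unfold dyadicDensity
    rw [ofReal_two_zpow_rpow, div_eq_mul_inv, ← ENNReal.rpow_neg, mul_left_comm, ← two_rpow_add]
    congr 2
    push_cast; ring
  calc dyadicDensity d ν x j ^ κ
      = 2 ^ (d * κ + 1) * ∫⁻ _ in Ioc ((2 : ℝ) ^ j) (2 ^ (j + 1)),
        (ν (ball x (2 ^ j)) / ENNReal.ofReal (((2 : ℝ) ^ (j + 1)) ^ d)) ^ κ /
          ENNReal.ofReal ((2 : ℝ) ^ (j + 1)) := by
        rw [setLIntegral_const, volume_Ioc_zpow, hA, ENNReal.mul_rpow_of_nonneg _ _ hκ0.le,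
          ← ENNReal.rpow_mul, ofReal_two_zpow (j + 1), div_eq_mul_inv _ ((2 : ℝ≥0∞) ^ _),
          ← ENNReal.rpow_neg, mul_assoc (_ ^ κ), ← two_rpow_add, two_rpow_add (d * κ),
          mul_assoc, mul_left_comm (2 ^ (1 : ℝ)), ← two_rpow_add]
        have : (1 : ℝ) + (-((j + 1 : ℤ) : ℝ) + j) = 0 := by push_cast; ring
        rw [this, ENNReal.rpow_zero, mul_one]
    _ ≤ _ := by
        refine mul_le_mul_right (setLIntegral_mono' measurableSet_Ioc fun t ht => ?_) _
        have h0 : 0 < t := (two_zpow_pos j).trans ht.1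
        gcongr
        exacts [ht.1.le, ht.2, ht.2]

theorem volume_ball_two_zpow {N : ℕ} (hN : N ≠ 0) (x : Space N) (j : ℤ) :
    volume (ball x ((2 : ℝ) ^ j)) = 2 ^ ((N : ℝ) * j) * volume (ball (0 : Space N) 1) := by
  have : NeZero N := ⟨hN⟩
  rw [Measure.addHaar_ball _ _ (two_zpow_pos j).le, finrank_euclideanSpace_fin,
    ← Real.rpow_natCast, ofReal_two_zpow_rpow]

/-! ### Measurability and elementary properties of the Wolff potential -/

theorem measurable_measure_ball_prod {N : ℕ} (ν : Measure (Space N)) [SFinite ν] :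
    Measurable fun q : Space N × ℝ => ν (ball q.1 q.2) := by
  have h : MeasurableSet {q : (Space N × ℝ) × Space N | dist q.2 q.1.1 < q.1.2} :=
    (isOpen_lt (by fun_prop) (by fun_prop)).measurableSet
  exact measurable_measure_prodMk_left h

theorem measurable_measure_ball {N : ℕ} (ν : Measure (Space N)) [SFinite ν] (r : ℝ) :
    Measurable fun x : Space N => ν (ball x r) := by
  have h : MeasurableSet {q : Space N × Space N | dist q.2 q.1 < r} :=
    (isOpen_lt (by fun_prop) (by fun_prop)).measurableSet
  exact measurable_measure_prodMk_left h

theorem measurable_dyadicDensity {N : ℕ} (d : ℝ) (ν : Measure (Space N)) [SFinite ν] (j : ℤ) :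
    Measurable fun x => dyadicDensity d ν x j :=
  (measurable_measure_ball ν _).mul_const _

theorem measurable_dyadicPotential {N : ℕ} (d κ : ℝ) (ν : Measure (Space N)) [SFinite ν] :
    Measurable (dyadicPotential d κ ν) :=
  Measurable.tsum fun j => (measurable_dyadicDensity d ν j).pow_const _

theorem measurable_wolff {N : ℕ} (α p : ℝ) (ν : Measure (Space N)) [SFinite ν] :
    Measurable (wolff α p ν) := by
  unfold wolff
  refine Measurable.lintegral_prod_right' (f := fun q : Space N × ℝ =>
    (ν (ball q.1 q.2) / ENNReal.ofReal (q.2 ^ ((N : ℝ) - α * p))) ^ (1 / (p - 1)) /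
      ENNReal.ofReal q.2) ?_
  exact (((measurable_measure_ball_prod ν).div (by fun_prop)).pow_const _).div (by fun_prop)

theorem measurable_wolff_integrand {N : ℕ} (α p : ℝ) (ν : Measure (Space N)) (x : Space N) :
    Measurable fun t : ℝ =>
      (ν (ball x t) / ENNReal.ofReal (t ^ ((N : ℝ) - α * p))) ^ (1 / (p - 1)) /
        ENNReal.ofReal t := by
  have h : Measurable fun t : ℝ => ν (ball x t) :=
    Monotone.measurable fun s t h => measure_mono (ball_subset_ball h)
  exact ((h.div (by fun_prop)).pow_const _).div (by fun_prop)

/-- The potential only depends on the masses of balls, monotonically. -/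
theorem wolff_mono_of_ball {N : ℕ} (α : ℝ) {p : ℝ} (hp : 1 < p) {ν ν' : Measure (Space N)}
    {x : Space N} (h : ∀ t, ν (ball x t) ≤ ν' (ball x t)) : wolff α p ν x ≤ wolff α p ν' x := by
  have : 0 ≤ 1 / (p - 1) := one_div_nonneg.2 (sub_nonneg.2 hp.le)
  exact lintegral_mono fun t => ENNReal.div_le_div_right
    (ENNReal.rpow_le_rpow (ENNReal.div_le_div_right (h t) _) this) _

theorem wolff_mono {N : ℕ} (α : ℝ) {p : ℝ} (hp : 1 < p) {ν ν' : Measure (Space N)}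
    (h : ν ≤ ν') (x : Space N) : wolff α p ν x ≤ wolff α p ν' x :=
  wolff_mono_of_ball α hp fun _ => h _

/-- Quasi-additivity of `r ↦ r^κ` for four terms, with the constant `max 1 (4^(κ-1))`. -/
theorem add_four_rpow_le {κ : ℝ} (h0 : 0 < κ) (a b c e : ℝ≥0∞) :
    (a + b + (c + e)) ^ κ ≤
      ENNReal.ofReal (max 1 (4 ^ (κ - 1))) * (a ^ κ + b ^ κ + (c ^ κ + e ^ κ)) := by
  rcases le_total 1 κ with h | h
  · have h2 : ∀ u v : ℝ≥0∞, (u + v) ^ κ ≤ 2 ^ (κ - 1) * (u ^ κ + v ^ κ) := fun u v =>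
      ENNReal.rpow_add_le_mul_rpow_add_rpow u v h
    calc (a + b + (c + e)) ^ κ
        ≤ 2 ^ (κ - 1) * ((2 ^ (κ - 1) * (a ^ κ + b ^ κ)) + 2 ^ (κ - 1) * (c ^ κ + e ^ κ)) :=
          (h2 _ _).trans (by gcongr <;> exact h2 _ _)
      _ = (4 : ℝ≥0∞) ^ (κ - 1) * (a ^ κ + b ^ κ + (c ^ κ + e ^ κ)) := by
          have : (4 : ℝ≥0∞) = 2 * 2 := by norm_num
          rw [this, ENNReal.mul_rpow_of_nonneg _ _ (by linarith)]; ring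
      _ ≤ _ := by
          gcongr
          have : (4 : ℝ≥0∞) = ENNReal.ofReal 4 := by simp
          rw [this, ENNReal.ofReal_rpow_of_pos (by norm_num)]
          exact ENNReal.ofReal_le_ofReal (le_max_right _ _)
  · have h2 : ∀ u v : ℝ≥0∞, (u + v) ^ κ ≤ u ^ κ + v ^ κ := fun u v =>
      ENNReal.rpow_add_le_add_rpow u v h0.le h
    calc (a + b + (c + e)) ^ κ
        ≤ 1 * (a ^ κ + b ^ κ + (c ^ κ + e ^ κ)) := by
          rw [one_mul]
          exact (h2 _ _).trans (by gcongr <;> exact h2 _ _)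
      _ ≤ _ := by
          gcongr
          rw [← ENNReal.ofReal_one]
          exact ENNReal.ofReal_le_ofReal (le_max_left _ _)

/-- Quasi-additivity of the Wolff potential for four measures, with the constant `c_p`. -/
theorem wolff_le_add_four {N : ℕ} (α : ℝ) {p : ℝ} (hp : 1 < p)
    {ν ν₁ ν₂ ν₃ ν₄ : Measure (Space N)} {x : Space N}
    (h : ∀ t, ν (ball x t) ≤ ν₁ (ball x t) + ν₂ (ball x t) + (ν₃ (ball x t) + ν₄ (ball x t))) :
    wolff α p ν x ≤ ENNReal.ofReal (cConst p) *
      (wolff α p ν₁ x + wolff α p ν₂ x + (wolff α p ν₃ x + wolff α p ν₄ x)) := by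
  have hκ0 : 0 < 1 / (p - 1) := one_div_pos.2 (sub_pos.2 hp)
  have hc : cConst p = max 1 (4 ^ (1 / (p - 1) - 1)) := by
    unfold cConst
    congr 2
    have := (sub_pos.2 hp).ne'
    field_simp; ring
  unfold wolff
  rw [← lintegral_add_left (measurable_wolff_integrand α p ν₁ x),
    ← lintegral_add_left (measurable_wolff_integrand α p ν₃ x), ← lintegral_add_left (by
      exact (measurable_wolff_integrand α p ν₁ x).add (measurable_wolff_integrand α p ν₂ x)),
    ← lintegral_const_mul' _ _ ENNReal.ofReal_ne_top]
  refine lintegral_mono fun t => ?_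
  simp only [ENNReal.div_add_div_same, ← mul_div_assoc]
  gcongr
  rw [hc]
  refine le_trans ?_ (add_four_rpow_le hκ0 _ _ _ _)
  simp only [ENNReal.div_add_div_same]
  gcongr
  exact h t

/-- Monotone convergence for Wolff potentials. -/
theorem wolff_iSup {N : ℕ} (α : ℝ) {p : ℝ} (hp : 1 < p) {ν : ℕ → Measure (Space N)}
    {ν' : Measure (Space N)} {x : Space N} (hmono : ∀ t, Monotone fun n => ν n (ball x t))
    (h : ∀ t, ν' (ball x t) = ⨆ n, ν n (ball x t)) :
    wolff α p ν' x = ⨆ n, wolff α p (ν n) x := by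
  have hκ0 : 0 < 1 / (p - 1) := one_div_pos.2 (sub_pos.2 hp)
  unfold wolff
  rw [← lintegral_iSup (fun n => measurable_wolff_integrand α p (ν n) x)]
  · refine lintegral_congr fun t => ?_
    rw [h t, ENNReal.iSup_div, iSup_rpow _ hκ0, ENNReal.iSup_div]
  · intro m n hmn t
    exact ENNReal.div_le_div_right
      (ENNReal.rpow_le_rpow (ENNReal.div_le_div_right (hmono t hmn) _) hκ0.le) _

/-! ### Smoothing a measure by a dyadic kernel -/

theorem tsum_int_eq_add (f : ℤ → ℝ≥0∞) :
    ∑' j, f j = ∑' n : ℕ, f n + ∑' n : ℕ, f (-(n + 1)) :=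
  (HasSum.of_nat_of_neg_add_one (f := f) ENNReal.summable.hasSum ENNReal.summable.hasSum).tsum_eq

theorem tsum_int_le_of_split {f a : ℤ → ℝ≥0∞} {b : ℕ → ℝ≥0∞} (i : ℤ)
    (ha : ∀ j ≤ i, f j ≤ a j) (hb : ∀ m : ℕ, f (i + m) ≤ b m) :
    ∑' j, f j ≤ ∑' j, a j + ∑' m, b m := by
  rw [← tsum_int_add f i, ← tsum_int_add a i, tsum_int_eq_add, tsum_int_eq_add, add_comm]
  refine add_le_add (le_trans (ENNReal.tsum_le_tsum fun n => ?_) le_add_self)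
    (ENNReal.tsum_le_tsum fun m => ?_)
  · exact ha _ (by omega)
  · rw [add_comm]; exact hb m

/-- Tonelli's theorem for the region `dist y z < r`. -/
theorem lintegral_ball_swap {N : ℕ} (ν ω : Measure (Space N)) [SFinite ν] [SFinite ω] (r : ℝ)
    {F : Space N → Space N → ℝ≥0∞} (hF : Measurable (Function.uncurry F)) :
    ∫⁻ y, ∫⁻ z in ball y r, F y z ∂ω ∂ν = ∫⁻ z, ∫⁻ y in ball z r, F y z ∂ν ∂ω := by
  have hS : MeasurableSet {q : Space N × Space N | dist q.1 q.2 < r} :=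
    (isOpen_lt (by fun_prop) (by fun_prop)).measurableSet
  have h1 : ∀ y, ∫⁻ z in ball y r, F y z ∂ω =
      ∫⁻ z, {q : Space N × Space N | dist q.1 q.2 < r}.indicator (Function.uncurry F) (y, z) ∂ω := by
    intro y
    rw [← lintegral_indicator measurableSet_ball]
    refine lintegral_congr fun z => ?_
    simp [indicator, mem_ball, dist_comm]
  have h2 : ∀ z, ∫⁻ y in ball z r, F y z ∂ν =
      ∫⁻ y, {q : Space N × Space N | dist q.1 q.2 < r}.indicator (Function.uncurry F) (y, z) ∂ν := by
    intro z
    rw [← lintegral_indicator measurableSet_ball]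
    refine lintegral_congr fun y => ?_
    simp [indicator, mem_ball]
  simp only [h1, h2]
  exact lintegral_lintegral_swap (hF.indicator hS).aemeasurable

theorem setLIntegral_measure_ball_le {N : ℕ} (ω : Measure (Space N)) [SFinite ω] (x : Space N)
    (s : ℝ) {r : ℝ} {v : ℝ≥0∞} (hv : ∀ z : Space N, volume (ball z r) ≤ v) :
    ∫⁻ y in ball x s, ω (ball y r) ≤ v * ω (ball x (s + r)) := by
  have h0 : ∀ y ∈ ball x s, ω (ball y r) ≤ ∫⁻ z in ball y r, 1 ∂(ω.restrict (ball x (s + r))) := by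
    intro y hy
    rw [setLIntegral_one, Measure.restrict_apply measurableSet_ball,
      inter_eq_left.2]
    exact ball_subset_ball' (by have := mem_ball.1 hy; linarith)
  calc ∫⁻ y in ball x s, ω (ball y r)
      ≤ ∫⁻ y in ball x s, ∫⁻ z in ball y r, 1 ∂(ω.restrict (ball x (s + r))) :=
        setLIntegral_mono' measurableSet_ball h0
    _ ≤ ∫⁻ y, ∫⁻ z in ball y r, 1 ∂(ω.restrict (ball x (s + r))) :=
        lintegral_mono' Measure.restrict_le_self le_rfl
    _ = ∫⁻ z, (∫⁻ y in ball z r, 1) ∂(ω.restrict (ball x (s + r))) :=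
        lintegral_ball_swap _ _ r (F := fun _ _ => 1) measurable_const
    _ ≤ ∫⁻ _, v ∂(ω.restrict (ball x (s + r))) := by
        refine lintegral_mono fun z => ?_
        rw [setLIntegral_one]; exact hv z
    _ = _ := by rw [lintegral_const, Measure.restrict_apply_univ]

/-- The smoothing `∑_j k_j ω(B_{2^j}(y))` of a measure `ω` by a dyadic kernel `k`. -/
noncomputable def smoothing {N : ℕ} (k : ℤ → ℝ≥0∞) (ω : Measure (Space N)) (y : Space N) : ℝ≥0∞ :=
  ∑' j : ℤ, k j * ω (ball y ((2 : ℝ) ^ j))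

theorem measurable_smoothing {N : ℕ} (k : ℤ → ℝ≥0∞) (ω : Measure (Space N)) [SFinite ω] :
    Measurable (smoothing k ω) :=
  Measurable.tsum fun _ => (measurable_measure_ball ω _).const_mul _

theorem lintegral_measure_ball {N : ℕ} (hN : N ≠ 0) (ω : Measure (Space N)) [SFinite ω] (j : ℤ) :
    ∫⁻ y, ω (ball y ((2 : ℝ) ^ j)) =
      2 ^ ((N : ℝ) * j) * volume (ball (0 : Space N) 1) * ω univ := by
  have := lintegral_ball_swap (volume : Measure (Space N)) ω ((2 : ℝ) ^ j) (F := fun _ _ => 1)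
    measurable_const
  simp only [setLIntegral_one, volume_ball_two_zpow hN] at this
  rw [this, lintegral_const]

/-- The mass of the kernel `k`, up to the volume of the unit ball. -/
noncomputable def kernelMass (N : ℕ) (k : ℤ → ℝ≥0∞) : ℝ≥0∞ :=
  ∑' j : ℤ, k j * 2 ^ ((N : ℝ) * j)

theorem lintegral_smoothing {N : ℕ} (hN : N ≠ 0) (k : ℤ → ℝ≥0∞) (ω : Measure (Space N))
    [SFinite ω] :
    ∫⁻ y, smoothing k ω y = kernelMass N k * (volume (ball (0 : Space N) 1) * ω univ) := by
  unfold smoothing kernelMass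
  rw [lintegral_tsum fun _ => ((measurable_measure_ball ω _).const_mul _).aemeasurable,
    ← ENNReal.tsum_mul_right]
  refine tsum_congr fun j => ?_
  rw [lintegral_const_mul _ (measurable_measure_ball ω _), lintegral_measure_ball hN]
  ring

/-- The dyadic density of `J dy`, `J` the smoothing of `ω`, is bounded by a weighted sum of the
densities of `ω` at larger scales: the part of the kernel at scales below `2^i` only moves mass of
`B_{2^(i+1)}(x)`, the part at larger scales is estimated by the size of `k`. -/
theorem dyadicDensity_smoothing_le {N : ℕ} (hN : N ≠ 0) (d : ℝ) {k : ℤ → ℝ≥0∞}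
    (hk : ∀ j : ℤ, k j ≤ 2 ^ (-((N : ℝ) * j))) (ω : Measure (Space N)) [SFinite ω]
    (x : Space N) (i : ℤ) :
    dyadicDensity d (volume.withDensity (smoothing k ω)) x i ≤
      volume (ball (0 : Space N) 1) * 2 ^ d * (kernelMass N k + 1) *
        ∑' m : ℕ, ((2 : ℝ≥0∞) ^ (-(N - d))) ^ m * dyadicDensity d ω x (i + m + 1) := by
  set v := volume (ball (0 : Space N) 1) with hv
  have hball : ∀ {j i' : ℤ}, j ≤ i' → i ≤ i' →
      ω (ball x ((2 : ℝ) ^ i + 2 ^ j)) ≤ ω (ball x (2 ^ (i' + 1))) := by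
    intro j i' hj hi
    refine measure_mono (ball_subset_ball ?_)
    have h1 : (2 : ℝ) ^ i ≤ 2 ^ i' := zpow_le_zpow_right₀ one_le_two hi
    have h2 : (2 : ℝ) ^ j ≤ 2 ^ i' := zpow_le_zpow_right₀ one_le_two hj
    rw [zpow_add_one₀ two_ne_zero]; linarith
  have h1 : (volume.withDensity (smoothing k ω)) (ball x (2 ^ i)) ≤
      (∑' j : ℤ, k j * 2 ^ ((N : ℝ) * j) * (v * ω (ball x (2 ^ (i + 1))))) +
      ∑' m : ℕ, 2 ^ (-((N : ℝ) * (i + m : ℤ))) *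
        (2 ^ ((N : ℝ) * i) * v * ω (ball x (2 ^ (i + m + 1)))) := by
    rw [withDensity_apply _ measurableSet_ball]
    unfold smoothing
    rw [lintegral_tsum fun _ => ((measurable_measure_ball ω _).const_mul _).aemeasurable]
    simp only [lintegral_const_mul _ (measurable_measure_ball ω _)]
    refine tsum_int_le_of_split i (fun j hj => ?_) (fun m => ?_)
    · have := setLIntegral_measure_ball_le ω x ((2 : ℝ) ^ i)
        (fun z => (volume_ball_two_zpow hN z j).le)
      rw [mul_assoc]
      gcongr
      refine this.trans ?_
      rw [mul_assoc]
      exact mul_le_mul_right (mul_le_mul_right (hball hj le_rfl) _) _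
    · refine mul_le_mul' (hk _) ?_
      calc ∫⁻ y in ball x (2 ^ i), ω (ball y (2 ^ (i + (m : ℤ))))
          ≤ ∫⁻ _ in ball x (2 ^ i), ω (ball x (2 ^ (i + m + 1))) := by
            refine setLIntegral_mono' measurableSet_ball fun y hy => ?_
            refine (measure_mono (ball_subset_ball' (ε₂ := (2 : ℝ) ^ i + 2 ^ (i + (m : ℤ))) ?_)).trans
              (hball le_rfl (by omega))
            have := mem_ball.1 hy
            linarith
        _ = _ := by rw [setLIntegral_const, volume_ball_two_zpow hN, ← hv]; ring
  have h2 : ∀ m : ℕ, ω (ball x (2 ^ (i + m + 1))) * 2 ^ (-(d * i)) =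
      2 ^ (d + d * m) * dyadicDensity d ω x (i + m + 1) := by
    intro m
    unfold dyadicDensity
    rw [mul_left_comm, ← two_rpow_add]
    congr 2
    push_cast; ring
  have h3 : ∑' j : ℤ, k j * 2 ^ ((N : ℝ) * j) * (v * ω (ball x (2 ^ (i + 1)))) * 2 ^ (-(d * i)) ≤
      v * 2 ^ d * kernelMass N k *
        ∑' m : ℕ, ((2 : ℝ≥0∞) ^ (-(N - d))) ^ m * dyadicDensity d ω x (i + m + 1) := by
    have h4 := h2 0
    simp only [Nat.cast_zero, add_zero, mul_zero] at h4
    calc ∑' j : ℤ, k j * 2 ^ ((N : ℝ) * j) * (v * ω (ball x (2 ^ (i + 1)))) * 2 ^ (-(d * i))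
        = v * 2 ^ d * kernelMass N k * dyadicDensity d ω x (i + 1) := by
          simp only [mul_assoc, h4]
          simp only [← mul_assoc]
          rw [ENNReal.tsum_mul_right, ENNReal.tsum_mul_right, ENNReal.tsum_mul_right, kernelMass]
          ring
      _ ≤ _ := by
          gcongr
          refine le_trans ?_ (ENNReal.le_tsum 0)
          simp
  calc dyadicDensity d (volume.withDensity (smoothing k ω)) x i
      ≤ ((∑' j : ℤ, k j * 2 ^ ((N : ℝ) * j) * (v * ω (ball x (2 ^ (i + 1))))) +
        ∑' m : ℕ, 2 ^ (-((N : ℝ) * (i + m : ℤ))) *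
        (2 ^ ((N : ℝ) * i) * v * ω (ball x (2 ^ (i + m + 1))))) * 2 ^ (-(d * i)) := by
        unfold dyadicDensity; gcongr
    _ ≤ v * 2 ^ d * kernelMass N k *
        (∑' m : ℕ, ((2 : ℝ≥0∞) ^ (-(N - d))) ^ m * dyadicDensity d ω x (i + m + 1)) +
        v * 2 ^ d *
        ∑' m : ℕ, ((2 : ℝ≥0∞) ^ (-(N - d))) ^ m * dyadicDensity d ω x (i + m + 1) := by
        rw [add_mul, ← ENNReal.tsum_mul_right, ← ENNReal.tsum_mul_right]
        refine add_le_add h3 (le_of_eq ?_)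
        rw [← ENNReal.tsum_mul_left]
        refine tsum_congr fun m => ?_
        calc 2 ^ (-((N : ℝ) * (i + m : ℤ))) *
              (2 ^ ((N : ℝ) * i) * v * ω (ball x (2 ^ (i + m + 1)))) * 2 ^ (-(d * i))
            = (2 ^ (-((N : ℝ) * (i + m : ℤ))) * 2 ^ ((N : ℝ) * i)) * v *
              (ω (ball x (2 ^ (i + m + 1))) * 2 ^ (-(d * i))) := by ring
          _ = (2 ^ (-((N : ℝ) * (i + m : ℤ))) * 2 ^ ((N : ℝ) * i) * 2 ^ (d + d * m)) * v *
              dyadicDensity d ω x (i + m + 1) := by rw [h2 m]; ring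
          _ = (2 ^ d * ((2 : ℝ≥0∞) ^ (-(N - d))) ^ m) * v * dyadicDensity d ω x (i + m + 1) := by
              rw [two_rpow_mul_nat, ← two_rpow_add, ← two_rpow_add, ← two_rpow_add]
              congr 3
              push_cast; ring
          _ = _ := by ring
    _ = _ := by ring

/-- The potential of `J dy`, `J` a smoothing of `ω`, is controlled by the one of `ω`, pointwise. -/
theorem dyadicPotential_smoothing_le {N : ℕ} (hN : N ≠ 0) (d : ℝ) {κ : ℝ} (hκ : 0 < κ)
    {k : ℤ → ℝ≥0∞} (hk : ∀ j : ℤ, k j ≤ 2 ^ (-((N : ℝ) * j))) (ω : Measure (Space N)) [SFinite ω]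
    (x : Space N) :
    dyadicPotential d κ (volume.withDensity (smoothing k ω)) x ≤
      (volume (ball (0 : Space N) 1) * 2 ^ d * (kernelMass N k + 1)) ^ κ *
        hardyConst (2 ^ (-(N - d))) κ * dyadicPotential d κ ω x := by
  unfold dyadicPotential
  calc ∑' i : ℤ, dyadicDensity d (volume.withDensity (smoothing k ω)) x i ^ κ
      ≤ ∑' i : ℤ, (volume (ball (0 : Space N) 1) * 2 ^ d * (kernelMass N k + 1)) ^ κ *
        (∑' m : ℕ, ((2 : ℝ≥0∞) ^ (-(N - d))) ^ m * dyadicDensity d ω x (i + m + 1)) ^ κ := by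
        refine ENNReal.tsum_le_tsum fun i => ?_
        rw [← ENNReal.mul_rpow_of_nonneg _ _ hκ.le]
        gcongr
        exact dyadicDensity_smoothing_le hN d hk ω x i
    _ ≤ _ := by
        rw [ENNReal.tsum_mul_left, mul_assoc (_ ^ κ)]
        refine mul_le_mul_right ?_ _
        refine (tsum_hardy_le _ (fun j => dyadicDensity d ω x (j + 1)) hκ).trans_eq ?_
        rw [tsum_int_add (fun j => dyadicDensity d ω x j ^ κ) 1]

/-- The kernel used to dominate exponentials of potentials. Its exponents are slightly larger
than `d` at small scales and larger than `N` at large scales (`n` is the exponent there). -/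
noncomputable def twoScaleKernel (e n : ℝ) (j : ℤ) : ℝ≥0∞ :=
  if 0 ≤ j then 2 ^ (-(n * j)) else 2 ^ (-(e * j))

theorem twoScaleKernel_le {N : ℕ} {e n : ℝ} (he : e ≤ N) (hn : N ≤ n) (j : ℤ) :
    twoScaleKernel e n j ≤ 2 ^ (-((N : ℝ) * j)) := by
  unfold twoScaleKernel
  split_ifs with h
  · have : (0 : ℝ) ≤ j := by exact_mod_cast h
    exact two_rpow_mono (by nlinarith)
  · have : (j : ℝ) ≤ 0 := by exact_mod_cast (le_of_not_ge h)
    exact two_rpow_mono (by nlinarith)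

theorem kernelMass_twoScaleKernel_ne_top {N : ℕ} {e n : ℝ} (he : e < N) (hn : N < n) :
    kernelMass N (twoScaleKernel e n) ≠ ∞ := by
  unfold kernelMass
  rw [tsum_int_eq_add]
  refine ENNReal.add_ne_top.2 ⟨?_, ?_⟩
  · convert tsum_two_rpow_ne_top (s := N - n) (by linarith) using 4 with m
    rw [twoScaleKernel, if_pos (by positivity), ← two_rpow_add]
    congr 1
    push_cast; ring
  · refine ne_top_of_le_ne_top (tsum_two_rpow_ne_top (s := e - N) (by linarith))
      (ENNReal.tsum_le_tsum fun m => ?_)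
    rw [twoScaleKernel, if_neg (by omega), ← two_rpow_add]
    refine two_rpow_mono ?_
    push_cast
    linarith

/-! ### Exponential of a dyadic potential against its smoothing -/

/-- The sum `∑ x_j` of dyadic terms when the smoothing is `τ < 1`; each term at a large scale is
estimated by interpolating between its two bounds. -/
theorem tsum_le_of_smoothing_le_one {d θ κ n L : ℝ} (hθ : 0 < θ) (hκ : 0 < κ)
    (hL : 1 < L) {G : ℤ → ℝ≥0∞} {τ : ℝ≥0∞} (hτ : τ ≤ 1)
    (h0 : ∀ j : ℕ, G j ≤ 1)
    (hG : ∀ j, twoScaleKernel (d + θ / 2) n j * G j ≤ τ) :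
    ∑' j : ℤ, (G j * 2 ^ (-(d * j))) ^ κ ≤
      (∑' m : ℕ, 2 ^ (κ * (n / L - d) * m) + ∑' m : ℕ, 2 ^ (-(θ / 2 * κ) * m)) * τ ^ (κ / L) := by
  have hL0 : 0 < L := by linarith
  have hL1 : 0 < 1 / L := by positivity
  have hinv : ∀ j, G j ≤ τ * (twoScaleKernel (d + θ / 2) n j)⁻¹ := by
    intro j
    have hne : twoScaleKernel (d + θ / 2) n j ≠ 0 ∧ twoScaleKernel (d + θ / 2) n j ≠ ∞ := by
      unfold twoScaleKernel; split_ifs <;> simp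
    rw [← div_eq_mul_inv, ENNReal.le_div_iff_mul_le (Or.inl hne.1) (Or.inl hne.2), mul_comm]
    exact hG j
  rw [tsum_int_eq_add, add_mul, ← ENNReal.tsum_mul_right, ← ENNReal.tsum_mul_right]
  refine add_le_add (ENNReal.tsum_le_tsum fun j => ?_) (ENNReal.tsum_le_tsum fun j => ?_)
  · have h1 : G j ≤ (τ * 2 ^ (n * j)) ^ (1 / L) := by
      have h2 := hinv j
      rw [twoScaleKernel, if_pos (by positivity), ← ENNReal.rpow_neg, neg_neg] at h2
      rw [Int.cast_natCast] at h2
      calc G j = G j ^ (1 : ℝ) := (ENNReal.rpow_one _).symm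
        _ ≤ G j ^ (1 / L) :=
            ENNReal.rpow_le_rpow_of_exponent_ge (h0 j) ((div_le_one hL0).2 hL.le)
        _ ≤ _ := by gcongr
    calc (G j * 2 ^ (-(d * (j : ℤ)))) ^ κ
        ≤ ((τ * 2 ^ (n * j)) ^ (1 / L) * 2 ^ (-(d * (j : ℤ)))) ^ κ := by gcongr
      _ = _ := by
          rw [ENNReal.mul_rpow_of_nonneg _ _ hL1.le, ENNReal.mul_rpow_of_nonneg _ _ hκ.le,
            ENNReal.mul_rpow_of_nonneg _ _ hκ.le]
          simp only [← ENNReal.rpow_mul]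
          rw [mul_assoc, ← two_rpow_add, mul_comm]
          congr 2
          · push_cast; field_simp; ring
          · field_simp
  · have h1 : G (-(j + 1)) * 2 ^ (-(d * ((-(j + 1) : ℤ) : ℝ))) ≤ τ * 2 ^ (-(θ / 2) * j) := by
      have h2 := hinv (-(j + 1))
      rw [twoScaleKernel, if_neg (by omega), ← ENNReal.rpow_neg, neg_neg] at h2
      calc G (-(j + 1)) * 2 ^ (-(d * ((-(j + 1) : ℤ) : ℝ)))
          ≤ τ * 2 ^ ((d + θ / 2) * ((-(j + 1) : ℤ) : ℝ)) * 2 ^ (-(d * ((-(j + 1) : ℤ) : ℝ))) := by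
            gcongr
        _ = τ * 2 ^ (-(θ / 2) * (j + 1)) := by
            rw [mul_assoc, ← two_rpow_add]
            congr 2
            push_cast; ring
        _ ≤ _ := by
            gcongr τ * ?_
            exact two_rpow_mono (by linarith)
    calc (G (-(j + 1)) * 2 ^ (-(d * ((-(j + 1) : ℤ) : ℝ)))) ^ κ
        ≤ (τ * 2 ^ (-(θ / 2) * j)) ^ κ := by gcongr
      _ = 2 ^ (-(θ / 2 * κ) * j) * τ ^ κ := by
          rw [ENNReal.mul_rpow_of_nonneg _ _ hκ.le, ← ENNReal.rpow_mul, mul_comm]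
          congr 2; ring
      _ ≤ _ := by
          gcongr _ * ?_
          exact ENNReal.rpow_le_rpow_of_exponent_ge hτ (div_le_self hκ.le hL.le)

/-- The sum `∑ x_j` of dyadic terms when the smoothing is at most `2^(θn/2)`: the scales between
`2^(-n)` and `1`, where only the logarithmic bound is available, contribute `O(n^(1/β))`. -/
theorem tsum_le_of_smoothing_le_two_rpow {d θ κ β η n' : ℝ} (hκ : 0 < κ)
    (hβ : 1 ≤ β) (hη : η * κ = 1 - 1 / β) {G : ℤ → ℝ≥0∞} {n : ℕ} (hn : 1 ≤ n)
    (h0 : ∀ j : ℕ, G j ≤ 1)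
    (h1 : ∀ j : ℕ, G (-(j + 1)) ≤ 2 ^ (d * ((-(j + 1) : ℤ) : ℝ)) *
      ENNReal.ofReal (((j : ℝ) + 1) ^ (-η)))
    (hG : ∀ j, twoScaleKernel (d + θ / 2) n' j * G j ≤ 2 ^ (θ / 2 * n)) (hθ : 0 < θ) :
    ∑' j : ℤ, (G j * 2 ^ (-(d * j))) ^ κ ≤
      (∑' m : ℕ, 2 ^ (-(d * κ) * m) + ∑' m : ℕ, 2 ^ (-(θ / 2 * κ) * m) + ENNReal.ofReal β) *
        (n : ℝ≥0∞) ^ (1 / β) := by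
  have hβ0 : 0 < 1 / β := by positivity
  have hn1 : (1 : ℝ≥0∞) ≤ (n : ℝ≥0∞) ^ (1 / β) :=
    ENNReal.one_le_rpow (by exact_mod_cast hn) hβ0
  rw [tsum_int_eq_add, add_assoc, add_mul]
  refine add_le_add ?_ ?_
  · calc ∑' j : ℕ, (G j * 2 ^ (-(d * (j : ℤ)))) ^ κ
        ≤ ∑' m : ℕ, 2 ^ (-(d * κ) * m) := by
          refine ENNReal.tsum_le_tsum fun j => ?_
          calc (G j * 2 ^ (-(d * (j : ℤ)))) ^ κ ≤ (1 * 2 ^ (-(d * (j : ℤ)))) ^ κ := by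
                gcongr; exact h0 j
            _ = _ := by
                rw [one_mul, ← ENNReal.rpow_mul]
                congr 1; push_cast; ring
      _ ≤ _ := le_mul_of_one_le_right' hn1
  · rw [← ENNReal.summable.sum_add_tsum_nat_add' (k := n), add_mul, add_comm]
    refine add_le_add ?_ ?_
    · calc ∑' j : ℕ, (G (-((j + n : ℕ) + 1)) * 2 ^ (-(d * ((-((j + n : ℕ) + 1) : ℤ) : ℝ)))) ^ κ
          ≤ ∑' m : ℕ, 2 ^ (-(θ / 2 * κ) * m) := by
            refine ENNReal.tsum_le_tsum fun j => ?_
            set i : ℤ := -((j + n : ℕ) + 1) with hi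
            have h2 := hG i
            rw [twoScaleKernel, if_neg (by omega)] at h2
            have h3 : G i * 2 ^ (-(d * (i : ℝ))) ≤ 2 ^ (-(θ / 2) * j) := by
              calc G i * 2 ^ (-(d * (i : ℝ)))
                  = (2 ^ (-((d + θ / 2) * (i : ℝ))) * G i) * 2 ^ (θ / 2 * (i : ℝ)) := by
                    rw [mul_comm _ (G i), mul_assoc, ← two_rpow_add]
                    congr 2; ring
                _ ≤ 2 ^ (θ / 2 * n) * 2 ^ (θ / 2 * (i : ℝ)) := by gcongr
                _ ≤ _ := by
                    rw [← two_rpow_add]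
                    refine two_rpow_mono ?_
                    rw [hi]; push_cast; nlinarith
            calc (G i * 2 ^ (-(d * (i : ℝ)))) ^ κ ≤ (2 ^ (-(θ / 2) * j)) ^ κ := by gcongr
              _ = _ := by
                rw [← ENNReal.rpow_mul]
                congr 1; ring
        _ ≤ _ := le_mul_of_one_le_right' hn1
    · calc ∑ j ∈ Finset.range n, (G (-(j + 1)) * 2 ^ (-(d * ((-(j + 1) : ℤ) : ℝ)))) ^ κ
          ≤ ∑ j ∈ Finset.range n, ENNReal.ofReal (((j : ℝ) + 1) ^ (1 / β - 1)) := by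
            refine Finset.sum_le_sum fun j _ => ?_
            calc (G (-(j + 1)) * 2 ^ (-(d * ((-(j + 1) : ℤ) : ℝ)))) ^ κ
                ≤ (2 ^ (d * ((-(j + 1) : ℤ) : ℝ)) * ENNReal.ofReal (((j : ℝ) + 1) ^ (-η)) *
                  2 ^ (-(d * ((-(j + 1) : ℤ) : ℝ)))) ^ κ := by gcongr; exact h1 j
              _ = _ := by
                rw [mul_right_comm, ← two_rpow_add, add_neg_cancel, ENNReal.rpow_zero, one_mul,
                  ENNReal.ofReal_rpow_of_pos (by positivity), ← Real.rpow_mul (by positivity)]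
                congr 2
                linarith
        _ = ENNReal.ofReal (∑ j ∈ Finset.range n, ((j : ℝ) + 1) ^ (1 / β - 1)) :=
            (ENNReal.ofReal_sum_of_nonneg fun j _ => by positivity).symm
        _ ≤ ENNReal.ofReal (β * (n : ℝ) ^ (1 / β)) := by
            refine ENNReal.ofReal_le_ofReal ?_
            have := sum_rpow_sub_one_le hβ0 ((div_le_one (by linarith)).2 hβ) n
            simpa only [one_div, inv_inv] using this
        _ = _ := by
            rw [ENNReal.ofReal_mul (by linarith), ← ENNReal.ofReal_rpow_of_nonneg (by positivity)
              hβ0.le, ENNReal.ofReal_natCast]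

/-- The normalized case of `exists_expTail_dyadic_le`. -/
theorem exists_expTail_normalized_le {d θ κ β η n : ℝ} {l : ℕ} (hd : 0 < d) (hθ : 0 < θ)
    (hκ : 0 < κ) (hβ : 1 ≤ β) (hl : 1 ≤ l) (hη : η * κ = 1 - 1 / β) (hL : 1 < l * β * κ)
    (hn : n < l * β * κ * d) :
    ∃ C : ℝ, 0 < C ∧ ∀ G : ℤ → ℝ≥0∞, (∀ j : ℕ, G j ≤ 1) →
      (∀ j : ℕ, G (-(j + 1)) ≤ 2 ^ (d * ((-(j + 1) : ℤ) : ℝ)) *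
        ENNReal.ofReal (((j : ℝ) + 1) ^ (-η))) →
      expTail l ((ENNReal.ofReal C)⁻¹ * (∑' j : ℤ, (G j * 2 ^ (-(d * j))) ^ κ) ^ β) ≤
        ENNReal.ofReal (Real.exp 1) * ∑' j : ℤ, twoScaleKernel (d + θ / 2) n j * G j := by
  have hβ0 : 0 < β := by linarith
  set L : ℝ := l * β * κ with hLdef
  have hL0 : 0 < L := by linarith
  have hl0 : (0 : ℝ) < l := by exact_mod_cast hl
  set S₁ : ℝ≥0∞ := ∑' m : ℕ, 2 ^ (κ * (n / L - d) * m) + ∑' m : ℕ, 2 ^ (-(θ / 2 * κ) * m)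
  set S₂ : ℝ≥0∞ := ∑' m : ℕ, 2 ^ (-(d * κ) * m) + ∑' m : ℕ, 2 ^ (-(θ / 2 * κ) * m)
    + ENNReal.ofReal β
  have hS₁ : S₁ ≠ ∞ := by
    refine ENNReal.add_ne_top.2 ⟨tsum_two_rpow_ne_top ?_, tsum_two_rpow_ne_top ?_⟩
    · refine mul_neg_of_pos_of_neg hκ ?_
      rw [sub_neg, div_lt_iff₀ hL0]; linarith
    · rw [neg_lt_zero]; positivity
  have hS₂ : S₂ ≠ ∞ := by
    refine ENNReal.add_ne_top.2 ⟨ENNReal.add_ne_top.2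
      ⟨tsum_two_rpow_ne_top ?_, tsum_two_rpow_ne_top ?_⟩, ENNReal.ofReal_ne_top⟩ <;>
    · rw [neg_lt_zero]; positivity
  -- the number of scales to be cut off is at most `c (1 + log τ)`
  set c : ℝ := 2 / θ / Real.log 2 + 2 with hc
  have hlog2 : 0 < Real.log 2 := Real.log_pos one_lt_two
  have hc0 : 0 < c := by positivity
  set C : ℝ := (S₁ ^ β).toReal + (S₂ ^ β).toReal * c + 1 with hC
  have hC0 : 0 < C := by positivity
  have hC1 : S₁ ^ β ≤ ENNReal.ofReal C := by
    rw [← ENNReal.ofReal_toReal (ENNReal.rpow_ne_top_of_nonneg hβ0.le hS₁)]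
    refine ENNReal.ofReal_le_ofReal ?_
    have : 0 ≤ (S₂ ^ β).toReal * c := by positivity
    linarith
  have hC2 : S₂ ^ β * ENNReal.ofReal c ≤ ENNReal.ofReal C := by
    rw [← ENNReal.ofReal_toReal (ENNReal.rpow_ne_top_of_nonneg hβ0.le hS₂),
      ← ENNReal.ofReal_mul ENNReal.toReal_nonneg]
    refine ENNReal.ofReal_le_ofReal ?_
    have : 0 ≤ (S₁ ^ β).toReal := by positivity
    linarith
  have hCinv : ∀ X Y : ℝ≥0∞, X ≤ ENNReal.ofReal C * Y → (ENNReal.ofReal C)⁻¹ * X ≤ Y := by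
    intro X Y h
    calc (ENNReal.ofReal C)⁻¹ * X ≤ (ENNReal.ofReal C)⁻¹ * (ENNReal.ofReal C * Y) := by gcongr
      _ = Y := by
        rw [← mul_assoc, ENNReal.inv_mul_cancel (by simpa using hC0) ENNReal.ofReal_ne_top, one_mul]
  refine ⟨C, hC0, fun G h0 h1 => ?_⟩
  set τ : ℝ≥0∞ := ∑' j : ℤ, twoScaleKernel (d + θ / 2) n j * G j with hτdef
  have hG : ∀ j, twoScaleKernel (d + θ / 2) n j * G j ≤ τ := fun j =>
    ENNReal.le_tsum (f := fun j => twoScaleKernel (d + θ / 2) n j * G j) j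
  have hexp : expTail l 1 ≤ ENNReal.ofReal (Real.exp 1) := by
    simpa using expTail_ofReal_le_exp l (zero_le_one (α := ℝ))
  rcases le_total τ 1 with hτ | hτ
  · have key := tsum_le_of_smoothing_le_one hθ hκ hL hτ h0 hG
    calc expTail l ((ENNReal.ofReal C)⁻¹ * (∑' j : ℤ, (G j * 2 ^ (-(d * j))) ^ κ) ^ β)
        ≤ expTail l (τ ^ (1 / (l : ℝ)) * 1) := by
          refine expTail_mono l (hCinv _ _ ?_)
          calc (∑' j : ℤ, (G j * 2 ^ (-(d * j))) ^ κ) ^ β ≤ (S₁ * τ ^ (κ / L)) ^ β := by gcongr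
            _ = S₁ ^ β * (τ ^ (1 / (l : ℝ)) * 1) := by
              rw [ENNReal.mul_rpow_of_nonneg _ _ hβ0.le, ← ENNReal.rpow_mul, mul_one]
              congr 2
              rw [hLdef]; field_simp
            _ ≤ _ := by gcongr
      _ ≤ (τ ^ (1 / (l : ℝ))) ^ l * expTail l 1 :=
          expTail_mul_le l (ENNReal.rpow_le_one hτ (by positivity)) 1
      _ ≤ _ := by
          rw [← ENNReal.rpow_natCast, ← ENNReal.rpow_mul, one_div_mul_cancel hl0.ne',
            ENNReal.rpow_one, mul_comm]
          gcongr
  · rcases eq_or_ne τ ∞ with htop | htop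
    · rw [htop, ENNReal.mul_top (by simpa using Real.exp_pos 1)]
      exact le_top
    set t : ℝ := τ.toReal with ht
    have hτt : τ = ENNReal.ofReal t := (ENNReal.ofReal_toReal htop).symm
    have ht1 : 1 ≤ t := by
      rw [hτt] at hτ
      simpa using hτ
    have hlogt : 0 ≤ Real.log t := Real.log_nonneg ht1
    set q : ℕ := ⌈2 / θ * (Real.log t / Real.log 2)⌉₊ + 1 with hq
    have hq1 : 2 / θ * (Real.log t / Real.log 2) ≤ q := by
      rw [hq]; push_cast
      exact (Nat.le_ceil _).trans (by linarith)
    have hq2 : (q : ℝ) ≤ c * (1 + Real.log t) := by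
      have h3 := (Nat.ceil_lt_add_one
        (show 0 ≤ 2 / θ * (Real.log t / Real.log 2) by positivity)).le
      have h4 : 2 / θ * (Real.log t / Real.log 2) = 2 / θ / Real.log 2 * Real.log t := by ring
      have h5 : 0 < 2 / θ / Real.log 2 := by positivity
      rw [hq]; push_cast
      rw [hc]
      nlinarith
    have hτq : τ ≤ 2 ^ (θ / 2 * q) := by
      have h6 : Real.log t ≤ θ / 2 * q * Real.log 2 := by
        have h7 : 2 / θ * (Real.log t / Real.log 2) * (θ / 2 * Real.log 2) ≤
          q * (θ / 2 * Real.log 2) := by gcongr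
        have h8 : 2 / θ * (Real.log t / Real.log 2) * (θ / 2 * Real.log 2) = Real.log t := by
          field_simp
        linarith
      have h9 : t ≤ (2 : ℝ) ^ (θ / 2 * q) := by
        rw [Real.rpow_def_of_pos two_pos, ← Real.log_le_iff_le_exp (by linarith)]
        linarith
      rw [hτt]
      refine (ENNReal.ofReal_le_ofReal h9).trans_eq ?_
      rw [← ENNReal.ofReal_rpow_of_pos two_pos]; simp
    have key := tsum_le_of_smoothing_le_two_rpow hκ hβ hη (n := q) (by omega) h0 h1
      (fun j => (hG j).trans hτq) hθ
    calc expTail l ((ENNReal.ofReal C)⁻¹ * (∑' j : ℤ, (G j * 2 ^ (-(d * j))) ^ κ) ^ β)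
        ≤ expTail l (ENNReal.ofReal (1 + Real.log t)) := by
          refine expTail_mono l (hCinv _ _ ?_)
          calc (∑' j : ℤ, (G j * 2 ^ (-(d * j))) ^ κ) ^ β
              ≤ (S₂ * (q : ℝ≥0∞) ^ (1 / β)) ^ β := by gcongr
            _ = S₂ ^ β * q := by
              rw [ENNReal.mul_rpow_of_nonneg _ _ hβ0.le, ← ENNReal.rpow_mul,
                one_div_mul_cancel hβ0.ne', ENNReal.rpow_one]
            _ ≤ S₂ ^ β * (ENNReal.ofReal c * ENNReal.ofReal (1 + Real.log t)) := by
              gcongr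
              rw [← ENNReal.ofReal_mul hc0.le, ← ENNReal.ofReal_natCast]
              exact ENNReal.ofReal_le_ofReal hq2
            _ ≤ _ := by
              rw [← mul_assoc]
              gcongr
      _ ≤ ENNReal.ofReal (Real.exp (1 + Real.log t)) := expTail_ofReal_le_exp l (by linarith)
      _ = _ := by
          rw [Real.exp_add, Real.exp_log (by linarith), ENNReal.ofReal_mul (Real.exp_pos 1).le, hτt]

/-- The exponential of a dyadic potential is dominated, pointwise, by the smoothing of the measure
with a kernel of finite mass. The factor `m^(lβκ - 1)` gains smallness, since `lβκ > 1`. -/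
theorem exists_expTail_dyadic_le {d θ κ β η n : ℝ} {l : ℕ} (hd : 0 < d) (hθ : 0 < θ)
    (hκ : 0 < κ) (hβ : 1 ≤ β) (hl : 1 ≤ l) (hη : η * κ = 1 - 1 / β) (hL : 1 < l * β * κ)
    (hn : n < l * β * κ * d) {b : ℝ} (hb : 0 < b) :
    ∃ C : ℝ, 0 < C ∧ ∃ m₀ : ℝ, 0 < m₀ ∧ ∀ m : ℝ, 0 < m → m ≤ m₀ →
      ∀ g : ℤ → ℝ≥0∞, (∀ j : ℕ, g j ≤ ENNReal.ofReal m) →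
      (∀ j : ℕ, g (-(j + 1)) ≤ ENNReal.ofReal m * (2 ^ (d * ((-(j + 1) : ℤ) : ℝ)) *
        ENNReal.ofReal (((j : ℝ) + 1) ^ (-η)))) →
      expTail l (ENNReal.ofReal b * (∑' j : ℤ, (g j * 2 ^ (-(d * j))) ^ κ) ^ β) ≤
        ENNReal.ofReal (C * m ^ (l * β * κ - 1)) *
          ∑' j : ℤ, twoScaleKernel (d + θ / 2) n j * g j := by
  obtain ⟨C, hC, hkey⟩ := exists_expTail_normalized_le hd hθ hκ hβ hl hη hL hn
  have hβ0 : 0 < β := by linarith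
  refine ⟨(b * C) ^ l * Real.exp 1, by positivity, (b * C)⁻¹ ^ (κ * β)⁻¹, by positivity,
    fun m hm hm0 g h0 h1 => ?_⟩
  have hm' : ENNReal.ofReal m ≠ 0 := by simpa using hm
  have hcancel : ∀ x, ENNReal.ofReal m * ((ENNReal.ofReal m)⁻¹ * x) = x := fun x => by
    rw [← mul_assoc, ENNReal.mul_inv_cancel hm' ENNReal.ofReal_ne_top, one_mul]
  have hcancel' : ∀ x, (ENNReal.ofReal m)⁻¹ * (ENNReal.ofReal m * x) = x := fun x => by
    rw [← mul_assoc, ENNReal.inv_mul_cancel hm' ENNReal.ofReal_ne_top, one_mul]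
  have hG := hkey (fun j => (ENNReal.ofReal m)⁻¹ * g j)
    (fun j => by
      calc (ENNReal.ofReal m)⁻¹ * g j ≤ (ENNReal.ofReal m)⁻¹ * (ENNReal.ofReal m * 1) := by
            rw [mul_one]; gcongr; exact h0 j
        _ = 1 := hcancel' 1)
    (fun j => by
      refine (mul_le_mul_right (h1 j) _).trans_eq (hcancel' _))
  set z : ℝ := b * C * m ^ (κ * β) with hz
  have hz0 : 0 < z := by positivity
  have hz1 : z ≤ 1 := by
    calc z ≤ b * C * ((b * C)⁻¹ ^ (κ * β)⁻¹) ^ (κ * β) := by rw [hz]; gcongr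
      _ = 1 := by
        rw [Real.rpow_inv_rpow (by positivity) (by positivity)]
        field_simp
  set D := ∑' j : ℤ, ((ENNReal.ofReal m)⁻¹ * g j * 2 ^ (-(d * j))) ^ κ with hD
  have hDm : ∑' j : ℤ, (g j * 2 ^ (-(d * j))) ^ κ = ENNReal.ofReal m ^ κ * D := by
    rw [hD, ← ENNReal.tsum_mul_left]
    refine tsum_congr fun j => ?_
    rw [← ENNReal.mul_rpow_of_nonneg _ _ hκ.le, mul_assoc, hcancel]
  calc expTail l (ENNReal.ofReal b * (∑' j : ℤ, (g j * 2 ^ (-(d * j))) ^ κ) ^ β)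
      = expTail l (ENNReal.ofReal z * ((ENNReal.ofReal C)⁻¹ * D ^ β)) := by
        rw [hDm, ENNReal.mul_rpow_of_nonneg _ _ hβ0.le, ← ENNReal.rpow_mul,
          ENNReal.ofReal_rpow_of_pos hm, ← mul_assoc, ← mul_assoc, ← ENNReal.ofReal_mul hb.le,
          ← ENNReal.ofReal_inv_of_pos hC, ← ENNReal.ofReal_mul hz0.le]
        congr 3
        rw [hz]; field_simp
    _ ≤ ENNReal.ofReal z ^ l * expTail l ((ENNReal.ofReal C)⁻¹ * D ^ β) :=
        expTail_mul_le l (by simpa using hz1) _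
    _ ≤ ENNReal.ofReal z ^ l * (ENNReal.ofReal (Real.exp 1) *
        ∑' j : ℤ, twoScaleKernel (d + θ / 2) n j * ((ENNReal.ofReal m)⁻¹ * g j)) := by gcongr
    _ = _ := by
        simp only [mul_left_comm _ (ENNReal.ofReal m)⁻¹]
        rw [ENNReal.tsum_mul_left, ← ENNReal.ofReal_inv_of_pos hm, ← ENNReal.ofReal_pow hz0.le,
          ← mul_assoc, ← mul_assoc, ← ENNReal.ofReal_mul (by positivity),
          ← ENNReal.ofReal_mul (by positivity)]
        congr 2
        rw [hz, mul_pow, ← Real.rpow_natCast (m ^ (κ * β)), ← Real.rpow_mul hm.le,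
          Real.rpow_sub_one hm.ne']
        have : κ * β * l = l * β * κ := by ring
        rw [this]
        field_simp

/-! ### Consequences of a bound on the fractional maximal function -/

theorem logWeight_pos (η t : ℝ) (ht : 0 < t) : 0 < logWeight η t := by
  unfold logWeight
  split_ifs with h
  · exact Real.rpow_pos_of_pos (neg_pos.2 (Real.log_neg ht (by linarith))) _
  · exact Real.rpow_pos_of_pos (Real.log_pos one_lt_two) _

theorem ae_fracMaximal_le {N : ℕ} (α p β : ℝ) (ω : Measure (Space N)) :
    ∀ᵐ x, fracMaximal (α * p) ((p - 1) * (β - 1) / β) ω x ≤ maximalNorm α p β ω := by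
  unfold maximalNorm
  rw [eLpNorm_exponent_top]
  filter_upwards [enorm_ae_le_eLpNormEssSup
    (fracMaximal (α * p) ((p - 1) * (β - 1) / β) ω) volume] with x hx
  simpa using hx

/-- An almost everywhere bound for the maximal function yields a bound for the masses of *all*
balls: each ball `B_t(x)` is contained in `B_{2t}(x')` for some `x'` outside a null set. -/
theorem measure_ball_le_of_maximalNorm {N : ℕ} {α p β M : ℝ} {ω : Measure (Space N)}
    (h : maximalNorm α p β ω ≤ ENNReal.ofReal M) (x : Space N) {t : ℝ} (ht : 0 < t) :
    ω (ball x t) ≤ ENNReal.ofReal M * ENNReal.ofReal ((2 * t) ^ ((N : ℝ) - α * p) *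
      logWeight ((p - 1) * (β - 1) / β) (2 * t)) := by
  obtain ⟨x', hx', hd⟩ := (Measure.dense_of_ae (ae_fracMaximal_le α p β ω)).exists_dist_lt x ht
  have ht2 : 0 < 2 * t := by linarith
  have hpos : 0 < (2 * t) ^ ((N : ℝ) - α * p) * logWeight ((p - 1) * (β - 1) / β) (2 * t) :=
    mul_pos (Real.rpow_pos_of_pos ht2 _) (logWeight_pos _ _ ht2)
  have h1 : ω (ball x' (2 * t)) / ENNReal.ofReal ((2 * t) ^ ((N : ℝ) - α * p) *
      logWeight ((p - 1) * (β - 1) / β) (2 * t)) ≤ ENNReal.ofReal M := by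
    refine le_trans ?_ (hx'.trans h)
    exact le_iSup₂ (f := fun (t : ℝ) (_ : 0 < t) => ω (ball x' t) /
      ENNReal.ofReal (t ^ ((N : ℝ) - α * p) * logWeight ((p - 1) * (β - 1) / β) t)) (2 * t) ht2
  rw [ENNReal.div_le_iff (by simpa using hpos) ENNReal.ofReal_ne_top] at h1
  refine (measure_mono (ball_subset_ball' ?_)).trans h1
  linarith

/-- Dyadic form of the bounds given by the maximal function, for measures carried by `B_R`. -/
theorem exists_measure_ball_le {N : ℕ} {α p β R : ℝ} (hp : 1 < p) (hβ : 1 ≤ β) (hR : 0 < R) :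
    ∃ c : ℝ, 0 < c ∧ ∀ M : ℝ, 0 < M → ∀ ω : Measure (Space N),
      maximalNorm α p β ω ≤ ENNReal.ofReal M → ω (ball (0 : Space N) R)ᶜ = 0 →
      ω univ ≤ ENNReal.ofReal (c * M) ∧ ∀ (x : Space N) (j : ℕ),
        ω (ball x (2 ^ (-(j + 1) : ℤ))) ≤ ENNReal.ofReal (c * M) *
          (2 ^ (((N : ℝ) - α * p) * ((-(j + 1) : ℤ) : ℝ)) *
            ENNReal.ofReal (((j : ℝ) + 1) ^ (-((p - 1) * (β - 1) / β)))) := by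
  set d : ℝ := N - α * p with hd
  set η : ℝ := (p - 1) * (β - 1) / β with hη
  have hη0 : 0 ≤ η := div_nonneg (mul_nonneg (by linarith) (by linarith)) (by linarith)
  have hlog2 : 0 < Real.log 2 := Real.log_pos one_lt_two
  set c₁ : ℝ := (2 * R) ^ d * logWeight η (2 * R) with hc₁
  set c₂ : ℝ := 2 ^ d * (Real.log 2 / 2) ^ (-η) with hc₂
  have hc₁0 : 0 < c₁ := mul_pos (by positivity) (logWeight_pos _ _ (by linarith))
  have hc₂0 : 0 < c₂ := by positivity
  refine ⟨c₁ + c₂, by positivity, fun M hM ω h hω => ⟨?_, fun x j => ?_⟩⟩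
  · calc ω univ ≤ ω (ball (0 : Space N) R) + ω (ball (0 : Space N) R)ᶜ := by
          rw [← union_compl_self (ball (0 : Space N) R)]; exact measure_union_le _ _
      _ = ω (ball (0 : Space N) R) := by rw [hω, add_zero]
      _ ≤ _ := measure_ball_le_of_maximalNorm h 0 hR
      _ ≤ _ := by
          rw [← ENNReal.ofReal_mul hM.le]
          refine ENNReal.ofReal_le_ofReal ?_
          rw [mul_comm]; gcongr; linarith
  · have h1 := measure_ball_le_of_maximalNorm h x (two_zpow_pos (-(j + 1)))
    refine h1.trans ?_
    rw [← ofReal_two_zpow_rpow, ← ENNReal.ofReal_mul hM.le,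
      ← ENNReal.ofReal_mul (p := ((2 : ℝ) ^ (-(j + 1) : ℤ)) ^ d) (by positivity),
      ← ENNReal.ofReal_mul (by positivity), ← hd, ← hη]
    refine ENNReal.ofReal_le_ofReal ?_
    have e2 : (2 : ℝ) * 2 ^ (-(j + 1) : ℤ) = 2 ^ (-j : ℤ) := by
      rw [show (-(j : ℤ)) = -(j + 1) + 1 by ring, zpow_add_one₀ two_ne_zero, mul_comm]
    have hw : logWeight η (2 ^ (-j : ℤ)) ≤ (Real.log 2 / 2) ^ (-η) * ((j : ℝ) + 1) ^ (-η) := by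
      rw [← Real.mul_rpow (by positivity) (by positivity)]
      have hneg : -η ≤ 0 := by linarith
      unfold logWeight
      split_ifs with hj
      · have hj1 : 1 ≤ j := by
          by_contra hj0
          have : j = 0 := by omega
          subst this
          norm_num at hj
        have hj1' : (1 : ℝ) ≤ j := by exact_mod_cast hj1
        refine Real.rpow_le_rpow_of_nonpos (by positivity) ?_ hneg
        rw [Real.log_zpow]
        push_cast
        nlinarith
      · have hj0 : j = 0 := by
          by_contra hj0
          apply hj
          calc (2 : ℝ) ^ (-j : ℤ) ≤ 2 ^ (-1 : ℤ) := zpow_le_zpow_right₀ one_le_two (by omega)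
            _ = 1 / 2 := by norm_num
        subst hj0
        refine Real.rpow_le_rpow_of_nonpos (by positivity) ?_ hneg
        push_cast
        linarith
    rw [Real.mul_rpow zero_le_two (by positivity), e2]
    calc M * (2 ^ d * (2 ^ (-(j + 1) : ℤ)) ^ d * logWeight η (2 ^ (-j : ℤ)))
        ≤ M * (2 ^ d * (2 ^ (-(j + 1) : ℤ)) ^ d *
          ((Real.log 2 / 2) ^ (-η) * ((j : ℝ) + 1) ^ (-η))) := by gcongr
      _ = c₂ * M * ((2 ^ (-(j + 1) : ℤ)) ^ d * ((j : ℝ) + 1) ^ (-η)) := by rw [hc₂]; ring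
      _ ≤ _ := by gcongr; linarith

theorem maximalNorm_augmented_le {N : ℕ} {α p β R M : ℝ} (hM : 0 ≤ M) {ν : Measure (Space N)}
    (h : maximalNorm α p β ν ≤ ENNReal.ofReal M) :
    maximalNorm α p β (augmented α p β R M ν) ≤ ENNReal.ofReal (2 * M) := by
  set χ : Measure (Space N) := volume.restrict (ball (0 : Space N) R) with hχ
  set A := ENNReal.ofReal M * (maximalNorm α p β χ)⁻¹ with hA
  have key : ∀ x, fracMaximal (α * p) ((p - 1) * (β - 1) / β) (augmented α p β R M ν) x ≤
      A * fracMaximal (α * p) ((p - 1) * (β - 1) / β) χ x +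
        fracMaximal (α * p) ((p - 1) * (β - 1) / β) ν x := by
    intro x
    refine iSup₂_le fun t ht => ?_
    have e : (augmented α p β R M ν) (ball x t) = A * χ (ball x t) + ν (ball x t) := by
      simp [augmented, hA, hχ]
    rw [e, ENNReal.add_div, mul_div_assoc]
    refine add_le_add (mul_le_mul_right ?_ _) ?_
    · exact le_iSup₂ (f := fun (t : ℝ) (_ : 0 < t) => χ (ball x t) /
        ENNReal.ofReal (t ^ ((N : ℝ) - α * p) * logWeight ((p - 1) * (β - 1) / β) t)) t ht
    · exact le_iSup₂ (f := fun (t : ℝ) (_ : 0 < t) => ν (ball x t) /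
        ENNReal.ofReal (t ^ ((N : ℝ) - α * p) * logWeight ((p - 1) * (β - 1) / β) t)) t ht
  rw [maximalNorm, eLpNorm_exponent_top]
  refine essSup_le_of_ae_le _ ?_
  filter_upwards [ae_fracMaximal_le α p β χ, ae_fracMaximal_le α p β ν] with x h1 h2
  rw [enorm_eq_self]
  calc _ ≤ _ := key x
    _ ≤ A * maximalNorm α p β χ + ENNReal.ofReal M := by gcongr; exact h2.trans h
    _ ≤ ENNReal.ofReal M + ENNReal.ofReal M := by
        gcongr
        rw [hA, mul_assoc]
        exact mul_le_of_le_one_right' (ENNReal.inv_mul_le_one _)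
    _ = _ := by rw [two_mul, ENNReal.ofReal_add hM hM]

theorem augmented_compl_ball {N : ℕ} {α p β R M : ℝ} {ν : Measure (Space N)}
    (h : ν (ball (0 : Space N) R)ᶜ = 0) :
    (augmented α p β R M ν) (ball (0 : Space N) R)ᶜ = 0 := by
  simp [augmented, h, Measure.restrict_apply measurableSet_ball.compl]

theorem le_augmented {N : ℕ} (α p β R M : ℝ) (ν : Measure (Space N)) :
    ν ≤ augmented α p β R M ν := Measure.le_add_left le_rfl

/-- If `ω` is carried by `B_R` and its maximal function is small, then the exponential of its Wolff
potential is integrable and, as a measure, has a Wolff potential bounded by that of `ω`. -/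
theorem exists_wolff_expTail_le {N : ℕ} {α p β R K : ℝ} {l : ℕ} (hα : 0 < α) (hp : 1 < p)
    (hl : 1 ≤ l) (hβ : 1 ≤ β) (hαp : α * p < N)
    (hlβ : (N : ℝ) * (p - 1) / ((N : ℝ) - α * p) < (l : ℝ) * β) (hR : 0 < R) (hK : 0 < K) :
    ∃ M : ℝ, 0 < M ∧ ∀ ω : Measure (Space N), maximalNorm α p β ω ≤ ENNReal.ofReal (2 * M) →
      ω (ball (0 : Space N) R)ᶜ = 0 →
      IsFiniteMeasure ω ∧
      ∫⁻ y, expTail l (ENNReal.ofReal K * wolff α p ω y ^ β) ≠ ∞ ∧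
      ∀ x, wolff α p (volume.withDensity
        fun y => expTail l (ENNReal.ofReal K * wolff α p ω y ^ β)) x ≤ wolff α p ω x := by
  set d : ℝ := N - α * p with hd
  set θ : ℝ := α * p with hθ
  set κ : ℝ := 1 / (p - 1) with hκ
  set η : ℝ := (p - 1) * (β - 1) / β with hη
  set L : ℝ := l * β * κ with hLdef
  have hp1 : 0 < p - 1 := sub_pos.2 hp
  have hd0 : 0 < d := sub_pos.2 hαp
  have hθ0 : 0 < θ := mul_pos hα (by linarith)
  have hκ0 : 0 < κ := one_div_pos.2 hp1
  have hβ0 : 0 < β := by linarith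
  have hN0 : N ≠ 0 := by
    rintro rfl
    rw [Nat.cast_zero] at hαp
    linarith
  have hηκ : η * κ = 1 - 1 / β := by rw [hη, hκ]; field_simp
  have hLd : (N : ℝ) < L * d := by
    rw [div_lt_iff₀ hd0] at hlβ
    have : L * d * (p - 1) = l * β * d := by rw [hLdef, hκ]; field_simp
    nlinarith
  have hL1 : 1 < L := by
    by_contra h
    push Not at h
    have : L * d ≤ 1 * d := by gcongr
    linarith
  set n : ℝ := (N + L * d) / 2 with hn
  have hnN : (N : ℝ) < n := by rw [hn]; linarith
  have hnL : n < L * d := by rw [hn]; linarith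
  have heN : d + θ / 2 < N := by rw [hd]; linarith
  set k : ℤ → ℝ≥0∞ := twoScaleKernel (d + θ / 2) n with hk
  have hkle : ∀ j, k j ≤ 2 ^ (-((N : ℝ) * j)) := twoScaleKernel_le heN.le hnN.le
  have hkmass : kernelMass N k ≠ ∞ := kernelMass_twoScaleKernel_ne_top heN hnN
  have hv : volume (ball (0 : Space N) 1) ≠ ∞ := measure_ball_lt_top.ne
  obtain ⟨C, hC, m₀, hm₀, hexp⟩ := exists_expTail_dyadic_le hd0 hθ0 hκ0 hβ hl hηκ hL1 hnL
    (b := K * (2 ^ (d * κ)) ^ β) (by positivity)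
  obtain ⟨c, hc, hball⟩ := exists_measure_ball_le (N := N) (α := α) hp hβ hR
  -- the constant of the estimate of the potential of the smoothing
  set A : ℝ≥0∞ := 2 ^ (d * κ) * ((volume (ball (0 : Space N) 1) * 2 ^ d *
    (kernelMass N k + 1)) ^ κ * hardyConst (2 ^ (-(N - d))) κ * 2 ^ (d * κ + 1)) with hA
  have hAtop : A ≠ ∞ := by
    have h1 : hardyConst (2 ^ (-(N - d))) κ ≠ ∞ :=
      hardyConst_ne_top (two_rpow_lt_one (by rw [hd]; linarith)) hκ0
    have h2 : (volume (ball (0 : Space N) 1) * 2 ^ d * (kernelMass N k + 1)) ^ κ ≠ ∞ :=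
      ENNReal.rpow_ne_top_of_nonneg hκ0.le (ENNReal.mul_ne_top (ENNReal.mul_ne_top hv
        (two_rpow_ne_top _)) (ENNReal.add_ne_top.2 ⟨hkmass, ENNReal.one_ne_top⟩))
    exact ENNReal.mul_ne_top (two_rpow_ne_top _)
      (ENNReal.mul_ne_top (ENNReal.mul_ne_top h2 h1) (two_rpow_ne_top _))
  obtain ⟨s₀, hs₀, hs₀A⟩ : ∃ s₀ : ℝ, 0 < s₀ ∧ A * ENNReal.ofReal s₀ ^ κ ≤ 1 := by
    refine ⟨((A.toReal + 1)⁻¹) ^ κ⁻¹, by positivity, ?_⟩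
    rw [ENNReal.ofReal_rpow_of_pos (by positivity), Real.rpow_inv_rpow (by positivity) hκ0.ne',
      ← ENNReal.ofReal_toReal hAtop, ← ENNReal.ofReal_mul ENNReal.toReal_nonneg]
    rw [ENNReal.ofReal_toReal hAtop, ENNReal.ofReal_le_one, ← div_eq_mul_inv,
      div_le_one (by positivity)]
    linarith
  set m : ℝ := min m₀ ((s₀ / C) ^ (L - 1)⁻¹) with hm
  have hm0 : 0 < m := lt_min hm₀ (by positivity)
  have hms : C * m ^ (L - 1) ≤ s₀ := by
    have hL1' : 0 < L - 1 := by linarith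
    calc C * m ^ (L - 1) ≤ C * ((s₀ / C) ^ (L - 1)⁻¹) ^ (L - 1) := by
          gcongr; exact min_le_right _ _
      _ = s₀ := by rw [Real.rpow_inv_rpow (by positivity) hL1'.ne']; field_simp
  refine ⟨m / (2 * c), by positivity, fun ω hω hωR => ?_⟩
  have hcm : c * (2 * (m / (2 * c))) = m := by field_simp
  obtain ⟨huniv, hsmall⟩ := hball _ (by positivity) ω hω hωR
  rw [hcm] at huniv hsmall
  have hfin : IsFiniteMeasure ω := ⟨huniv.trans_lt ENNReal.ofReal_lt_top⟩
  have hpt : ∀ y, expTail l (ENNReal.ofReal K * wolff α p ω y ^ β) ≤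
      ENNReal.ofReal s₀ * smoothing k ω y := by
    intro y
    have h1 := hexp m hm0 (min_le_left _ _) (fun j => ω (ball y (2 ^ j)))
      (fun j => (measure_mono (subset_univ _)).trans huniv) (fun j => hsmall y j)
    calc expTail l (ENNReal.ofReal K * wolff α p ω y ^ β)
        ≤ expTail l (ENNReal.ofReal (K * (2 ^ (d * κ)) ^ β) *
          (∑' j : ℤ, (ω (ball y (2 ^ j)) * 2 ^ (-(d * j))) ^ κ) ^ β) := by
          refine expTail_mono l ?_
          calc ENNReal.ofReal K * wolff α p ω y ^ β
              ≤ ENNReal.ofReal K * (2 ^ (d * κ) * dyadicPotential d κ ω y) ^ β := by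
                gcongr; exact wolff_le_dyadicPotential α hp hαp ω y
            _ = _ := by
                rw [ENNReal.mul_rpow_of_nonneg _ _ hβ0.le, ← mul_assoc, ENNReal.ofReal_mul hK.le,
                  ← ENNReal.ofReal_rpow_of_pos (by positivity),
                  ← ENNReal.ofReal_rpow_of_pos two_pos, ENNReal.ofReal_ofNat]
                rfl
      _ ≤ ENNReal.ofReal (C * m ^ (L - 1)) * smoothing k ω y := h1
      _ ≤ _ := by gcongr
  refine ⟨hfin, ?_, fun x => ?_⟩
  · refine ne_top_of_le_ne_top ?_ (lintegral_mono hpt)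
    rw [lintegral_const_mul _ (measurable_smoothing k ω), lintegral_smoothing hN0]
    exact ENNReal.mul_ne_top ENNReal.ofReal_ne_top (ENNReal.mul_ne_top hkmass
      (ENNReal.mul_ne_top hv (measure_ne_top ω univ)))
  · have hdens : ∀ i, dyadicDensity d (volume.withDensity
        fun y => expTail l (ENNReal.ofReal K * wolff α p ω y ^ β)) x i ≤
        ENNReal.ofReal s₀ * dyadicDensity d (volume.withDensity (smoothing k ω)) x i := by
      intro i
      unfold dyadicDensity
      rw [← mul_assoc]
      gcongr
      rw [withDensity_apply _ measurableSet_ball, withDensity_apply _ measurableSet_ball,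
        ← lintegral_const_mul _ (measurable_smoothing k ω)]
      exact lintegral_mono hpt
    calc wolff α p (volume.withDensity
          fun y => expTail l (ENNReal.ofReal K * wolff α p ω y ^ β)) x
        ≤ 2 ^ (d * κ) * dyadicPotential d κ (volume.withDensity
          fun y => expTail l (ENNReal.ofReal K * wolff α p ω y ^ β)) x :=
          wolff_le_dyadicPotential α hp hαp _ x
      _ ≤ 2 ^ (d * κ) * (ENNReal.ofReal s₀ ^ κ *
          dyadicPotential d κ (volume.withDensity (smoothing k ω)) x) := by
          refine mul_le_mul_right ?_ _
          unfold dyadicPotential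
          rw [← ENNReal.tsum_mul_left]
          refine ENNReal.tsum_le_tsum fun i => ?_
          rw [← ENNReal.mul_rpow_of_nonneg _ _ hκ0.le]
          exact ENNReal.rpow_le_rpow (hdens i) hκ0.le
      _ ≤ 2 ^ (d * κ) * (ENNReal.ofReal s₀ ^ κ *
          ((volume (ball (0 : Space N) 1) * 2 ^ d * (kernelMass N k + 1)) ^ κ *
          hardyConst (2 ^ (-(N - d))) κ * (2 ^ (d * κ + 1) * wolff α p ω x))) := by
          refine mul_le_mul_right (mul_le_mul_right ?_ _) _
          refine (dyadicPotential_smoothing_le hN0 d hκ0 hkle ω x).trans (mul_le_mul_right ?_ _)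
          exact dyadicPotential_le_wolff α hp hαp ω x
      _ = A * ENNReal.ofReal s₀ ^ κ * wolff α p ω x := by rw [hA]; ring
      _ ≤ wolff α p ω x := mul_le_of_le_one_left' hs₀A

/-! ### Existence by monotone iteration -/

/-- The iteration `u ↦ W[P(u) + μ] + f`, started from `0`. -/
noncomputable def iterate {N : ℕ} (α p : ℝ) (l : ℕ) (a β : ℝ) (f : Space N → ℝ≥0∞)
    (μ : Measure (Space N)) : ℕ → Space N → ℝ≥0∞
  | 0 => 0
  | n + 1 => fun x => wolff α p (reactionMeasure l a β (iterate α p l a β f μ n) + μ) x + f x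

theorem reactionMeasure_ball {N : ℕ} (l : ℕ) (a β : ℝ) (u : Space N → ℝ≥0∞) (x : Space N) (t : ℝ) :
    reactionMeasure l a β u (ball x t) = ∫⁻ y in ball x t, reaction l a β (u y) :=
  withDensity_apply _ measurableSet_ball

theorem iterate_le_succ {N : ℕ} {α p : ℝ} {l : ℕ} {a β : ℝ} (hp : 1 < p) (hl : 1 ≤ l) (ha : 0 < a)
    (hβ : 0 < β) (f : Space N → ℝ≥0∞) (μ : Measure (Space N)) (n : ℕ) :
    ∀ x, iterate α p l a β f μ n x ≤ iterate α p l a β f μ (n + 1) x := by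
  induction n with
  | zero => exact fun x => zero_le
  | succ n ih =>
    intro x
    refine add_le_add (wolff_mono_of_ball α hp fun t => ?_) le_rfl
    rw [Measure.add_apply, Measure.add_apply, reactionMeasure_ball, reactionMeasure_ball]
    gcongr with y
    exact reaction_mono hl ha hβ (ih y)

theorem iterate_mono {N : ℕ} {α p : ℝ} {l : ℕ} {a β : ℝ} (hp : 1 < p) (hl : 1 ≤ l) (ha : 0 < a)
    (hβ : 0 < β) (f : Space N → ℝ≥0∞) (μ : Measure (Space N)) (x : Space N) :
    Monotone fun n => iterate α p l a β f μ n x :=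
  monotone_nat_of_le_succ fun n => iterate_le_succ hp hl ha hβ f μ n x

theorem aemeasurable_iterate {N : ℕ} (α p : ℝ) (l : ℕ) (a β : ℝ) {f : Space N → ℝ≥0∞}
    (hf : AEMeasurable f volume) (μ : Measure (Space N)) [SFinite μ] (n : ℕ) :
    AEMeasurable (iterate α p l a β f μ n) volume := by
  cases n with
  | zero => exact aemeasurable_const
  | succ n =>
    have : SFinite (reactionMeasure l a β (iterate α p l a β f μ n)) := by
      unfold reactionMeasure; infer_instance
    exact (measurable_wolff α p _).aemeasurable.add hf

/-- The limit of the iteration solves the equation, at every point. -/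
theorem iSup_iterate_eq {N : ℕ} {α p : ℝ} {l : ℕ} {a β : ℝ} (hp : 1 < p) (hl : 1 ≤ l) (ha : 0 < a)
    (hβ : 0 < β) {f : Space N → ℝ≥0∞} (hf : AEMeasurable f volume) (μ : Measure (Space N))
    [SFinite μ] (x : Space N) :
    ⨆ n, iterate α p l a β f μ n x =
      wolff α p (reactionMeasure l a β (fun x => ⨆ n, iterate α p l a β f μ n x) + μ) x + f x := by
  have hmono : ∀ y, Monotone fun n => reaction l a β (iterate α p l a β f μ n y) := fun y m n h =>
    reaction_mono hl ha hβ (iterate_mono hp hl ha hβ f μ y h)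
  have hball : ∀ t, Monotone fun n =>
      (reactionMeasure l a β (iterate α p l a β f μ n)) (ball x t) := by
    intro t m n h
    simp only [reactionMeasure_ball]
    exact lintegral_mono fun y => hmono y h
  have h1 : wolff α p (reactionMeasure l a β (fun x => ⨆ n, iterate α p l a β f μ n x) + μ) x =
      ⨆ n, wolff α p (reactionMeasure l a β (iterate α p l a β f μ n) + μ) x := by
    refine wolff_iSup α hp (fun t m n h => ?_) fun t => ?_
    · simp only [Measure.add_apply]
      exact add_le_add (hball t h) le_rfl
    · simp only [Measure.add_apply]
      rw [← ENNReal.iSup_add, reactionMeasure_ball]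
      congr 1
      simp only [reactionMeasure_ball, reaction_iSup hl ha hβ (iterate_mono hp hl ha hβ f μ _)]
      rw [lintegral_iSup']
      · exact fun n => ((measurable_reaction hl ha hβ).comp_aemeasurable
          (aemeasurable_iterate α p l a β hf μ n)).restrict
      · exact Filter.Eventually.of_forall hmono
  rw [h1, ENNReal.iSup_add]
  refine le_antisymm (iSup_le fun n => ?_) (iSup_le fun n => ?_)
  · exact (iterate_le_succ hp hl ha hβ f μ n x).trans
      (le_iSup (fun n => wolff α p (reactionMeasure l a β (iterate α p l a β f μ n) + μ) x + f x) n)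
  · exact le_iSup (fun n => iterate α p l a β f μ n x) (n + 1)

/-- A function `F` whose reaction splits into the reaction of `f` and two densities with small
potentials bounds all the iterates. -/
theorem iterate_le {N : ℕ} {α p : ℝ} {l : ℕ} {a β ε : ℝ} (hp : 1 < p) (hl : 1 ≤ l) (ha : 0 < a)
    (hβ : 0 < β) {f : Space N → ℝ≥0∞} {μ ω₁ ω₂ : Measure (Space N)} {φ₁ φ₂ F : Space N → ℝ≥0∞}
    (hφ₁ : Measurable φ₁) (hφ₂ : Measurable φ₂)
    (hF : ∀ x, reaction l a β (F x) ≤ reaction l (a + ε) β (f x) + (φ₁ x + φ₂ x))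
    (hF' : ∀ x, F x = 2 * ENNReal.ofReal (cConst p) * wolff α p ω₁ x +
      2 * ENNReal.ofReal (cConst p) * wolff α p ω₂ x + f x)
    (h₁ : ∀ x, wolff α p (volume.withDensity φ₁) x ≤ wolff α p ω₁ x)
    (h₂ : ∀ x, wolff α p (volume.withDensity φ₂) x ≤ wolff α p ω₂ x)
    (hμ : μ ≤ ω₁) (hf : reactionMeasure l (a + ε) β f ≤ ω₂) (n : ℕ) :
    ∀ x, iterate α p l a β f μ n x ≤ F x := by
  induction n with
  | zero => exact fun x => zero_le
  | succ n ih =>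
    intro x
    rw [hF' x]
    refine add_le_add ?_ le_rfl
    calc wolff α p (reactionMeasure l a β (iterate α p l a β f μ n) + μ) x
        ≤ ENNReal.ofReal (cConst p) *
          (wolff α p μ x + wolff α p (reactionMeasure l (a + ε) β f) x +
            (wolff α p (volume.withDensity φ₁) x + wolff α p (volume.withDensity φ₂) x)) := by
          refine wolff_le_add_four α hp fun t => ?_
          rw [Measure.add_apply, reactionMeasure_ball, reactionMeasure_ball,
            withDensity_apply _ measurableSet_ball, withDensity_apply _ measurableSet_ball,
            add_comm, add_assoc]
          gcongr
          rw [← lintegral_add_left hφ₁, ← lintegral_add_right _ (by exact hφ₁.add hφ₂)]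
          exact lintegral_mono fun y => (reaction_mono hl ha hβ (ih y)).trans (hF y)
      _ ≤ ENNReal.ofReal (cConst p) *
          (wolff α p ω₁ x + wolff α p ω₂ x + (wolff α p ω₁ x + wolff α p ω₂ x)) := by
          gcongr
          exacts [wolff_mono α hp hμ x, wolff_mono α hp hf x, h₁ x, h₂ x]
      _ = _ := by ring

theorem exists_solution {N : ℕ} {α p a β ε R : ℝ} {l : ℕ} (hα : 0 < α) (hp : 1 < p) (ha : 0 < a)
    (hl : 1 ≤ l) (hβ : 1 ≤ β) (hαp : α * p < N)
    (hlβ : (N : ℝ) * (p - 1) / ((N : ℝ) - α * p) < (l : ℝ) * β) (hε : 0 < ε) (hR : 0 < R) :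
    ∃ M : ℝ, 0 < M ∧ ∀ (f : Space N → ℝ≥0∞) (μ : Measure (Space N)),
      AEMeasurable f volume → IsLocallyFiniteMeasure μ →
      (∀ᵐ x ∂(volume : Measure (Space N)), x ∉ ball (0 : Space N) R → f x = 0) →
      μ (ball (0 : Space N) R)ᶜ = 0 →
      (∀ K : Set (Space N), IsCompact K → ∫⁻ x in K, reaction l (a + ε) β (f x) ≠ ∞) →
      maximalNorm α p β μ ≤ ENNReal.ofReal M →
      maximalNorm α p β (reactionMeasure l (a + ε) β f) ≤ ENNReal.ofReal M →
      ∃ u : Space N → ℝ≥0∞, AEMeasurable u volume ∧ ∫⁻ x, reaction l a β (u x) ≠ ∞ ∧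
        (∀ x, u x = wolff α p (reactionMeasure l a β u + μ) x + f x) ∧
        (∀ x, u x ≤ upperBound α p l a β ε R M f μ x) ∧
        ∫⁻ x, reaction l a β (upperBound α p l a β ε R M f μ x) ≠ ∞ := by
  have hβ0 : 0 < β := by linarith
  have haε : 0 < a + ε := by linarith
  have hc0 : 0 < cConst p := lt_max_of_lt_left one_pos
  obtain ⟨K, hK, hsplit⟩ := exists_expTail_add_le l ha hε hβ0
  obtain ⟨M, hM, hsmall⟩ := exists_wolff_expTail_le (N := N) (K := K * (2 * cConst p) ^ β) hα hp hl
    hβ hαp hlβ hR (by positivity)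
  refine ⟨M, hM, fun f μ hf hμ hfR hμR hloc hμM hfM => ?_⟩
  set μ₁ := reactionMeasure l (a + ε) β f with hμ₁
  have hzero : ∀ᵐ x ∂(volume : Measure (Space N)),
      x ∈ (ball (0 : Space N) R)ᶜ → reaction l (a + ε) β (f x) = 0 := by
    filter_upwards [hfR] with x hx hxR
    rw [hx hxR, reaction_zero hl haε hβ0]
  have hcompl : ∫⁻ x in (ball (0 : Space N) R)ᶜ, reaction l (a + ε) β (f x) = 0 := by
    rw [setLIntegral_congr_fun_ae measurableSet_ball.compl hzero, lintegral_zero]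
  have hμ₁R : μ₁ (ball (0 : Space N) R)ᶜ = 0 := by
    rw [hμ₁, reactionMeasure, withDensity_apply _ measurableSet_ball.compl, hcompl]
  have hfint : ∫⁻ x, reaction l (a + ε) β (f x) ≠ ∞ := by
    rw [← lintegral_add_compl _ (measurableSet_ball (x := (0 : Space N)) (ε := R)), hcompl,
      add_zero]
    exact ne_top_of_le_ne_top (hloc _ (isCompact_closedBall (0 : Space N) R))
      (lintegral_mono_set ball_subset_closedBall)
  obtain ⟨hfin₁, hint₁, hW₁⟩ := hsmall (augmented α p β R M μ)
    (maximalNorm_augmented_le hM.le hμM) (augmented_compl_ball hμR)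
  obtain ⟨hfin₂, hint₂, hW₂⟩ := hsmall (augmented α p β R M μ₁)
    (maximalNorm_augmented_le hM.le hfM) (augmented_compl_ball hμ₁R)
  set F := upperBound α p l a β ε R M f μ with hFdef
  have hmeas : ∀ ω : Measure (Space N), IsFiniteMeasure ω → Measurable fun y =>
      expTail l (ENNReal.ofReal (K * (2 * cConst p) ^ β) * wolff α p ω y ^ β) := fun ω _ =>
    (measurable_expTail l).comp (((measurable_wolff α p ω).pow_const β).const_mul _)
  have hscale : ∀ w : ℝ≥0∞, ENNReal.ofReal K * (2 * ENNReal.ofReal (cConst p) * w) ^ β =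
      ENNReal.ofReal (K * (2 * cConst p) ^ β) * w ^ β := by
    intro w
    rw [ENNReal.mul_rpow_of_nonneg _ _ hβ0.le, ENNReal.ofReal_mul hK.le,
      ← ENNReal.ofReal_rpow_of_pos (by positivity), ENNReal.ofReal_mul zero_le_two, mul_assoc]
    simp
  have hFsplit : ∀ x, reaction l a β (F x) ≤ reaction l (a + ε) β (f x) +
      (expTail l (ENNReal.ofReal (K * (2 * cConst p) ^ β) *
          wolff α p (augmented α p β R M μ) x ^ β) +
        expTail l (ENNReal.ofReal (K * (2 * cConst p) ^ β) *
          wolff α p (augmented α p β R M μ₁) x ^ β)) := by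
    intro x
    rw [reaction_eq_expTail hl ha hβ0, reaction_eq_expTail hl haε hβ0, ← hscale, ← hscale]
    exact hsplit _ _ _
  have hFint : ∫⁻ x, reaction l a β (F x) ≠ ∞ := by
    refine ne_top_of_le_ne_top ?_ (lintegral_mono hFsplit)
    rw [lintegral_add_right _ (by exact (hmeas _ hfin₁).add (hmeas _ hfin₂)),
      lintegral_add_left (hmeas _ hfin₁)]
    exact ENNReal.add_ne_top.2 ⟨hfint, ENNReal.add_ne_top.2 ⟨hint₁, hint₂⟩⟩
  have hle : ∀ x, ⨆ n, iterate α p l a β f μ n x ≤ F x := fun x => iSup_le fun n =>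
    iterate_le hp hl ha hβ0 (hmeas _ hfin₁) (hmeas _ hfin₂) hFsplit (fun _ => rfl) hW₁ hW₂
      (le_augmented α p β R M μ) (le_augmented α p β R M μ₁) n x
  exact ⟨fun x => ⨆ n, iterate α p l a β f μ n x,
    AEMeasurable.iSup fun n => aemeasurable_iterate α p l a β hf μ n,
    ne_top_of_le_ne_top hFint (lintegral_mono fun x => reaction_mono hl ha hβ0 (hle x)),
    iSup_iterate_eq hp hl ha hβ0 hf μ, hle, hFint⟩

/-! ### Riesz potentials and the dyadic Wolff inequality -/

/-- The Riesz potential of a measure. -/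
noncomputable def rieszPotential {N : ℕ} (γ : ℝ) (ν : Measure (Space N)) (y : Space N) : ℝ≥0∞ :=
  ∫⁻ x, rieszKernel γ (x - y) ∂ν

theorem measurable_rieszKernel {N : ℕ} (γ : ℝ) :
    Measurable (rieszKernel γ : Space N → ℝ≥0∞) := by
  unfold rieszKernel
  exact (measurable_enorm.pow_const _).const_mul _

theorem measurable_rieszPotential {N : ℕ} (γ : ℝ) (ν : Measure (Space N)) [SFinite ν] :
    Measurable (rieszPotential γ ν) := by
  unfold rieszPotential
  refine Measurable.lintegral_prod_right'
    (f := fun q : Space N × Space N => rieszKernel γ (q.2 - q.1)) ?_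
  exact (measurable_rieszKernel γ).comp (measurable_snd.sub measurable_fst)

theorem rieszKernel_sub_le {N : ℕ} {γ : ℝ} (hγ : γ < N) (x y : Space N) :
    rieszKernel γ (x - y) ≤ (ENNReal.ofReal (N - γ))⁻¹ * 2 ^ ((N : ℝ) - γ) *
      ∑' j : ℤ, 2 ^ (-(((N : ℝ) - γ) * j)) * (ball y ((2 : ℝ) ^ j)).indicator 1 x := by
  set d : ℝ := N - γ with hd
  have hd0 : 0 < d := sub_pos.2 hγ
  unfold rieszKernel
  rw [mul_assoc]
  refine mul_le_mul_right ?_ _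
  rcases eq_or_ne x y with rfl | hxy
  · have htop : ∑' j : ℤ, 2 ^ (-(d * j)) * (ball x ((2 : ℝ) ^ j)).indicator 1 x = (∞ : ℝ≥0∞) := by
      rw [tsum_int_eq_add]
      refine ENNReal.add_eq_top.2 (Or.inr (top_unique ?_))
      rw [← ENNReal.tsum_const_eq_top_of_ne_zero (α := ℕ) (one_ne_zero (α := ℝ≥0∞))]
      refine ENNReal.tsum_le_tsum fun n => ?_
      rw [indicator_of_mem (mem_ball_self (two_zpow_pos _)), Pi.one_apply, mul_one]
      refine ENNReal.one_le_rpow ENNReal.one_lt_two.le ?_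
      push_cast
      nlinarith [(Nat.cast_nonneg n : (0 : ℝ) ≤ n)]
    rw [htop, ENNReal.mul_top (two_rpow_ne_zero d)]
    exact le_top
  · have hpos : 0 < ‖x - y‖ := norm_pos_iff.2 (sub_ne_zero.2 hxy)
    obtain ⟨j, hj1, hj2⟩ := exists_mem_Ico_zpow hpos (one_lt_two (α := ℝ))
    refine le_trans ?_ (mul_le_mul_right (ENNReal.le_tsum (j + 1)) _)
    rw [indicator_of_mem (by rwa [mem_ball, dist_eq_norm]), Pi.one_apply, mul_one,
      ← two_rpow_add]
    have e : d + -(d * ((j + 1 : ℤ) : ℝ)) = j * -d := by push_cast; ring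
    rw [e, ENNReal.rpow_mul, ← ofReal_two_zpow, ENNReal.rpow_neg, ENNReal.rpow_neg,
      ENNReal.inv_le_inv]
    refine ENNReal.rpow_le_rpow ?_ hd0.le
    rw [← ofReal_norm]
    exact ENNReal.ofReal_le_ofReal hj1

theorem rieszPotential_le {N : ℕ} {γ : ℝ} (hγ : γ < N) (ν : Measure (Space N)) (y : Space N) :
    rieszPotential γ ν y ≤ (ENNReal.ofReal (N - γ))⁻¹ * 2 ^ ((N : ℝ) - γ) *
      ∑' j : ℤ, dyadicDensity (N - γ) ν y j := by
  unfold rieszPotential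
  refine (lintegral_mono fun x => rieszKernel_sub_le hγ x y).trans_eq ?_
  have hm : ∀ j : ℤ, Measurable fun x : Space N =>
      (ball y ((2 : ℝ) ^ j)).indicator (1 : Space N → ℝ≥0∞) x := fun j =>
    measurable_one.indicator measurableSet_ball
  rw [lintegral_const_mul _ (Measurable.tsum fun j => (hm j).const_mul _),
    lintegral_tsum fun j => ((hm j).const_mul _).aemeasurable]
  congr 1
  refine tsum_congr fun j => ?_
  rw [lintegral_const_mul _ (hm j), lintegral_indicator_one measurableSet_ball, mul_comm]
  rfl

/-- The tail `∑_{k ≥ 0} A_{j+k}(x)` of the dyadic densities at scales at least `2^j`. -/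
noncomputable def dyadicTail {N : ℕ} (d : ℝ) (ν : Measure (Space N)) (x : Space N) (j : ℤ) :
    ℝ≥0∞ :=
  ∑' k : ℕ, dyadicDensity d ν x (j + k)

theorem measurable_dyadicTail {N : ℕ} (d : ℝ) (ν : Measure (Space N)) [SFinite ν] (j : ℤ) :
    Measurable fun x => dyadicTail d ν x j :=
  Measurable.tsum fun _ => measurable_dyadicDensity d ν _

theorem dyadicDensity_le_of_dist_lt {N : ℕ} (d : ℝ) (ν : Measure (Space N)) {x z : Space N}
    {i j : ℤ} (hij : i ≤ j) (h : dist x z < (2 : ℝ) ^ i) :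
    dyadicDensity d ν x j ≤ 2 ^ d * dyadicDensity d ν z (j + 1) := by
  rw [← dyadicDensity_add_one]
  unfold dyadicDensity
  gcongr
  refine ball_subset_ball' ?_
  have : (2 : ℝ) ^ i ≤ 2 ^ j := zpow_le_zpow_right₀ one_le_two hij
  rw [zpow_add_one₀ two_ne_zero]
  linarith

theorem dyadicTail_le_of_dist_lt {N : ℕ} (d : ℝ) (ν : Measure (Space N)) {x z : Space N}
    {j : ℤ} (h : dist x z < (2 : ℝ) ^ j) :
    dyadicTail d ν x j ≤ 2 ^ d * dyadicTail d ν z (j + 1) := by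
  unfold dyadicTail
  rw [← ENNReal.tsum_mul_left]
  refine ENNReal.tsum_le_tsum fun k => ?_
  have := dyadicDensity_le_of_dist_lt d ν (j := j + k) (by omega) h
  rwa [add_right_comm] at this

/-- The tails vary slowly, so that an integral over `x` can be turned into one against `ν`. -/
theorem lintegral_density_mul_tail_le {N : ℕ} (hN : N ≠ 0) (d : ℝ) {σ : ℝ} (hσ : 0 ≤ σ)
    (ν : Measure (Space N)) [SFinite ν] (j : ℤ) :
    ∫⁻ x, dyadicDensity d ν x j * dyadicTail d ν x j ^ σ ≤
      volume (ball (0 : Space N) 1) * 2 ^ (d * σ) *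
        ∫⁻ z, 2 ^ ((N - d) * j) * dyadicTail d ν z (j + 1) ^ σ ∂ν := by
  have hmt : Measurable fun z => dyadicTail d ν z (j + 1) ^ σ :=
    (measurable_dyadicTail d ν (j + 1)).pow_const σ
  calc ∫⁻ x, dyadicDensity d ν x j * dyadicTail d ν x j ^ σ
      ≤ ∫⁻ x, 2 ^ (-(d * j)) * ∫⁻ z in ball x (2 ^ j),
          2 ^ (d * σ) * dyadicTail d ν z (j + 1) ^ σ ∂ν := by
        refine lintegral_mono fun x => ?_
        unfold dyadicDensity
        rw [mul_comm (ν _), mul_assoc]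
        refine mul_le_mul_right ?_ _
        rw [mul_comm, ← setLIntegral_const]
        refine setLIntegral_mono' measurableSet_ball fun z hz => ?_
        rw [ENNReal.rpow_mul, ← ENNReal.mul_rpow_of_nonneg _ _ hσ]
        gcongr
        exact dyadicTail_le_of_dist_lt d ν (by rw [dist_comm]; exact mem_ball.1 hz)
    _ = 2 ^ (-(d * j)) * ∫⁻ z, (∫⁻ _ in ball z (2 ^ j),
          2 ^ (d * σ) * dyadicTail d ν z (j + 1) ^ σ) ∂ν := by
        rw [lintegral_const_mul' _ _ (two_rpow_ne_top _)]
        rw [lintegral_ball_swap volume ν _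
          (F := fun _ z => 2 ^ (d * σ) * dyadicTail d ν z (j + 1) ^ σ)
          (by exact (hmt.const_mul _).comp measurable_snd)]
    _ = _ := by
        rw [← lintegral_const_mul' _ _ (two_rpow_ne_top _), ← lintegral_const_mul']
        · refine lintegral_congr fun z => ?_
          rw [setLIntegral_const, volume_ball_two_zpow hN]
          have e : ((N : ℝ) - d) * j = N * j + -(d * j) := by ring
          rw [e, two_rpow_add]
          ring
        · exact ENNReal.mul_ne_top measure_ball_lt_top.ne (two_rpow_ne_top _)

theorem lintegral_rpow_density_le {N : ℕ} (hN : N ≠ 0) (d : ℝ) {σ : ℝ} (hσ : 0 ≤ σ)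
    (ν : Measure (Space N)) [SFinite ν] (j : ℤ) :
    volume (ball (0 : Space N) 1) * ∫⁻ z, 2 ^ ((N - d) * j) * dyadicDensity d ν z j ^ σ ∂ν ≤
      2 ^ (d * (σ + 1)) * ∫⁻ x, dyadicDensity d ν x (j + 1) ^ (σ + 1) := by
  have hmt : Measurable fun z => dyadicDensity d ν z j ^ σ :=
    (measurable_dyadicDensity d ν j).pow_const σ
  calc volume (ball (0 : Space N) 1) *
        ∫⁻ z, 2 ^ ((N - d) * j) * dyadicDensity d ν z j ^ σ ∂ν
      = 2 ^ (-(d * j)) * ∫⁻ z, (∫⁻ _ in ball z (2 ^ j), dyadicDensity d ν z j ^ σ) ∂ν := by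
        rw [← lintegral_const_mul' _ _ (two_rpow_ne_top _),
          ← lintegral_const_mul' _ _ measure_ball_lt_top.ne]
        refine lintegral_congr fun z => ?_
        rw [setLIntegral_const, volume_ball_two_zpow hN]
        have e : ((N : ℝ) - d) * j = N * j + -(d * j) := by ring
        rw [e, two_rpow_add]
        ring
    _ = 2 ^ (-(d * j)) * ∫⁻ x, ∫⁻ z in ball x (2 ^ j), dyadicDensity d ν z j ^ σ ∂ν := by
        rw [lintegral_ball_swap volume ν _ (F := fun _ z => dyadicDensity d ν z j ^ σ)
          (hmt.comp measurable_snd)]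
    _ ≤ 2 ^ (-(d * j)) * ∫⁻ x, (2 ^ d * dyadicDensity d ν x (j + 1)) ^ σ *
          ν (ball x (2 ^ j)) := by
        refine mul_le_mul_right (lintegral_mono fun x => ?_) _
        rw [← setLIntegral_const]
        refine setLIntegral_mono' measurableSet_ball fun z hz => ?_
        gcongr
        exact dyadicDensity_le_of_dist_lt d ν le_rfl (mem_ball.1 hz)
    _ ≤ ∫⁻ x, 2 ^ (d * (σ + 1)) * dyadicDensity d ν x (j + 1) ^ (σ + 1) := by
        rw [← lintegral_const_mul' _ _ (two_rpow_ne_top _)]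
        refine lintegral_mono fun x => ?_
        have h1 : dyadicDensity d ν x j ≤ 2 ^ d * dyadicDensity d ν x (j + 1) :=
          dyadicDensity_le_of_dist_lt d ν le_rfl (by simpa using two_zpow_pos j)
        calc 2 ^ (-(d * j)) * ((2 ^ d * dyadicDensity d ν x (j + 1)) ^ σ * ν (ball x (2 ^ j)))
            = (2 ^ d * dyadicDensity d ν x (j + 1)) ^ σ * dyadicDensity d ν x j := by
              unfold dyadicDensity; ring
          _ ≤ (2 ^ d * dyadicDensity d ν x (j + 1)) ^ σ *
              (2 ^ d * dyadicDensity d ν x (j + 1)) ^ (1 : ℝ) := by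
              rw [ENNReal.rpow_one]; gcongr
          _ = _ := by
              rw [← ENNReal.rpow_add_of_nonneg _ _ hσ zero_le_one,
                ENNReal.mul_rpow_of_nonneg _ _ (by linarith), ← ENNReal.rpow_mul]
    _ = _ := lintegral_const_mul' _ _ (two_rpow_ne_top _)

theorem tsum_rpow_tail_le {N : ℕ} (d : ℝ) {θ σ : ℝ} (hσ : 0 < σ)
    (ν : Measure (Space N)) (z : Space N) :
    ∑' j : ℤ, 2 ^ (θ * j) * dyadicTail d ν z j ^ σ ≤
      hardyConst (2 ^ (-(θ / σ))) σ * ∑' j : ℤ, 2 ^ (θ * j) * dyadicDensity d ν z j ^ σ := by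
  have h := tsum_hardy_le (2 ^ (-(θ / σ))) (fun j => 2 ^ (θ / σ * j) * dyadicDensity d ν z j) hσ
  convert h using 3 with j
  · unfold dyadicTail
    have e : θ * j = θ / σ * j * σ := by field_simp
    rw [e, ENNReal.rpow_mul, ← ENNReal.mul_rpow_of_nonneg _ _ hσ.le, ← ENNReal.tsum_mul_left]
    congr 1
    refine tsum_congr fun k => ?_
    rw [two_rpow_mul_nat, ← mul_assoc, ← two_rpow_add]
    congr 2
    push_cast; ring
  · funext j
    rw [ENNReal.mul_rpow_of_nonneg _ _ hσ.le, ← ENNReal.rpow_mul]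
    congr 2
    field_simp

/-- Wolff's inequality in dyadic form. -/
theorem lintegral_rpow_tsum_density_le {N : ℕ} (hN : N ≠ 0) {d s : ℝ} (hd : d < N) (hs : 1 < s)
    (ν : Measure (Space N)) [SFinite ν] :
    ∫⁻ x, (∑' j : ℤ, dyadicDensity d ν x j) ^ s ≤
      ENNReal.ofReal s * 2 ^ (d * (s - 1)) * 2 ^ (d * s) *
        hardyConst (2 ^ (-((N - d) / (s - 1)))) (s - 1) *
        ∫⁻ x, ∑' j : ℤ, dyadicDensity d ν x j ^ s := by
  set σ : ℝ := s - 1 with hσdef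
  have hσ : 0 < σ := sub_pos.2 hs
  have hsσ : s = σ + 1 := by rw [hσdef]; ring
  set θ : ℝ := N - d with hθ
  set v := volume (ball (0 : Space N) 1) with hv
  set H := hardyConst (2 ^ (-(θ / σ))) σ with hH
  have hHtop : H ≠ ∞ := hardyConst_ne_top (two_rpow_lt_one
    (neg_lt_zero.2 (div_pos (sub_pos.2 hd) hσ))) hσ
  have hvtop : v ≠ ∞ := measure_ball_lt_top.ne
  have hmA : ∀ j, Measurable fun x => dyadicDensity d ν x j := measurable_dyadicDensity d ν
  have hmT : ∀ j, Measurable fun x => dyadicTail d ν x j := measurable_dyadicTail d ν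
  calc ∫⁻ x, (∑' j : ℤ, dyadicDensity d ν x j) ^ s
      ≤ ∫⁻ x, ENNReal.ofReal s * ∑' j : ℤ, dyadicDensity d ν x j * dyadicTail d ν x j ^ σ :=
        lintegral_mono fun x => rpow_tsum_le_tsum_mul_tail _ hs.le
    _ = ENNReal.ofReal s *
        ∑' j : ℤ, ∫⁻ x, dyadicDensity d ν x j * dyadicTail d ν x j ^ σ := by
        rw [lintegral_const_mul' _ _ ENNReal.ofReal_ne_top,
          lintegral_tsum fun j => by
            exact ((hmA j).mul ((hmT j).pow_const σ)).aemeasurable]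
    _ ≤ ENNReal.ofReal s * ∑' j : ℤ, v * 2 ^ (d * σ) *
        ∫⁻ z, 2 ^ (θ * j) * dyadicTail d ν z (j + 1) ^ σ ∂ν := by
        gcongr with j
        exact lintegral_density_mul_tail_le hN d hσ.le ν j
    _ = ENNReal.ofReal s * 2 ^ (d * σ) * (v * ∫⁻ z, ∑' j : ℤ,
        2 ^ (θ * j) * dyadicTail d ν z (j + 1) ^ σ ∂ν) := by
        rw [ENNReal.tsum_mul_left,
          lintegral_tsum fun j => (((hmT (j + 1)).pow_const σ).const_mul _).aemeasurable]
        ring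
    _ ≤ ENNReal.ofReal s * 2 ^ (d * σ) * (v * ∫⁻ z, H * ∑' j : ℤ,
        2 ^ (θ * j) * dyadicDensity d ν z j ^ σ ∂ν) := by
        gcongr with z
        refine le_trans ?_ (tsum_rpow_tail_le d hσ ν z)
        rw [← tsum_int_add (fun j => 2 ^ (θ * j) * dyadicTail d ν z j ^ σ) 1]
        refine ENNReal.tsum_le_tsum fun j => ?_
        gcongr ?_ * _
        refine two_rpow_mono ?_
        have : 0 < θ := sub_pos.2 hd
        push_cast
        nlinarith
    _ = ENNReal.ofReal s * 2 ^ (d * σ) * (H * ∑' j : ℤ, v * ∫⁻ z,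
        2 ^ (θ * j) * dyadicDensity d ν z j ^ σ ∂ν) := by
        rw [lintegral_const_mul' _ _ hHtop,
          lintegral_tsum fun j => (((hmA j).pow_const σ).const_mul _).aemeasurable,
          ENNReal.tsum_mul_left]
        ring
    _ ≤ ENNReal.ofReal s * 2 ^ (d * σ) * (H * ∑' j : ℤ,
        2 ^ (d * s) * ∫⁻ x, dyadicDensity d ν x (j + 1) ^ s) := by
        rw [hsσ]
        exact mul_le_mul_right (mul_le_mul_right (ENNReal.tsum_le_tsum fun j =>
          lintegral_rpow_density_le hN d hσ.le ν j) _) _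
    _ = _ := by
        rw [ENNReal.tsum_mul_left, tsum_int_add (fun j => ∫⁻ x, dyadicDensity d ν x j ^ s) 1,
          lintegral_tsum fun j => ((hmA j).pow_const s).aemeasurable]
        ring

theorem inv_one_sub_two_rpow_le {x : ℝ} (hx : 0 < x) :
    (1 - (2 : ℝ≥0∞) ^ (-x))⁻¹ ≤ ENNReal.ofReal (1 + (x * Real.log 2)⁻¹) := by
  have hlog2 : 0 < Real.log 2 := Real.log_pos one_lt_two
  set y : ℝ := x * Real.log 2 with hy
  have hy0 : 0 < y := by positivity
  have h1 : (2 : ℝ≥0∞) ^ (-x) = ENNReal.ofReal (Real.exp (-y)) := by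
    have : (2 : ℝ≥0∞) = ENNReal.ofReal 2 := by simp
    rw [this, ENNReal.ofReal_rpow_of_pos two_pos, Real.rpow_def_of_pos two_pos]
    congr 2; rw [hy]; ring
  have h2 : Real.exp (-y) ≤ (1 + y)⁻¹ := by
    rw [Real.exp_neg]
    gcongr
    linarith [Real.add_one_le_exp y]
  have h3 : (1 + y⁻¹)⁻¹ ≤ 1 - Real.exp (-y) := by
    have : (1 + y⁻¹)⁻¹ = 1 - (1 + y)⁻¹ := by field_simp; ring
    linarith
  rw [h1, ← ENNReal.ofReal_one, ← ENNReal.ofReal_sub _ (Real.exp_pos _).le,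
    ← inv_inv (1 + y⁻¹), ENNReal.ofReal_inv_of_pos (by positivity), ENNReal.inv_le_inv]
  exact ENNReal.ofReal_le_ofReal h3

/-- Wolff's inequality with the growth `(C s)^s` of the constant, which is what makes the
exponential integrability of Riesz potentials accessible term by term. -/
theorem exists_lintegral_rpow_tsum_density_le {N : ℕ} (hN : N ≠ 0) {d : ℝ} (hd0 : 0 < d)
    (hd : d < N) :
    ∃ C : ℝ, 0 < C ∧ ∀ s : ℝ, 1 < s → ∀ (ν : Measure (Space N)) [SFinite ν],
      ∫⁻ x, (∑' j : ℤ, dyadicDensity d ν x j) ^ s ≤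
        ENNReal.ofReal ((C * s) ^ s) * ∫⁻ x, ∑' j : ℤ, dyadicDensity d ν x j ^ s := by
  have hlog2 : 0 < Real.log 2 := Real.log_pos one_lt_two
  set θ : ℝ := N - d with hθ
  have hθ0 : 0 < θ := sub_pos.2 hd
  set C₁ : ℝ := 1 + (θ * Real.log 2)⁻¹ with hC₁
  have hC₁1 : 1 ≤ C₁ := by
    have : 0 < (θ * Real.log 2)⁻¹ := by positivity
    linarith
  refine ⟨Real.exp 1 * 2 ^ d * 2 ^ d * C₁, by positivity, fun s hs ν _ => ?_⟩
  refine (lintegral_rpow_tsum_density_le hN hd hs ν).trans (mul_le_mul_left ?_ _)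
  have hs0 : 0 < s := by linarith
  have hσ : 0 < s - 1 := sub_pos.2 hs
  have hH : hardyConst (2 ^ (-(θ / (s - 1)))) (s - 1) ≤ ENNReal.ofReal ((C₁ * s) ^ s) := by
    unfold hardyConst
    split_ifs with h1
    · calc ((1 - (2 : ℝ≥0∞) ^ (-(θ / (s - 1))))⁻¹) ^ (s - 1)
          ≤ ENNReal.ofReal (1 + (θ / (s - 1) * Real.log 2)⁻¹) ^ (s - 1) := by
            gcongr; exact inv_one_sub_two_rpow_le (by positivity)
        _ ≤ ENNReal.ofReal (C₁ * s) ^ (s - 1) := by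
            gcongr
            have e : (θ / (s - 1) * Real.log 2)⁻¹ = (θ * Real.log 2)⁻¹ * (s - 1) := by
              field_simp
            have : 0 < (θ * Real.log 2)⁻¹ := by positivity
            rw [e, hC₁]
            nlinarith
        _ ≤ _ := by
            rw [ENNReal.ofReal_rpow_of_pos (by positivity)]
            refine ENNReal.ofReal_le_ofReal (Real.rpow_le_rpow_of_exponent_le ?_ (by linarith))
            nlinarith
    · have e : ((2 : ℝ≥0∞) ^ (-(θ / (s - 1)))) ^ (s - 1) = 2 ^ (-θ) := by
        rw [← ENNReal.rpow_mul]
        congr 1; field_simp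
      rw [e]
      refine (inv_one_sub_two_rpow_le hθ0).trans (ENNReal.ofReal_le_ofReal ?_)
      rw [← hC₁]
      calc C₁ ≤ C₁ * s := by nlinarith
        _ = (C₁ * s) ^ (1 : ℝ) := (Real.rpow_one _).symm
        _ ≤ _ := Real.rpow_le_rpow_of_exponent_le (by nlinarith) hs.le
  calc ENNReal.ofReal s * 2 ^ (d * (s - 1)) * 2 ^ (d * s) *
        hardyConst (2 ^ (-(θ / (s - 1)))) (s - 1)
      ≤ ENNReal.ofReal (Real.exp 1 ^ s) * 2 ^ (d * s) * 2 ^ (d * s) *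
        ENNReal.ofReal ((C₁ * s) ^ s) := by
        refine mul_le_mul' (mul_le_mul' (mul_le_mul' ?_ ?_) le_rfl) hH
        · refine ENNReal.ofReal_le_ofReal ?_
          rw [Real.exp_one_rpow]
          linarith [Real.add_one_le_exp s]
        · exact two_rpow_mono (by nlinarith)
    _ = _ := by
        have e : (2 : ℝ≥0∞) ^ (d * s) = ENNReal.ofReal (((2 : ℝ) ^ d) ^ s) := by
          rw [← ENNReal.ofReal_rpow_of_pos (by positivity), ← ENNReal.ofReal_rpow_of_pos two_pos,
            ENNReal.ofReal_ofNat, ENNReal.rpow_mul]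
        rw [e, ← ENNReal.ofReal_mul (by positivity), ← ENNReal.ofReal_mul (by positivity),
          ← ENNReal.ofReal_mul (by positivity)]
        congr 1
        rw [← Real.mul_rpow (by positivity) (by positivity),
          ← Real.mul_rpow (by positivity) (by positivity),
          ← Real.mul_rpow (by positivity) (by positivity), ← mul_assoc]

/-! ### The Young function of a Riesz potential -/

/-- The normalization `q^(βq/(p-1))` (`1` if `p = 2`) of the terms of the Young function `Q_p`. -/
noncomputable def youngCoeff (p β : ℝ) (q : ℕ) : ℝ :=
  if p = 2 then 1 else (q : ℝ) ^ (β * q / (p - 1))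

/-- The Young function `Q_p` as a power series on `[0,∞]`. -/
noncomputable def youngSeries (p : ℝ) (l : ℕ) (β : ℝ) (s : ℝ≥0∞) : ℝ≥0∞ :=
  ∑' k : ℕ, s ^ (β * ((k + l : ℕ) : ℝ) / (p - 1)) /
    (ENNReal.ofReal (youngCoeff p β (k + l)) * ((k + l).factorial : ℝ≥0∞))

theorem youngCoeff_pos (p β : ℝ) {q : ℕ} (hq : q ≠ 0) : 0 < youngCoeff p β q := by
  unfold youngCoeff
  split_ifs
  · exact one_pos
  · have : (0 : ℝ) < q := by exact_mod_cast Nat.pos_of_ne_zero hq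
    positivity

theorem measurable_youngSeries (p : ℝ) (l : ℕ) (β : ℝ) : Measurable (youngSeries p l β) :=
  Measurable.tsum fun _ => (measurable_id.pow_const _).div_const _

theorem youngSeries_top {p β : ℝ} {l : ℕ} (hp : 1 < p) (hβ : 0 < β) (hl : 1 ≤ l) :
    youngSeries p l β ∞ = ∞ := by
  have hl0 : (0 : ℝ) < l := by exact_mod_cast hl
  have hp1 : 0 < p - 1 := sub_pos.2 hp
  refine top_unique (le_trans ?_ (ENNReal.le_tsum 0))
  rw [zero_add, ENNReal.top_rpow_of_pos (by positivity), ENNReal.top_div_of_ne_top]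
  exact ENNReal.mul_ne_top ENNReal.ofReal_ne_top (ENNReal.natCast_ne_top _)

theorem ofReal_youngQ_le {p β : ℝ} {l : ℕ} (hp : 1 < p) (hβ : 0 < β) (hl : 1 ≤ l) (s : ℝ≥0) :
    ENNReal.ofReal (youngQ p l β s) ≤ youngSeries p l β s := by
  have hp1 : 0 < p - 1 := sub_pos.2 hp
  unfold youngQ youngSeries
  split_ifs with h
  · rw [← expTail_ofReal l (by positivity), expTail]
    refine ENNReal.tsum_le_tsum fun k => ?_
    rw [youngCoeff, if_pos h, ENNReal.ofReal_one, one_mul,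
      ← ENNReal.ofReal_rpow_of_nonneg s.coe_nonneg hβ.le, ENNReal.ofReal_coe_nnreal,
      ← ENNReal.rpow_natCast, ← ENNReal.rpow_mul, h]
    norm_num
  · by_cases hs : Summable fun k : ℕ => (s : ℝ) ^ (β * ((k + l : ℕ) : ℝ) / (p - 1)) /
        (((k + l : ℕ) : ℝ) ^ (β * ((k + l : ℕ) : ℝ) / (p - 1)) * ((k + l).factorial : ℝ))
    · rw [ENNReal.ofReal_tsum_of_nonneg (fun k => by positivity) hs]
      refine ENNReal.tsum_le_tsum fun k => ?_
      have hk : (0 : ℝ) < ((k + l : ℕ) : ℝ) := by exact_mod_cast (by omega : 0 < k + l)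
      rw [ENNReal.ofReal_div_of_pos (by positivity), youngCoeff, if_neg h,
        ENNReal.ofReal_mul (by positivity), ENNReal.ofReal_natCast,
        ← ENNReal.ofReal_rpow_of_nonneg s.coe_nonneg (by positivity), ENNReal.ofReal_coe_nnreal]
    · rw [tsum_eq_zero_of_not_summable hs, ENNReal.ofReal_zero]
      exact zero_le

/-- Young's inequality. -/
theorem mul_le_youngQStar_add {p β : ℝ} {l : ℕ} (hp : 1 < p) (hβ : 0 < β) (hl : 1 ≤ l)
    (r : ℝ≥0) (S : ℝ≥0∞) : r * S ≤ youngQStar p l β r + youngSeries p l β S := by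
  rcases eq_or_ne S ∞ with rfl | hS
  · rw [youngSeries_top hp hβ hl, add_top]
    exact le_top
  · lift S to ℝ≥0 using hS
    calc (r : ℝ≥0∞) * S = ENNReal.ofReal (((r : ℝ) * S - youngQ p l β S) + youngQ p l β S) := by
          rw [sub_add_cancel, ENNReal.ofReal_mul r.coe_nonneg]; simp
      _ ≤ ENNReal.ofReal ((r : ℝ) * S - youngQ p l β S) + ENNReal.ofReal (youngQ p l β S) :=
          ENNReal.ofReal_add_le
      _ ≤ _ := add_le_add (le_iSup (fun s : ℝ≥0 => ENNReal.ofReal ((r : ℝ) * s - youngQ p l β s)) S)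
          (ofReal_youngQ_le hp hβ hl S)

/-- Moments of Riesz potentials in terms of moments of the dyadic Wolff potential. -/
theorem exists_lintegral_rieszPotential_rpow_le {N : ℕ} {α p β : ℝ} (hα : 0 < α) (hp : 1 < p)
    (hβ : 1 ≤ β) (hαp : α * p < N) :
    ∃ B : ℝ, 0 < B ∧ ∀ q : ℕ, 1 ≤ q → 1 < β * q / (p - 1) →
      ∀ (ν : Measure (Space N)) [SFinite ν],
      ∫⁻ y, rieszPotential (α * p) ν y ^ (β * q / (p - 1)) ≤
        ENNReal.ofReal (B ^ (β * q / (p - 1)) * youngCoeff p β q) *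
          ∫⁻ y, dyadicPotential (N - α * p) (1 / (p - 1)) ν y ^ (β * q) := by
  have hp1 : 0 < p - 1 := sub_pos.2 hp
  have hβ0 : 0 < β := by linarith
  set d : ℝ := N - α * p with hd
  have hd0 : 0 < d := sub_pos.2 hαp
  have hαp0 : 0 < α * p := mul_pos hα (by linarith)
  have hN0 : N ≠ 0 := by
    rintro rfl
    rw [Nat.cast_zero] at hαp
    linarith
  set c : ℝ := d⁻¹ * 2 ^ d with hc
  have hc0 : 0 < c := by positivity
  have hR : ∀ (ν : Measure (Space N)) (y : Space N), rieszPotential (α * p) ν y ≤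
      ENNReal.ofReal c * ∑' j : ℤ, dyadicDensity d ν y j := by
    intro ν y
    refine (rieszPotential_le hαp ν y).trans_eq ?_
    rw [hc, ENNReal.ofReal_mul (by positivity), ENNReal.ofReal_inv_of_pos hd0,
      ← ENNReal.ofReal_rpow_of_pos two_pos, ENNReal.ofReal_ofNat]
  by_cases h2 : p = 2
  · refine ⟨c, hc0, fun q hq _ ν _ => ?_⟩
    have hq0 : (0 : ℝ) < q := by exact_mod_cast hq
    have e1 : β * q / (p - 1) = β * q := by rw [h2]; norm_num
    have e2 : 1 / (p - 1) = 1 := by rw [h2]; norm_num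
    rw [e1, e2, youngCoeff, if_pos h2, mul_one,
      ← ENNReal.ofReal_rpow_of_pos hc0, ← lintegral_const_mul' _ _ (by finiteness)]
    refine lintegral_mono fun y => ?_
    rw [← ENNReal.mul_rpow_of_nonneg _ _ (by positivity)]
    gcongr
    unfold dyadicPotential
    simpa using hR ν y
  · obtain ⟨C, hC, hW⟩ := exists_lintegral_rpow_tsum_density_le hN0 hd0
      (by rw [hd]; linarith : d < N)
    refine ⟨c * C * (β / (p - 1)), by positivity, fun q hq hs ν _ => ?_⟩
    have hq0 : (0 : ℝ) < q := by exact_mod_cast hq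
    have hq1 : (1 : ℝ) ≤ q := by exact_mod_cast hq
    set s : ℝ := β * q / (p - 1) with hsdef
    have hs0 : 0 < s := by linarith
    calc ∫⁻ y, rieszPotential (α * p) ν y ^ s
        ≤ ∫⁻ y, ENNReal.ofReal c ^ s * (∑' j : ℤ, dyadicDensity d ν y j) ^ s := by
          refine lintegral_mono fun y => ?_
          rw [← ENNReal.mul_rpow_of_nonneg _ _ hs0.le]
          gcongr
          exact hR ν y
      _ = ENNReal.ofReal c ^ s * ∫⁻ y, (∑' j : ℤ, dyadicDensity d ν y j) ^ s :=
          lintegral_const_mul' _ _ (by finiteness)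
      _ ≤ ENNReal.ofReal c ^ s * (ENNReal.ofReal ((C * s) ^ s) *
          ∫⁻ y, ∑' j : ℤ, dyadicDensity d ν y j ^ s) := by
          gcongr
          exact hW s hs ν
      _ ≤ ENNReal.ofReal c ^ s * (ENNReal.ofReal ((C * s) ^ s) *
          ∫⁻ y, dyadicPotential d (1 / (p - 1)) ν y ^ (β * q)) := by
          gcongr with y
          have h1 : 1 ≤ β * q := by nlinarith
          refine le_trans (le_of_eq (tsum_congr fun j => ?_)) (tsum_rpow_le_rpow_tsum
            (fun j => dyadicDensity d ν y j ^ (1 / (p - 1))) h1)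
          rw [← ENNReal.rpow_mul]
          congr 1
          rw [hsdef]; ring
      _ = _ := by
          rw [← mul_assoc, ENNReal.ofReal_rpow_of_pos hc0, ← ENNReal.ofReal_mul (by positivity),
            youngCoeff, if_neg h2, ← hsdef, ← Real.mul_rpow (by positivity) (by positivity),
            ← Real.mul_rpow (by positivity) (by positivity)]
          congr 3
          rw [hsdef]; field_simp

/-- The Young function of a small multiple of a Riesz potential is controlled by the exponential
of the dyadic Wolff potential. -/
theorem exists_lintegral_youngSeries_le {N : ℕ} {α p β : ℝ} {l : ℕ} (hα : 0 < α) (hp : 1 < p)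
    (hβ : 1 ≤ β) (hl : 1 ≤ l) (hαp : α * p < N) (hL : 1 < l * β * (1 / (p - 1))) :
    ∃ B : ℝ, 0 < B ∧ ∀ δ : ℝ, 0 < δ → ∀ (ν : Measure (Space N)) [SFinite ν],
      ∫⁻ y, youngSeries p l β (ENNReal.ofReal δ * rieszPotential (α * p) ν y) ≤
        ∫⁻ y, expTail l (ENNReal.ofReal ((B * δ) ^ (β / (p - 1))) *
          dyadicPotential (N - α * p) (1 / (p - 1)) ν y ^ β) := by
  obtain ⟨B, hB, h⟩ := exists_lintegral_rieszPotential_rpow_le hα hp hβ hαp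
  have hp1 : 0 < p - 1 := sub_pos.2 hp
  have hβ0 : 0 < β := by linarith
  refine ⟨B, hB, fun δ hδ ν _ => ?_⟩
  set d : ℝ := N - α * p with hd
  set D := dyadicPotential d (1 / (p - 1)) ν with hD
  have hmD : Measurable D := measurable_dyadicPotential _ _ _
  have hmI : Measurable (rieszPotential (α * p) ν) := measurable_rieszPotential _ _
  unfold youngSeries expTail
  rw [lintegral_tsum fun k => ((((hmI.const_mul _).pow_const _).div_const _)).aemeasurable,
    lintegral_tsum fun k =>
      ((((hmD.pow_const _).const_mul _).pow_const _).div_const _).aemeasurable]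
  refine ENNReal.tsum_le_tsum fun k => ?_
  set q : ℕ := k + l with hq
  have hq1 : 1 ≤ q := by omega
  have hq0 : (0 : ℝ) < q := by exact_mod_cast hq1
  have hlq : (l : ℝ) ≤ q := by rw [hq]; push_cast; linarith [(Nat.cast_nonneg k : (0 : ℝ) ≤ k)]
  set s : ℝ := β * q / (p - 1) with hs
  have hs1 : 1 < s := by
    refine hL.trans_le ?_
    have e : l * β * (1 / (p - 1)) = β * l / (p - 1) := by ring
    rw [e, hs]
    gcongr
  have hs0 : 0 < s := by linarith
  have hY := youngCoeff_pos p β (q := q) (by omega)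
  have hY' : ENNReal.ofReal (youngCoeff p β q) ≠ 0 := by simpa using hY
  calc ∫⁻ y, (ENNReal.ofReal δ * rieszPotential (α * p) ν y) ^ s /
        (ENNReal.ofReal (youngCoeff p β q) * (q.factorial : ℝ≥0∞))
      = (ENNReal.ofReal δ ^ s * ∫⁻ y, rieszPotential (α * p) ν y ^ s) /
        (ENNReal.ofReal (youngCoeff p β q) * (q.factorial : ℝ≥0∞)) := by
        simp only [div_eq_mul_inv, ENNReal.mul_rpow_of_nonneg _ _ hs0.le]
        rw [lintegral_mul_const _ ((hmI.pow_const _).const_mul _),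
          lintegral_const_mul _ (hmI.pow_const _)]
    _ ≤ (ENNReal.ofReal δ ^ s * (ENNReal.ofReal (B ^ s * youngCoeff p β q) *
        ∫⁻ y, D y ^ (β * q))) /
        (ENNReal.ofReal (youngCoeff p β q) * (q.factorial : ℝ≥0∞)) := by
        gcongr
        exact h q hq1 hs1 ν
    _ = (ENNReal.ofReal (youngCoeff p β q) *
        (ENNReal.ofReal ((B * δ) ^ s) * ∫⁻ y, D y ^ (β * q))) /
        (ENNReal.ofReal (youngCoeff p β q) * (q.factorial : ℝ≥0∞)) := by
        congr 1
        rw [ENNReal.ofReal_rpow_of_pos hδ, ← mul_assoc, ← mul_assoc,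
          ← ENNReal.ofReal_mul (by positivity), ← ENNReal.ofReal_mul hY.le,
          Real.mul_rpow hB.le hδ.le]
        congr 2; ring
    _ = (ENNReal.ofReal ((B * δ) ^ s) * ∫⁻ y, D y ^ (β * q)) / (q.factorial : ℝ≥0∞) :=
        ENNReal.mul_div_mul_left _ _ hY' ENNReal.ofReal_ne_top
    _ = _ := by
        have e : ∀ y, (ENNReal.ofReal ((B * δ) ^ (β / (p - 1))) * D y ^ β) ^ q =
            ENNReal.ofReal ((B * δ) ^ s) * D y ^ (β * q) := by
          intro y
          rw [mul_pow, ← ENNReal.ofReal_pow (by positivity), ← Real.rpow_natCast,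
            ← Real.rpow_mul (by positivity), ← ENNReal.rpow_natCast, ← ENNReal.rpow_mul]
          congr 3
          rw [hs]; ring
        simp only [e]
        simp only [div_eq_mul_inv]
        rw [lintegral_mul_const _ ((hmD.pow_const _).const_mul _),
          lintegral_const_mul _ (hmD.pow_const _)]

/-! ### The centred dyadic maximal function of a set with respect to a measure -/

/-- The largest proportion `ω(E ∩ B_{2^j}(x)) / ω(B_{2^j}(x))` of mass of dyadic balls around `x`
that lies in `E`. -/
noncomputable def massRatio {N : ℕ} (ω : Measure (Space N)) (E : Set (Space N)) (x : Space N) :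
    ℝ≥0∞ :=
  ⨆ j : ℤ, ω.restrict E (ball x ((2 : ℝ) ^ j)) / ω (ball x ((2 : ℝ) ^ j))

theorem massRatio_le_one {N : ℕ} (ω : Measure (Space N)) (E : Set (Space N)) (x : Space N) :
    massRatio ω E x ≤ 1 :=
  iSup_le fun _ => ENNReal.div_le_of_le_mul (by rw [one_mul]; exact Measure.restrict_le_self _)

theorem measurable_massRatio {N : ℕ} (ω : Measure (Space N)) [SFinite ω] (E : Set (Space N)) :
    Measurable (massRatio ω E) :=
  Measurable.iSup fun _ => (measurable_measure_ball _ _).div (measurable_measure_ball _ _)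

theorem restrict_ball_le_massRatio_mul {N : ℕ} (ω : Measure (Space N)) [IsLocallyFiniteMeasure ω]
    (E : Set (Space N)) (x : Space N) (j : ℤ) :
    ω.restrict E (ball x ((2 : ℝ) ^ j)) ≤ massRatio ω E x * ω (ball x ((2 : ℝ) ^ j)) := by
  have h : ω.restrict E (ball x ((2 : ℝ) ^ j)) / ω (ball x ((2 : ℝ) ^ j)) ≤ massRatio ω E x :=
    le_iSup (fun j : ℤ => ω.restrict E (ball x ((2 : ℝ) ^ j)) / ω (ball x ((2 : ℝ) ^ j))) j
  rcases eq_or_ne (ω (ball x ((2 : ℝ) ^ j))) 0 with h0 | h0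
  · have : ω.restrict E (ball x ((2 : ℝ) ^ j)) = 0 :=
      le_antisymm ((Measure.restrict_le_self _).trans h0.le) zero_le
    rw [this]; exact zero_le
  · exact (ENNReal.div_le_iff h0 measure_ball_lt_top.ne).1 h

theorem dyadicPotential_restrict_le {N : ℕ} (d : ℝ) {κ : ℝ} (hκ : 0 ≤ κ) (ω : Measure (Space N))
    [IsLocallyFiniteMeasure ω] (E : Set (Space N)) (x : Space N) :
    dyadicPotential d κ (ω.restrict E) x ≤ massRatio ω E x ^ κ * dyadicPotential d κ ω x := by
  unfold dyadicPotential
  rw [← ENNReal.tsum_mul_left]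
  refine ENNReal.tsum_le_tsum fun j => ?_
  rw [← ENNReal.mul_rpow_of_nonneg _ _ hκ]
  refine ENNReal.rpow_le_rpow ?_ hκ
  unfold dyadicDensity
  rw [← mul_assoc]
  gcongr
  exact restrict_ball_le_massRatio_mul ω E x j

/-- The weak type `(1,1)` bound for the centred maximal function. Its constant depends on the space
only, by the Besicovitch covering theorem. -/
theorem exists_measure_lt_massRatio_le (N : ℕ) :
    ∃ C : ℕ, ∀ (ω : Measure (Space N)) [IsLocallyFiniteMeasure ω] (E : Set (Space N)),
      ∀ t : ℝ≥0∞, t ≠ 0 → t ≠ ∞ →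
        ω {x | t < massRatio ω E x} ≤ C * (t⁻¹ * ω E) := by
  obtain ⟨C, τ, hτ, hC⟩ := HasBesicovitchCovering.no_satelliteConfig (α := Space N)
  refine ⟨C, fun ω _ E t ht0 htop => ?_⟩
  -- the radii are bounded first, as required by the covering theorem
  set S : ℕ → Set (Space N) := fun J => {x | ∃ j : ℤ, j ≤ J ∧
    t < ω.restrict E (ball x ((2 : ℝ) ^ j)) / ω (ball x ((2 : ℝ) ^ j))} with hS
  have hSmono : Monotone S := fun J J' h x ⟨j, hj, hx⟩ => ⟨j, hj.trans (by exact_mod_cast h), hx⟩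
  have hSU : {x | t < massRatio ω E x} = ⋃ J, S J := by
    ext x
    simp only [massRatio, mem_ofPred_eq, lt_iSup_iff, mem_iUnion, hS]
    constructor
    · rintro ⟨j, hj⟩
      exact ⟨j.toNat, j, Int.self_le_toNat j, hj⟩
    · rintro ⟨_, j, _, hj⟩
      exact ⟨j, hj⟩
  rw [hSU, hSmono.measure_iUnion]
  refine iSup_le fun J => ?_
  choose j hjJ hjt using fun x : S J => x.2
  let Q : Besicovitch.BallPackage (S J) (Space N) :=
    { c := fun x => x
      r := fun x => (2 : ℝ) ^ j x
      rpos := fun x => two_zpow_pos _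
      r_bound := (2 : ℝ) ^ (J : ℤ)
      r_le := fun x => zpow_le_zpow_right₀ one_le_two (hjJ x) }
  obtain ⟨s, hdisj, hcov⟩ := Besicovitch.exist_disjoint_covering_families hτ hC Q
  have hcov' : S J ⊆ ⋃ i : Fin C, ⋃ x ∈ s i, ball (x : Space N) ((2 : ℝ) ^ j x) := by
    intro x hx
    exact hcov ⟨⟨x, hx⟩, rfl⟩
  have hdisj' : ∀ i, (s i).PairwiseDisjoint fun x => ball (x : Space N) ((2 : ℝ) ^ j x) :=
    fun i => (hdisj i).mono fun x => ball_subset_closedBall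
  have hcount : ∀ i, (s i).Countable := fun i =>
    (hdisj' i).countable_of_isOpen (fun _ _ => isOpen_ball)
      (fun x _ => ⟨x, mem_ball_self (two_zpow_pos _)⟩)
  have hone : ∀ x : S J, ω (ball (x : Space N) ((2 : ℝ) ^ j x)) ≤
      t⁻¹ * ω.restrict E (ball (x : Space N) ((2 : ℝ) ^ j x)) := by
    intro x
    have h1 := (hjt x).le
    rw [mul_comm, ← div_eq_mul_inv, ENNReal.le_div_iff_mul_le (Or.inl ht0) (Or.inl htop)]
    rw [mul_comm]
    exact ENNReal.mul_le_of_le_div h1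
  calc ω (S J) ≤ ω (⋃ i : Fin C, ⋃ x ∈ s i, ball (x : Space N) ((2 : ℝ) ^ j x)) :=
        measure_mono hcov'
    _ ≤ ∑ i : Fin C, ω (⋃ x ∈ s i, ball (x : Space N) ((2 : ℝ) ^ j x)) :=
        measure_iUnion_fintype_le _ _
    _ ≤ ∑ _i : Fin C, t⁻¹ * ω E := by
        refine Finset.sum_le_sum fun i _ => ?_
        calc ω (⋃ x ∈ s i, ball (x : Space N) ((2 : ℝ) ^ j x))
            ≤ ∑' x : s i, ω (ball (x : Space N) ((2 : ℝ) ^ j x)) :=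
              measure_biUnion_le _ (hcount i) _
          _ ≤ ∑' x : s i, t⁻¹ * ω.restrict E (ball (x : Space N) ((2 : ℝ) ^ j x)) :=
              ENNReal.tsum_le_tsum fun x => hone x
          _ = t⁻¹ * ω.restrict E (⋃ x ∈ s i, ball (x : Space N) ((2 : ℝ) ^ j x)) := by
              rw [ENNReal.tsum_mul_left, measure_biUnion (hcount i) (hdisj' i)
                fun _ _ => measurableSet_ball]
          _ ≤ t⁻¹ * ω E := by
              exact mul_le_mul_right
                ((measure_mono (subset_univ _)).trans_eq (Measure.restrict_apply_univ _)) _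
    _ = _ := by simp

/-- The strong type bound, from the weak type bound and `massRatio ≤ 1`. -/
theorem exists_lintegral_massRatio_rpow_le (N : ℕ) {L : ℝ} (hL : 1 < L) :
    ∃ C : ℝ, 0 < C ∧ ∀ (ω : Measure (Space N)) [IsLocallyFiniteMeasure ω] (E : Set (Space N)),
      ∫⁻ x, massRatio ω E x ^ L ∂ω ≤ ENNReal.ofReal C * ω E := by
  obtain ⟨C, hC⟩ := exists_measure_lt_massRatio_le N
  set A : ℝ≥0∞ := (∑' k : ℕ, (2 : ℝ≥0∞) ^ (-(L - 1) * k)) * (2 * C) with hA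
  have hAtop : A ≠ ∞ :=
    ENNReal.mul_ne_top (tsum_two_rpow_ne_top (by linarith)) (by finiteness)
  refine ⟨A.toReal + 1, by positivity, fun ω _ E => ?_⟩
  have hL0 : 0 < L := by linarith
  set S : ℕ → Set (Space N) := fun k => {x | (2 : ℝ≥0∞) ^ (-((k : ℝ) + 1)) < massRatio ω E x}
    with hS
  have hSm : ∀ k, MeasurableSet (S k) := fun k =>
    measurableSet_lt measurable_const (measurable_massRatio ω E)
  have hpt : ∀ x, massRatio ω E x ^ L ≤
      ∑' k : ℕ, (2 : ℝ≥0∞) ^ (-L * k) * (S k).indicator 1 x := by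
    intro x
    rcases eq_or_ne (massRatio ω E x) 0 with h0 | h0
    · rw [h0, ENNReal.zero_rpow_of_pos hL0]; exact zero_le
    have htop : massRatio ω E x ≠ ∞ := ne_top_of_le_ne_top ENNReal.one_ne_top
      (massRatio_le_one ω E x)
    have hex : ∃ k : ℕ, (2 : ℝ≥0∞) ^ (-((k : ℝ) + 1)) < massRatio ω E x := by
      obtain ⟨n, hn⟩ := ENNReal.exists_inv_two_pow_lt h0
      refine ⟨n, lt_of_le_of_lt ?_ hn⟩
      rw [← ENNReal.inv_pow, ← ENNReal.rpow_natCast, ← ENNReal.rpow_neg]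
      exact two_rpow_mono (by linarith)
    classical
    set k := Nat.find hex with hk
    have hk1 : (2 : ℝ≥0∞) ^ (-((k : ℝ) + 1)) < massRatio ω E x := Nat.find_spec hex
    have hk2 : massRatio ω E x ≤ 2 ^ (-(k : ℝ)) := by
      rcases Nat.eq_zero_or_pos k with h | h
      · rw [h]; simpa using massRatio_le_one ω E x
      · have := Nat.find_min hex (m := k - 1) (by omega)
        push Not at this
        have e : ((k - 1 : ℕ) : ℝ) + 1 = k := by
          rw [Nat.cast_sub (by omega)]; simp
        rwa [e] at this
    refine le_trans ?_ (ENNReal.le_tsum k)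
    rw [indicator_of_mem (by exact hk1), Pi.one_apply, mul_one]
    calc massRatio ω E x ^ L ≤ (2 ^ (-(k : ℝ))) ^ L := by gcongr
      _ = _ := by rw [← ENNReal.rpow_mul]; congr 1; ring
  calc ∫⁻ x, massRatio ω E x ^ L ∂ω
      ≤ ∫⁻ x, ∑' k : ℕ, (2 : ℝ≥0∞) ^ (-L * k) * (S k).indicator 1 x ∂ω := lintegral_mono hpt
    _ = ∑' k : ℕ, (2 : ℝ≥0∞) ^ (-L * k) * ω (S k) := by
        rw [lintegral_tsum fun k => ((measurable_one.indicator (hSm k)).const_mul _).aemeasurable]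
        refine tsum_congr fun k => ?_
        rw [lintegral_const_mul _ (measurable_one.indicator (hSm k)),
          lintegral_indicator_one (hSm k)]
    _ ≤ ∑' k : ℕ, (2 : ℝ≥0∞) ^ (-(L - 1) * k) * (2 * C * ω E) := by
        refine ENNReal.tsum_le_tsum fun k => ?_
        calc (2 : ℝ≥0∞) ^ (-L * k) * ω (S k)
            ≤ (2 : ℝ≥0∞) ^ (-L * k) * (C * (((2 : ℝ≥0∞) ^ (-((k : ℝ) + 1)))⁻¹ * ω E)) := by
              gcongr
              exact hC ω E _ (two_rpow_ne_zero _) (two_rpow_ne_top _)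
          _ = ((2 : ℝ≥0∞) ^ (-L * k) * 2 ^ ((k : ℝ) + 1)) * (C * ω E) := by
              rw [← ENNReal.rpow_neg, neg_neg]; ring
          _ = _ := by
              have e : -L * k + ((k : ℝ) + 1) = -(L - 1) * k + 1 := by ring
              rw [← two_rpow_add, e, two_rpow_add, ENNReal.rpow_one]
              ring
    _ = A * ω E := by rw [ENNReal.tsum_mul_right, hA]; ring
    _ ≤ _ := by
        gcongr
        rw [← ENNReal.ofReal_toReal hAtop]
        exact ENNReal.ofReal_le_ofReal (by rw [ENNReal.toReal_ofReal ENNReal.toReal_nonneg]; linarith)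

/-! ### The capacitary estimate -/

/-- The energy estimate behind the capacitary bound: if the exponential of the Wolff potential of
`ω` is dominated by `ω`, then for every set `E` the Young function of `δ I[ω|_E]` has integral at
most `C δ^(lβ/(p-1)) ω(E)`, for `δ` small. -/
theorem exists_lintegral_youngSeries_restrict_le {N : ℕ} {α p a β : ℝ} {l : ℕ} (hα : 0 < α)
    (hp : 1 < p) (ha : 0 < a) (hl : 1 ≤ l) (hβ : 1 ≤ β) (hαp : α * p < N)
    (hL : 1 < l * β * (1 / (p - 1))) :
    ∃ C : ℝ, 0 < C ∧ ∃ δ₀ : ℝ, 0 < δ₀ ∧ ∀ δ : ℝ, 0 < δ → δ ≤ δ₀ →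
      ∀ (ω : Measure (Space N)) [IsLocallyFiniteMeasure ω],
      volume.withDensity (fun x => reaction l a β (wolff α p ω x)) ≤ ω →
      ∀ E : Set (Space N),
        ∫⁻ y, youngSeries p l β (ENNReal.ofReal δ * rieszPotential (α * p) (ω.restrict E) y) ≤
          ENNReal.ofReal (C * δ ^ (l * β * (1 / (p - 1)))) * ω E := by
  have hp1 : 0 < p - 1 := sub_pos.2 hp
  have hβ0 : 0 < β := by linarith
  set d : ℝ := N - α * p with hd
  set κ : ℝ := 1 / (p - 1) with hκ
  have hκ0 : 0 < κ := one_div_pos.2 hp1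
  obtain ⟨B, hB, hY⟩ := exists_lintegral_youngSeries_le hα hp hβ hl hαp hL
  obtain ⟨C, hC, hM⟩ := exists_lintegral_massRatio_rpow_le N hL
  have hβκ : β / (p - 1) = β * κ := by rw [hκ]; ring
  rw [hβκ] at hY
  -- `c` compares the dyadic and the continuous Wolff potentials
  set c : ℝ := (2 ^ (d * κ + 1)) ^ β / a with hc
  have hc0 : 0 < c := by positivity
  refine ⟨C * (c * B ^ (β * κ)) ^ l, by positivity, (c * B ^ (β * κ))⁻¹ ^ (β * κ)⁻¹,
    by positivity, fun δ hδ hδ₀ ω _ hω E => ?_⟩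
  set z : ℝ := c * (B * δ) ^ (β * κ) with hz
  have hz0 : 0 < z := by positivity
  have hz1 : z ≤ 1 := by
    calc z = c * B ^ (β * κ) * δ ^ (β * κ) := by
          rw [hz, Real.mul_rpow hB.le hδ.le]; ring
      _ ≤ c * B ^ (β * κ) * ((c * B ^ (β * κ))⁻¹ ^ (β * κ)⁻¹) ^ (β * κ) := by gcongr
      _ = 1 := by
          rw [Real.rpow_inv_rpow (by positivity) (by positivity)]
          field_simp
  set r := massRatio ω E with hr
  have hrm : Measurable r := measurable_massRatio ω E
  have hWm : Measurable fun x => reaction l a β (wolff α p ω x) :=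
    (measurable_reaction hl ha hβ0).comp (measurable_wolff α p ω)
  have hpt : ∀ y, expTail l (ENNReal.ofReal ((B * δ) ^ (β * κ)) *
      dyadicPotential d κ (ω.restrict E) y ^ β) ≤
      ENNReal.ofReal (z ^ l) * (reaction l a β (wolff α p ω y) * r y ^ (l * β * κ)) := by
    intro y
    have hD : dyadicPotential d κ (ω.restrict E) y ≤
        r y ^ κ * (2 ^ (d * κ + 1) * wolff α p ω y) :=
      (dyadicPotential_restrict_le d hκ0.le ω E y).trans
        (mul_le_mul_right (dyadicPotential_le_wolff α hp hαp ω y) _)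
    calc expTail l (ENNReal.ofReal ((B * δ) ^ (β * κ)) *
          dyadicPotential d κ (ω.restrict E) y ^ β)
        ≤ expTail l (ENNReal.ofReal z * r y ^ (β * κ) *
          (ENNReal.ofReal a * wolff α p ω y ^ β)) := by
          refine expTail_mono l ?_
          calc ENNReal.ofReal ((B * δ) ^ (β * κ)) * dyadicPotential d κ (ω.restrict E) y ^ β
              ≤ ENNReal.ofReal ((B * δ) ^ (β * κ)) *
                (r y ^ κ * (2 ^ (d * κ + 1) * wolff α p ω y)) ^ β := by gcongr
            _ = (ENNReal.ofReal ((B * δ) ^ (β * κ)) * ENNReal.ofReal ((2 ^ (d * κ + 1)) ^ β)) *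
                r y ^ (β * κ) * wolff α p ω y ^ β := by
                have e2 : ENNReal.ofReal ((2 ^ (d * κ + 1)) ^ β) = (2 ^ (d * κ + 1)) ^ β := by
                  rw [← ENNReal.ofReal_rpow_of_pos (by positivity),
                    ← ENNReal.ofReal_rpow_of_pos two_pos, ENNReal.ofReal_ofNat]
                rw [ENNReal.mul_rpow_of_nonneg _ _ hβ0.le, ENNReal.mul_rpow_of_nonneg _ _ hβ0.le,
                  ← ENNReal.rpow_mul, mul_comm κ β, e2]
                ring
            _ = (ENNReal.ofReal z * ENNReal.ofReal a) * r y ^ (β * κ) * wolff α p ω y ^ β := by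
                rw [← ENNReal.ofReal_mul (by positivity), ← ENNReal.ofReal_mul hz0.le]
                congr 3
                rw [hz, hc]; field_simp
            _ = _ := by ring
      _ ≤ (ENNReal.ofReal z * r y ^ (β * κ)) ^ l *
          expTail l (ENNReal.ofReal a * wolff α p ω y ^ β) := by
          refine expTail_mul_le l (mul_le_one' (by simpa using hz1) ?_) _
          exact ENNReal.rpow_le_one (massRatio_le_one ω E y) (by positivity)
      _ = _ := by
          rw [mul_pow, ← ENNReal.ofReal_pow hz0.le, ← ENNReal.rpow_natCast (r y ^ (β * κ)),
            ← ENNReal.rpow_mul, reaction_eq_expTail hl ha hβ0]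
          have e : β * κ * l = l * β * κ := by ring
          rw [e]; ring
  calc ∫⁻ y, youngSeries p l β (ENNReal.ofReal δ * rieszPotential (α * p) (ω.restrict E) y)
      ≤ ∫⁻ y, expTail l (ENNReal.ofReal ((B * δ) ^ (β * κ)) *
          dyadicPotential d κ (ω.restrict E) y ^ β) := hY δ hδ (ω.restrict E)
    _ ≤ ∫⁻ y, ENNReal.ofReal (z ^ l) *
          (reaction l a β (wolff α p ω y) * r y ^ (l * β * κ)) := lintegral_mono hpt
    _ = ENNReal.ofReal (z ^ l) *
          ∫⁻ y, r y ^ (l * β * κ) ∂(volume.withDensity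
            fun x => reaction l a β (wolff α p ω x)) := by
        rw [lintegral_const_mul' _ _ ENNReal.ofReal_ne_top,
          lintegral_withDensity_eq_lintegral_mul _ hWm (hrm.pow_const _)]
        rfl
    _ ≤ ENNReal.ofReal (z ^ l) * (ENNReal.ofReal C * ω E) := by
        gcongr
        exact (lintegral_mono' hω le_rfl).trans (hM ω E)
    _ = _ := by
        rw [← mul_assoc, ← ENNReal.ofReal_mul (by positivity)]
        congr 2
        rw [hz, Real.mul_rpow hB.le hδ.le, ← mul_assoc, mul_pow, ← Real.rpow_natCast (δ ^ (β * κ)),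
          ← Real.rpow_mul hδ.le]
        have e : β * κ * l = l * β * κ := by ring
        rw [e]; ring

/-- A test function for the capacity of `E` is integrated against `ω|_E`. -/
theorem measure_le_lintegral_mul_rieszPotential {N : ℕ} (γ : ℝ) (ω : Measure (Space N)) [SFinite ω]
    {E : Set (Space N)} (hE : MeasurableSet E) {g : Space N → ℝ≥0} (hg : AEMeasurable g volume)
    (hgE : ∀ x, E.indicator (fun _ => (1 : ℝ≥0∞)) x ≤
      ∫⁻ y, rieszKernel γ (x - y) * (g y : ℝ≥0∞)) :
    ω E ≤ ∫⁻ y, g y * rieszPotential γ (ω.restrict E) y := by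
  have hk : Measurable fun q : Space N × Space N => rieszKernel γ (q.1 - q.2) :=
    (measurable_rieszKernel γ).comp (measurable_fst.sub measurable_snd)
  obtain ⟨g', hg'm, hae⟩ := hg
  calc ω E = ∫⁻ x in E, 1 ∂ω := (setLIntegral_one E).symm
    _ ≤ ∫⁻ x in E, (∫⁻ y, rieszKernel γ (x - y) * (g' y : ℝ≥0∞)) ∂ω := by
        refine setLIntegral_mono' hE fun x hx => ?_
        have := hgE x
        rw [indicator_of_mem hx] at this
        refine this.trans_eq (lintegral_congr_ae ?_)
        filter_upwards [hae] with y hy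
        rw [hy]
    _ = ∫⁻ y, (∫⁻ x in E, rieszKernel γ (x - y) * (g' y : ℝ≥0∞) ∂ω) := by
        refine lintegral_lintegral_swap (Measurable.aemeasurable ?_)
        exact hk.mul ((hg'm.comp measurable_snd).coe_nnreal_ennreal)
    _ = ∫⁻ y, g y * rieszPotential γ (ω.restrict E) y := by
        refine lintegral_congr_ae ?_
        filter_upwards [hae] with y hy
        rw [lintegral_mul_const' _ _ ENNReal.coe_ne_top, mul_comm, hy]
        rfl

/-- A measure that dominates the exponential of its Wolff potential is dominated by the capacity. -/
theorem exists_measure_le_rieszCapacity {N : ℕ} {α p a β : ℝ} {l : ℕ} (hα : 0 < α)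
    (hp : 1 < p) (ha : 0 < a) (hl : 1 ≤ l) (hβ : 1 ≤ β) (hαp : α * p < N)
    (hL : 1 < l * β * (1 / (p - 1))) :
    ∃ C : ℝ, 0 < C ∧ ∀ (ω : Measure (Space N)) [IsLocallyFiniteMeasure ω],
      volume.withDensity (fun x => reaction l a β (wolff α p ω x)) ≤ ω →
      ∀ E : Set (Space N), MeasurableSet E →
        ω E ≤ ENNReal.ofReal C * rieszCapacity (α * p) p l β E := by
  obtain ⟨C, hC, δ₀, hδ₀, h⟩ := exists_lintegral_youngSeries_restrict_le hα hp ha hl hβ hαp hL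
  have hβ0 : 0 < β := by linarith
  set L : ℝ := l * β * (1 / (p - 1)) with hLdef
  have hL1 : 0 < L - 1 := by linarith
  set δ : ℝ := min δ₀ ((2 * C)⁻¹ ^ (L - 1)⁻¹) with hδ
  have hδ0 : 0 < δ := lt_min hδ₀ (by positivity)
  have hCδ : C * δ ^ L ≤ δ / 2 := by
    have h1 : δ ^ (L - 1) ≤ (2 * C)⁻¹ := by
      calc δ ^ (L - 1) ≤ ((2 * C)⁻¹ ^ (L - 1)⁻¹) ^ (L - 1) := by
            gcongr; exact min_le_right _ _
        _ = _ := Real.rpow_inv_rpow (by positivity) hL1.ne'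
    have h2 : δ ^ L = δ ^ (L - 1) * δ := by
      rw [Real.rpow_sub_one hδ0.ne']; field_simp
    calc C * δ ^ L ≤ C * ((2 * C)⁻¹ * δ) := by rw [h2]; gcongr
      _ = δ / 2 := by field_simp
  refine ⟨2 / δ, by positivity, fun ω _ hω E hE => ?_⟩
  -- bounded sets have finite mass, which allows to absorb the energy term
  have hbdd : ∀ E' : Set (Space N), MeasurableSet E' → ω E' ≠ ∞ → E' ⊆ E →
      ω E' ≤ ENNReal.ofReal (2 / δ) * rieszCapacity (α * p) p l β E := by
    intro E' hE' hfin hsub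
    have h0 : ENNReal.ofReal (2 / δ) ≠ 0 := by simpa using (by positivity : 0 < 2 / δ)
    rw [mul_comm, ← ENNReal.div_le_iff_le_mul (Or.inl h0) (Or.inl ENNReal.ofReal_ne_top)]
    refine le_sInf fun Q hQ => ENNReal.div_le_of_le_mul' ?_
    obtain ⟨g, hg, hgE, _, rfl⟩ := hQ
    have h1 : ω E' ≤ ∫⁻ y, g y * rieszPotential (α * p) (ω.restrict E') y :=
      measure_le_lintegral_mul_rieszPotential _ ω hE' hg fun x =>
        (indicator_le_indicator_of_subset hsub (fun _ => zero_le) x).trans (hgE x)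
    have hm : Measurable fun y => youngSeries p l β
        (ENNReal.ofReal δ * rieszPotential (α * p) (ω.restrict E') y) :=
      (measurable_youngSeries p l β).comp ((measurable_rieszPotential _ _).const_mul _)
    have h2 : ENNReal.ofReal δ * ω E' ≤
        (∫⁻ y, youngQStar p l β (g y)) + ENNReal.ofReal (δ / 2) * ω E' := by
      calc ENNReal.ofReal δ * ω E'
          ≤ ENNReal.ofReal δ * ∫⁻ y, g y * rieszPotential (α * p) (ω.restrict E') y := by gcongr
        _ = ∫⁻ y, g y * (ENNReal.ofReal δ * rieszPotential (α * p) (ω.restrict E') y) := by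
            rw [← lintegral_const_mul' _ _ ENNReal.ofReal_ne_top]
            exact lintegral_congr fun y => mul_left_comm _ _ _
        _ ≤ ∫⁻ y, (youngQStar p l β (g y) + youngSeries p l β
            (ENNReal.ofReal δ * rieszPotential (α * p) (ω.restrict E') y)) :=
            lintegral_mono fun y => mul_le_youngQStar_add hp hβ0 hl _ _
        _ ≤ _ := by
            rw [lintegral_add_right _ hm]
            gcongr
            refine (h δ hδ0 (min_le_left _ _) ω hω E').trans ?_
            gcongr
    have h3 : ENNReal.ofReal (δ / 2) * ω E' ≤ ∫⁻ y, youngQStar p l β (g y) := by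
      have e : ENNReal.ofReal δ = ENNReal.ofReal (δ / 2) + ENNReal.ofReal (δ / 2) := by
        rw [← ENNReal.ofReal_add (by positivity) (by positivity)]; congr 1; ring
      rw [e, add_mul] at h2
      exact (ENNReal.add_le_add_iff_right (ENNReal.mul_ne_top ENNReal.ofReal_ne_top hfin)).1 h2
    calc ω E' = ENNReal.ofReal (2 / δ) * (ENNReal.ofReal (δ / 2) * ω E') := by
          rw [← mul_assoc, ← ENNReal.ofReal_mul (by positivity)]
          have : 2 / δ * (δ / 2) = 1 := by field_simp
          rw [this, ENNReal.ofReal_one, one_mul]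
      _ ≤ _ := by gcongr
  have hU : E = ⋃ n : ℕ, E ∩ ball (0 : Space N) n := by
    rw [← inter_iUnion, iUnion_ball_nat, inter_univ]
  have hmono : Monotone fun n : ℕ => E ∩ ball (0 : Space N) n := fun m n hmn =>
    inter_subset_inter_right _ (ball_subset_ball (by exact_mod_cast hmn))
  calc ω E = ⨆ n : ℕ, ω (E ∩ ball (0 : Space N) n) := by
        conv_lhs => rw [hU]
        exact hmono.measure_iUnion
    _ ≤ _ := iSup_le fun n => hbdd _ (hE.inter measurableSet_ball)
        (measure_ne_top_of_subset inter_subset_right measure_ball_lt_top.ne) inter_subset_left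

theorem exists_le_rieszCapacity_of_solution {N : ℕ} {α p a β : ℝ} {l : ℕ} (hα : 0 < α)
    (hp : 1 < p) (ha : 0 < a) (hl : 1 ≤ l) (hβ : 1 ≤ β) (hαp : α * p < N)
    (hlβ : (N : ℝ) * (p - 1) / ((N : ℝ) - α * p) < (l : ℝ) * β) :
    ∃ C : ℝ, 0 < C ∧ ∀ (f u : Space N → ℝ≥0∞) (μ : Measure (Space N)),
      IsLocallyFiniteMeasure μ → ∫⁻ x, reaction l a β (u x) ≠ ∞ →
      (∀ᵐ x ∂(volume : Measure (Space N)),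
        u x = wolff α p (reactionMeasure l a β u + μ) x + f x) →
      ∀ E : Set (Space N), MeasurableSet E →
        (∫⁻ x in E, reaction l a β (u x)) + (∫⁻ x in E, reaction l a β (f x)) + μ E ≤
          ENNReal.ofReal C * rieszCapacity (α * p) p l β E := by
  have hp1 : 0 < p - 1 := sub_pos.2 hp
  have hd0 : 0 < (N : ℝ) - α * p := sub_pos.2 hαp
  have hβ0 : 0 < β := by linarith
  have hL : 1 < l * β * (1 / (p - 1)) := by
    rw [mul_one_div, lt_div_iff₀ hp1, one_mul]
    refine lt_of_le_of_lt ?_ hlβ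
    rw [le_div_iff₀ hd0]
    nlinarith [mul_pos hα (by linarith : 0 < p)]
  obtain ⟨C, hC, h⟩ := exists_measure_le_rieszCapacity hα hp ha hl hβ hαp hL
  refine ⟨2 * C, by positivity, fun f u μ hμ hu heq E hE => ?_⟩
  set ω := reactionMeasure l a β u + μ with hω
  have hfin : IsFiniteMeasure (reactionMeasure l a β u) := isFiniteMeasure_withDensity hu
  have hloc : IsLocallyFiniteMeasure ω := ⟨fun x => by
    obtain ⟨s, hs, hμs⟩ := μ.finiteAt_nhds x
    exact ⟨s, hs, ENNReal.add_lt_top.2 ⟨measure_lt_top _ s, hμs⟩⟩⟩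
  have hmono := reaction_mono hl ha hβ0
  have hωE : (∫⁻ x in E, reaction l a β (u x)) + μ E = ω E := by
    rw [hω, Measure.add_apply, reactionMeasure, withDensity_apply _ hE]
  have hdom : volume.withDensity (fun x => reaction l a β (wolff α p ω x)) ≤ ω := by
    refine le_trans (withDensity_mono ?_) (Measure.le_add_right le_rfl)
    filter_upwards [heq] with x hx
    exact hmono (hx ▸ le_self_add)
  have hf : ∫⁻ x in E, reaction l a β (f x) ≤ ω E := by
    rw [← hωE]
    refine le_trans (lintegral_mono_ae ?_) le_self_add
    filter_upwards [ae_restrict_of_ae heq] with x hx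
    exact hmono (hx ▸ le_add_self)
  calc (∫⁻ x in E, reaction l a β (u x)) + (∫⁻ x in E, reaction l a β (f x)) + μ E
      = ω E + ∫⁻ x in E, reaction l a β (f x) := by rw [← hωE]; ring
    _ ≤ ω E + ω E := by gcongr
    _ = 2 * ω E := (two_mul _).symm
    _ ≤ 2 * (ENNReal.ofReal C * rieszCapacity (α * p) p l β E) := by
        gcongr; exact h ω hdom E hE
    _ = _ := by rw [ENNReal.ofReal_mul zero_le_two, ENNReal.ofReal_ofNat, mul_assoc]

end WolffExp

open WolffExp in
theorem theorem1p6 (N : ℕ) (α p a β : ℝ) (l : ℕ)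
    (hα : 0 < α) (hp : 1 < p) (ha : 0 < a) (hl : 1 ≤ l) (hβ : 1 ≤ β)
    (hαp : α * p < (N : ℝ))
    (hlβ : (N : ℝ) * (p - 1) / ((N : ℝ) - α * p) < (l : ℝ) * β) :
    (∀ ε : ℝ, 0 < ε → ∀ R : ℝ, 0 < R → ∃ M : ℝ, 0 < M ∧
      ∀ (f : EuclideanSpace ℝ (Fin N) → ℝ≥0∞) (μ : Measure (EuclideanSpace ℝ (Fin N))),
        AEMeasurable f volume → IsLocallyFiniteMeasure μ →
        (∀ᵐ x ∂(volume : Measure (EuclideanSpace ℝ (Fin N))),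
          x ∉ ball (0 : EuclideanSpace ℝ (Fin N)) R → f x = 0) →
        μ (ball (0 : EuclideanSpace ℝ (Fin N)) R)ᶜ = 0 →
        (∀ K : Set (EuclideanSpace ℝ (Fin N)), IsCompact K →
          ∫⁻ x in K, reaction l (a + ε) β (f x) ≠ ∞) →
        maximalNorm α p β μ ≤ ENNReal.ofReal M →
        maximalNorm α p β (reactionMeasure l (a + ε) β f) ≤ ENNReal.ofReal M →
        ∃ u : EuclideanSpace ℝ (Fin N) → ℝ≥0∞,
          AEMeasurable u volume ∧
          ∫⁻ x, reaction l a β (u x) ≠ ∞ ∧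
          (∀ x, u x = wolff α p (reactionMeasure l a β u + μ) x + f x) ∧
          (∀ x, u x ≤ upperBound α p l a β ε R M f μ x) ∧
          ∫⁻ x, reaction l a β (upperBound α p l a β ε R M f μ x) ≠ ∞) ∧
    (∃ C : ℝ, 0 < C ∧
      ∀ (f u : EuclideanSpace ℝ (Fin N) → ℝ≥0∞) (μ : Measure (EuclideanSpace ℝ (Fin N))),
        AEMeasurable f volume → AEMeasurable u volume → IsLocallyFiniteMeasure μ →
        ∫⁻ x, reaction l a β (u x) ≠ ∞ →
        (∀ᵐ x ∂(volume : Measure (EuclideanSpace ℝ (Fin N))),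
          u x = wolff α p (reactionMeasure l a β u + μ) x + f x) →
        ∀ E : Set (EuclideanSpace ℝ (Fin N)), MeasurableSet E →
          (∫⁻ x in E, reaction l a β (u x)) + (∫⁻ x in E, reaction l a β (f x)) + μ E ≤
            ENNReal.ofReal C * rieszCapacity (α * p) p l β E) := by
  obtain ⟨C, hC, h⟩ := exists_le_rieszCapacity_of_solution hα hp ha hl hβ hαp hlβ
  exact ⟨fun ε hε R hR => exists_solution hα hp ha hl hβ hαp hlβ hε hR,
    C, hC, fun f u μ _ _ hμ hu heq E hE => h f u μ hμ hu heq E hE⟩
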